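/- **Sequences.** A *block* is a sequence of distinct symbols; an $m$-block sequence is a concatenation of at most $m$ (possibly empty) blocks. A sequence is an *order-$s$ DS sequence* if it has no (not necessarily contiguous) subsequence $abab\cdots$ of length $s+2$ with $a\ne b$. For $m\ge 1$, $\lambda_s(n,m)$ is the maximum length of an $m$-block order-$s$ DS sequence over an $n$-letter alphabet (all letters used). **Ackermann function.** For $i,j\ge 1$: $a_{1,j}=2^j$; $a_{i,1}=2$ for $i\ge 2$; $a_{i,j}=w\cdot a_{i-1,w}$ with $w=a_{i,j-1}$ for $i,j\ge 2$. **Derivation trees.** For an $m$-block sequence $S$ and an integer $r\ge1$ with $2^r<m$, cut $S$ into $\hat m=\lceil m/2^r\rceil$ intervals $S_1,\dots,S_{\hat m}$ of $2^r$ consecutive blocks (the last may be shorter). A symbol is *local* to $S_q$ if it appears in no other interval, and *global* if it is local to no interval. Let $\check S_q$ be the projection of $S_q$ onto its local symbols, let $\acute S_q$ (resp. $\grave S_q$) be its projection onto the global symbols that appear in no earlier (resp. no later) interval, and let $\hat S'$ be the $\hat m$-block sequence whose $q$th block consists of the global symbols in $S_q$. A *(permissible) derivation tree* $\mathcal T$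 of $S$ is a rooted ordered tree whose nodes $v$ other than the root carry blocks $\mathcal B(v)$ (regarded as sets), the $p$th leaf carrying the $p$th block of $S$. If $m\le 2$ it is a root with the blocks of $S$ as its leaf children; the root carries no block. If $m>2$, choose $r$ as above and derivation trees $\hat{\mathcal T}$ of $\hat S'$ and $\check{\mathcal T}_q$ of $\check S_q$, identify the root of $\check{\mathcal T}_q$ with the $q$th leaf $x_q$ of $\hat{\mathcal T}$ (which keeps its block), and put the blocks of $S$ at the leaves. If all choices are of this kind, the resulting tree structure (with one-child nodes allowed on the rightmost path so that all leaves have equal depth) depends only on $m$. In a derivation tree *ensemble* one also chooses, in each such composition (including those made in building $\hat{\mathcal T}$ and the $\check{\mathcal T}_q$), derivation trees $\acute{\mathcal T}[x_q]$ of $\acute S_q$ and $\grave{\mathcal T}[x_q]$ of $\grave S_q$, whose leaves are identified with the leaves below $x_q$ of the tree being composed. **Feathers.** For a symbol $a$ occurring at least twice, the *crown* of $a$ is the root of the base tree ($m\le 2$) reached from $S$ by passing to $\hat S'$ while $a$ is global and to $\check S_q$ when $a$ is local to $S_q$; the two children of the crown are the left and right *heads* of $a$. Let $\mathcal T_{|a}$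 consist of the crown and of all $v$ with $a\in\mathcal B(v)$, with the ancestor relation of $\mathcal T$. The leftmost and rightmost leaves of $\mathcal T_{|a}$ are the dove and hawk *wingtips*; nodes descending from the left (right) head are *doves* (*hawks*); the left (right) *wing* is the path from the left (right) head to the dove (hawk) wingtip. A *quill* is a child in $\mathcal T_{|a}$ of a wing node that is not itself on the wing. A leaf is a *dove (hawk) feather* if it is the rightmost (leftmost) leaf descendant in $\mathcal T_{|a}$ of a dove (hawk) quill. A dove feather with quill $z$ and $w$ the parent of $z$ is a *double-feather* if $z$, as a leaf of $\acute{\mathcal T}[w]_{|a}$, is a dove feather or the hawk wingtip; a hawk feather is a double-feather if $z$, as a leaf of $\grave{\mathcal T}[w]_{|a}$, is a hawk feather or the dove wingtip. Symbols that occur only once have no feathers. Feathers and double-feathers are counted as occurrences of symbols in $S$. Let $\Phi'(n,m)$ be the maximum, over all $m$-block order-$4$ DS sequences $S$ over an $n$-letter alphabet and over both types (dove or hawk), of the minimum over all permissible derivation trees of $S$ of the number of feathers of that type. Let $\Phi''(n,m)$ be the maximum, over all $m$-block order-$5$ DS sequences $S$ over an $n$-letter alphabet, of the minimum over all permissible derivation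 tree ensembles of $S$ of the number of double-feathers (of both types together). **Lemma.** Let $n\ge 0$ and $m\ge 1$, let $i\ge 1$ be any integer, let $c=3$, and let $j\ge 1$ be minimum such that $m\le a_{i,j}^{c}$. Then $$\Phi'(n,m)\le \Bigl(3\tbinom{i+1}{2}+3\Bigr)\bigl(n+(cj)^2(m-1)\bigr),$$ $$\Phi''(n,m)\le \Bigl(6\tbinom{i+2}{3}+8i\Bigr)\bigl(n+(cj)^3(m-1)\bigr),$$ $$\lambda_5(n,m)\le i\,2^{i+7}\bigl(n+(cj)^3(m-1)\bigr).$$ -/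

import Mathlib

namespace DavenportSchinzel

/-! ### Sequences, blocks, and the extremal function `λ_s(n,m)` -/

/-- The alternating sequence `a b a b ⋯` of length `k`. -/
def alternating {α : Type*} (a b : α) : ℕ → List α
  | 0 => []
  | k + 1 => a :: alternating b a k

/-- `σ` is an order-`s` Davenport–Schinzel sequence: it has no subsequence (not necessarily
contiguous) isomorphic to the alternating sequence `a b a b ⋯` of length `s + 2`. -/
def IsDS {α : Type*} (s : ℕ) (σ : List α) : Prop :=
  ∀ a b : α, a ≠ b → ¬ (alternating a b (s + 2)).Sublist σ

/-- `B` is an order-`s` Davenport–Schinzel sequence, partitioned into at most `m` blocks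
(a block is a list of distinct symbols, possibly empty), with exactly `n` distinct symbols.
The underlying sequence is `B.flatten`. -/
structure IsBlockedDS (s n m : ℕ) (B : List (List ℕ)) : Prop where
  nodup : ∀ β ∈ B, β.Nodup
  length_le : B.length ≤ m
  card_alphabet : B.flatten.toFinset.card = n
  isDS : IsDS s B.flatten

/-- `λ_s(n,m)`: the maximum length of an order-`s` Davenport–Schinzel sequence over an `n`-letter
alphabet that can be partitioned into at most `m` blocks. -/
noncomputable def dsLength (s n m : ℕ) : ℕ :=
  sSup {k | ∃ B, IsBlockedDS s n m B ∧ k = B.flatten.length}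

/-- The variant of Ackermann's function in use, for `i, j ≥ 1`: `a_{1,j} = 2^j`, `a_{i,1} = 2`, and
`a_{i,j} = w * a_{i-1,w}` with `w = a_{i,j-1}` for `i, j ≥ 2`. (Index `0` carries no meaning.) -/
def acker : ℕ → ℕ → ℕ
  | 0, _ => 0
  | 1, j => 2 ^ j
  | _ + 2, 0 => 0
  | _ + 2, 1 => 2
  | i + 2, j + 2 => acker (i + 2) (j + 1) * acker (i + 1) (acker (i + 2) (j + 1))
termination_by i j => (i, j)

/-! ### Decomposing a blocked sequence

The order of the symbols within a block plays no role for derivation trees, so there a blocked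
sequence is a function `S : ℕ → Set α`; `S p` is the `p`-th block, numbered from `0`, and blocks
beyond the end are empty. Interval `q` consists of the `2 ^ r` consecutive blocks
`q * 2 ^ r, …, q * 2 ^ r + 2 ^ r - 1` (fewer for the last interval). -/

section Decomposition

variable {α : Type*}

/-- The blocks of a list of lists, as sets of symbols. -/
def blocksOf (B : List (List α)) : ℕ → Set α := fun p => {a | a ∈ B.getD p []}

/-- The symbols that appear in interval `q`. -/
def intervalAlphabet (S : ℕ → Set α) (r q : ℕ) : Set α :=
  {a | ∃ p, p / 2 ^ r = q ∧ a ∈ S p}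

/-- A symbol is global if it appears in at least two intervals. -/
def IsGlobal (S : ℕ → Set α) (r : ℕ) (a : α) : Prop :=
  ∃ q q', q ≠ q' ∧ a ∈ intervalAlphabet S r q ∧ a ∈ intervalAlphabet S r q'

/-- The contracted global sequence `Ŝ'`: its `q`-th block holds all global symbols of
interval `q`. -/
def contracted (S : ℕ → Set α) (r : ℕ) : ℕ → Set α :=
  fun q => {a | IsGlobal S r a ∧ a ∈ intervalAlphabet S r q}

/-- The projection of interval `q` onto its local symbols. -/
def localPart (S : ℕ → Set α) (r q : ℕ) : ℕ → Set α :=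
  fun p => {a | p < 2 ^ r ∧ a ∈ S (q * 2 ^ r + p) ∧ ¬ IsGlobal S r a}

/-- The two types of occurrences: doves descend from the left head of their symbol,
hawks from the right head. -/
inductive Side
  | dove
  | hawk

/-- The other type. -/
def Side.opp : Side → Side
  | .dove => .hawk
  | .hawk => .dove

/-- `d.Before p p'`: going inwards from the wing of type `d`, position `p` comes no later
than `p'` (left to right for doves, right to left for hawks). -/
def Side.Before : Side → ℕ → ℕ → Prop
  | .dove, p, p' => p ≤ p'
  | .hawk, p, p' => p' ≤ p

/-- The projection of interval `q` onto the global symbols that make their first appearance in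
interval `q` (for `dove`), respectively their last appearance (for `hawk`). -/
def extremePart (S : ℕ → Set α) (r : ℕ) (d : Side) (q : ℕ) : ℕ → Set α :=
  fun p => {a | p < 2 ^ r ∧ a ∈ S (q * 2 ^ r + p) ∧ IsGlobal S r a ∧
    ∀ q', a ∈ intervalAlphabet S r q' → d.Before q q'}

end Decomposition

/-! ### Permissible derivation trees

All permissible derivation trees of an `m`-block sequence have the same node set. A node is
written `(ℓ, k)`: it sits `ℓ` levels above the leaves and its leaf descendants are
the leaves `(0, p)` with `p / 2 ^ ℓ = k`; the leaf `(0, p)` belongs to the `p`-th block. -/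

/-- Nodes `(level, index)`. -/
abbrev Node := ℕ × ℕ

/-- `u` is an ancestor of `v` (possibly `u = v`). -/
def Anc (u v : Node) : Prop := v.1 ≤ u.1 ∧ v.2 / 2 ^ (u.1 - v.1) = u.2

/-- The number `⌈m / 2^r⌉` of intervals of the uniform block partition of width `2 ^ r`. -/
def numIntervals (m r : ℕ) : ℕ := (m + 2 ^ r - 1) / 2 ^ r

/-- The number of blocks in interval `q` (it is `0` if there is no such interval). -/
def intervalSize (m r q : ℕ) : ℕ := min (2 ^ r) (m - q * 2 ^ r)

/-- The choices that determine a permissible derivation tree of an `m`-block sequence. For `m ≤ 2`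
nothing is chosen; otherwise one chooses the width `2 ^ r` (with `r ≥ 1` and more than one interval)
of a uniform block partition, and recursively a derivation tree for the contracted global sequence
and one for the local part of every interval. -/
inductive DTree : ℕ → Type
  | base {m : ℕ} (hm : m ≤ 2) : DTree m
  | comp {m : ℕ} (r : ℕ) (hr : 1 ≤ r) (hm : 2 ^ r < m)
      (top : DTree (numIntervals m r)) (loc : ∀ q : ℕ, DTree (intervalSize m r q)) : DTree m

namespace DTree

variable {α : Type*}

/-- The block `𝓑(v)` of a node. The leaves hold the blocks of `S`, the nodes at or above the
leaf level of the global tree inherit their blocks from it, and the nodes strictly between carry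
the blocks of the local trees. Roots of base trees hold nothing. -/
def block : {m : ℕ} → DTree m → (ℕ → Set α) → Node → Set α
  | _, .base _, S, v => if v.1 = 0 then S v.2 else ∅
  | _, .comp r _ _ top loc, S, v =>
      if v.1 = 0 then S v.2
      else if v.1 < r then
        (loc (v.2 / 2 ^ (r - v.1))).block (localPart S r (v.2 / 2 ^ (r - v.1)))
          (v.1, v.2 % 2 ^ (r - v.1))
      else top.block (contracted S r) (v.1 - r, v.2)

open Classical in
/-- The crown of a symbol: the root of the base tree in which the symbol ends up when global symbols
are followed into the global tree and local symbols into the tree of their interval. -/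
noncomputable def crown : {m : ℕ} → DTree m → (ℕ → Set α) → α → Node
  | _, .base _, _, _ => (1, 0)
  | _, .comp r _ _ top loc, S, a =>
      if IsGlobal S r a then
        (((top.crown (contracted S r) a).1 + r, (top.crown (contracted S r) a).2))
      else
        let q := sInf {q | a ∈ intervalAlphabet S r q}
        let c := (loc q).crown (localPart S r q) a
        (c.1, q * 2 ^ (r - c.1) + c.2)

/-- The left (for `dove`) or right (for `hawk`) head of a symbol: the left or right child of
its crown. -/
noncomputable def head {m : ℕ} (T : DTree m) (S : ℕ → Set α) (a : α) : Side → Node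
  | .dove => ((T.crown S a).1 - 1, 2 * (T.crown S a).2)
  | .hawk => ((T.crown S a).1 - 1, 2 * (T.crown S a).2 + 1)

/-- `w` is the parent of `z` in `𝒯|a`: the nearest strict ancestor whose block contains `a`.
(Only the two heads have the crown as their parent; that case is not included here.) -/
def IsParent {m : ℕ} (T : DTree m) (S : ℕ → Set α) (a : α) (w z : Node) : Prop :=
  a ∈ T.block S w ∧ a ∈ T.block S z ∧ w ≠ z ∧ Anc w z ∧
    ∀ u, a ∈ T.block S u → u ≠ z → Anc u z → Anc u w

end DTree

/-- Leaf `p` is the dove (leftmost) or hawk (rightmost) wingtip of `a`. -/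
def IsWingtip {α : Type*} (S : ℕ → Set α) (a : α) (d : Side) (p : ℕ) : Prop :=
  a ∈ S p ∧ ∀ p', a ∈ S p' → d.Before p p'

namespace DTree

variable {α : Type*}

/-- `w` lies on the left or right wing: the path in `𝒯|a` from a head to the wingtip of the
same type. -/
def OnWing {m : ℕ} (T : DTree m) (S : ℕ → Set α) (a : α) (d : Side) (w : Node) : Prop :=
  a ∈ T.block S w ∧ Anc (T.head S a d) w ∧ ∃ p, IsWingtip S a d p ∧ Anc w (0, p)

/-- `z` is a quill of type `d` and `w` is its parent, a wing node: `z` is a child in `𝒯|a` of the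
wing node `w` and is not itself on the wing. -/
def IsQuill {m : ℕ} (T : DTree m) (S : ℕ → Set α) (a : α) (d : Side) (w z : Node) : Prop :=
  T.OnWing S a d w ∧ T.IsParent S a w z ∧ ¬ T.OnWing S a d z

/-- Leaf `p` is the rightmost (for `dove`) or leftmost (for `hawk`) leaf descendant of `z`
in `𝒯|a`. -/
def IsInnermost (S : ℕ → Set α) (a : α) (d : Side) (z : Node) (p : ℕ) : Prop :=
  a ∈ S p ∧ Anc z (0, p) ∧ ∀ p', a ∈ S p' → Anc z (0, p') → d.Before p' p

/-- Leaf `p` is a feather of type `d` in `𝒯|a`: the rightmost leaf descendant of a dove quill, or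
the leftmost leaf descendant of a hawk quill. -/
def IsFeather {m : ℕ} (T : DTree m) (S : ℕ → Set α) (a : α) (d : Side) (p : ℕ) : Prop :=
  ∃ w z, T.IsQuill S a d w z ∧ IsInnermost S a d z p

/-- The number of occurrences in `S` that are feathers of type `d`. -/
noncomputable def featherCount {m : ℕ} (T : DTree m) (S : ℕ → Set α) (d : Side) : ℕ :=
  {x : α × ℕ | T.IsFeather S x.1 d x.2}.ncard

end DTree

/-! ### Ensembles of derivation trees and double-feathers -/

/-- The choices that determine a permissible derivation tree ensemble. In every composition step,
the `q`-th leaf `x_q` of the global tree receives, besides the local tree, two superimposed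
derivation trees `sup .dove q` and `sup .hawk q`, for the projections of interval `q` onto the
global symbols appearing there for the first, respectively last, time. -/
inductive Ensemble : ℕ → Type
  | base {m : ℕ} (hm : m ≤ 2) : Ensemble m
  | comp {m : ℕ} (r : ℕ) (hr : 1 ≤ r) (hm : 2 ^ r < m)
      (top : Ensemble (numIntervals m r)) (loc : ∀ q : ℕ, Ensemble (intervalSize m r q))
      (sup : Side → ∀ q : ℕ, DTree (intervalSize m r q)) : Ensemble m

/-- A superimposed derivation tree: `tree` is a derivation tree of the sequence `seq`, and its `p`-th
leaf is identified with the node `(level, offset + p)` of the main tree. -/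
structure Superimposed (α : Type*) where
  size : ℕ
  tree : DTree size
  seq : ℕ → Set α
  level : ℕ
  offset : ℕ

namespace Ensemble

variable {α : Type*}

/-- The main derivation tree `𝒯` of an ensemble. -/
def toDTree : {m : ℕ} → Ensemble m → DTree m
  | _, .base hm => .base hm
  | _, .comp r hr hm top loc _ => .comp r hr hm top.toDTree (fun q => (loc q).toDTree)

/-- The derivation tree superimposed at node `u` for type `d` (present exactly when `u` was the leaf
of a global tree in some composition step). Its leaf level is that of the tree composed in that step. -/
def superimposed : {m : ℕ} → Ensemble m → (ℕ → Set α) → Side → Node → Option (Superimposed α)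
  | _, .base _, _, _, _ => none
  | _, .comp r _ _ top loc sup, S, d, u =>
      if u.1 = r then
        some ⟨_, sup d u.2, extremePart S r d u.2, 0, u.2 * 2 ^ r⟩
      else if r < u.1 then
        (top.superimposed (contracted S r) d (u.1 - r, u.2)).map
          fun X => ⟨X.size, X.tree, X.seq, X.level + r, X.offset⟩
      else
        ((loc (u.2 / 2 ^ (r - u.1))).superimposed (localPart S r (u.2 / 2 ^ (r - u.1))) d
          (u.1, u.2 % 2 ^ (r - u.1))).map
          fun X => ⟨X.size, X.tree, X.seq, X.level,
            u.2 / 2 ^ (r - u.1) * 2 ^ (r - X.level) + X.offset⟩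

/-- Leaf `p` is a double-feather of type `d` in `𝒯|a`: it is the feather of a quill `z` with parent
wing node `w`, and `z`, seen as a leaf of the derivation tree superimposed at `w`, is there a feather
of type `d` or the wingtip of the opposite type. -/
def IsDoubleFeather {m : ℕ} (E : Ensemble m) (S : ℕ → Set α) (a : α) (d : Side) (p : ℕ) : Prop :=
  ∃ w z, E.toDTree.IsQuill S a d w z ∧ DTree.IsInnermost S a d z p ∧
    ∃ X, E.superimposed S d w = some X ∧ ∃ p', z = (X.level, X.offset + p') ∧
      (X.tree.IsFeather X.seq a d p' ∨ IsWingtip X.seq a d.opp p')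

/-- The number of occurrences in `S` that are double-feathers, of either type. -/
noncomputable def doubleFeatherCount {m : ℕ} (E : Ensemble m) (S : ℕ → Set α) : ℕ :=
  {x : α × ℕ | ∃ d, E.IsDoubleFeather S x.1 d x.2}.ncard

end Ensemble

/-! ### The functions `Φ'` and `Φ''` -/

/-- `Φ'(n,m)`: the maximum, over all order-`4` sequences with `n` letters and `m` blocks and over the
two types, of the number of feathers of that type in an optimal permissible derivation tree, i.e. one
that minimizes this number. -/
noncomputable def maxFeathers (n m : ℕ) : ℕ :=
  sSup {k | ∃ B, IsBlockedDS 4 n m B ∧ ∃ d : Side,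
    k = ⨅ T : DTree B.length, T.featherCount (blocksOf B) d}

/-- `Φ''(n,m)`: the maximum, over all order-`5` sequences with `n` letters and `m` blocks, of the
number of double-feathers (of both types) in an optimal permissible derivation tree ensemble, i.e. one
that minimizes this number. -/
noncomputable def maxDoubleFeathers (n m : ℕ) : ℕ :=
  sSup {k | ∃ B, IsBlockedDS 5 n m B ∧
    k = ⨅ E : Ensemble B.length, E.doubleFeatherCount (blocksOf B)}

/-! ### The extrema above exist -/

theorem numIntervals_one_lt {m : ℕ} (h : ¬ m ≤ 2) : numIntervals m 1 < m := by
  unfold numIntervals; omega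

theorem intervalSize_one_le (m q : ℕ) : intervalSize m 1 q ≤ 2 := by
  unfold intervalSize; omega

theorem nonempty_dTree (m : ℕ) : Nonempty (DTree m) := by
  induction m using Nat.strong_induction_on with
  | _ m ih =>
    by_cases h : m ≤ 2
    · exact ⟨.base h⟩
    · obtain ⟨top⟩ := ih _ (numIntervals_one_lt h)
      exact ⟨.comp 1 le_rfl (by omega) top fun q => .base (intervalSize_one_le m q)⟩

theorem nonempty_ensemble (m : ℕ) : Nonempty (Ensemble m) := by
  induction m using Nat.strong_induction_on with
  | _ m ih =>
    by_cases h : m ≤ 2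
    · exact ⟨.base h⟩
    · obtain ⟨top⟩ := ih _ (numIntervals_one_lt h)
      exact ⟨.comp 1 le_rfl (by omega) top (fun q => .base (intervalSize_one_le m q))
        fun _ q => .base (intervalSize_one_le m q)⟩

theorem IsBlockedDS.length_flatten_le {s n m : ℕ} {B : List (List ℕ)}
    (h : IsBlockedDS s n m B) : B.flatten.length ≤ n * m := by
  have key : ∀ β ∈ B, β.length ≤ n := fun β hβ => by
    rw [← List.toFinset_card_of_nodup (h.nodup β hβ), ← h.card_alphabet]
    refine Finset.card_le_card fun a ha => ?_
    simp only [List.mem_toFinset, List.mem_flatten] at ha ⊢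
    exact ⟨β, hβ, ha⟩
  rw [List.length_flatten]
  calc (B.map List.length).sum ≤ (B.map List.length).length • n :=
        List.sum_le_card_nsmul _ _ (by simpa using key)
    _ ≤ n * m := by
        rw [List.length_map, smul_eq_mul, mul_comm]
        exact Nat.mul_le_mul_left _ h.length_le

theorem bddAbove_dsLength (s n m : ℕ) :
    BddAbove {k | ∃ B, IsBlockedDS s n m B ∧ k = B.flatten.length} := by
  refine ⟨n * m, ?_⟩
  rintro k ⟨B, hB, rfl⟩
  exact hB.length_flatten_le

/-- The set of all occurrences is finite, so the counts above are cardinalities of finite sets. -/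
theorem occurrences_finite_and_card {s n m : ℕ} {B : List (List ℕ)} (h : IsBlockedDS s n m B) :
    {x : ℕ × ℕ | x.1 ∈ blocksOf B x.2}.Finite ∧
      {x : ℕ × ℕ | x.1 ∈ blocksOf B x.2}.ncard ≤ n * m := by
  have hsub : {x : ℕ × ℕ | x.1 ∈ blocksOf B x.2} ⊆
      ↑(B.flatten.toFinset ×ˢ Finset.range m) := by
    rintro ⟨a, p⟩ hx
    simp only [blocksOf, Set.mem_ofPred_eq] at hx
    have hp : p < B.length := by
      by_contra hp
      rw [List.getD_eq_default _ _ (by omega)] at hx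
      simp at hx
    rw [List.getD_eq_getElem _ _ hp] at hx
    simp only [Finset.coe_product, Set.mem_prod, Finset.mem_coe, List.mem_toFinset,
      List.mem_flatten, Finset.mem_range]
    exact ⟨⟨_, List.getElem_mem hp, hx⟩, hp.trans_le h.length_le⟩
  refine ⟨(Finset.finite_toSet _).subset hsub, ?_⟩
  refine (Set.ncard_le_ncard hsub (Finset.finite_toSet _)).trans ?_
  rw [Set.ncard_coe_finset, Finset.card_product, h.card_alphabet, Finset.card_range]

theorem bddAbove_maxFeathers (n m : ℕ) :
    BddAbove {k | ∃ B, IsBlockedDS 4 n m B ∧ ∃ d : Side,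
      k = ⨅ T : DTree B.length, T.featherCount (blocksOf B) d} := by
  refine ⟨n * m, ?_⟩
  rintro k ⟨B, hB, d, rfl⟩
  obtain ⟨hf, hc⟩ := occurrences_finite_and_card hB
  obtain ⟨T⟩ := nonempty_dTree B.length
  refine (ciInf_le (OrderBot.bddBelow _) T).trans ((Set.ncard_le_ncard ?_ hf).trans hc)
  rintro x ⟨w, z, -, hx, -⟩
  exact hx

theorem bddAbove_maxDoubleFeathers (n m : ℕ) :
    BddAbove {k | ∃ B, IsBlockedDS 5 n m B ∧
      k = ⨅ E : Ensemble B.length, E.doubleFeatherCount (blocksOf B)} := by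
  refine ⟨n * m, ?_⟩
  rintro k ⟨B, hB, rfl⟩
  obtain ⟨hf, hc⟩ := occurrences_finite_and_card hB
  obtain ⟨E⟩ := nonempty_ensemble B.length
  refine (ciInf_le (OrderBot.bddBelow _) E).trans ((Set.ncard_le_ncard ?_ hf).trans hc)
  rintro x ⟨d, w, z, -, ⟨hx, -⟩, -⟩
  exact hx

end DavenportSchinzel

namespace DavenportSchinzel
open scoped Classical

/-! ### Davenport–Schinzel sequences and their order -/

/-! Cut a sequence into intervals of `2 ^ r` blocks. Local symbols keep the order `s` inside their
interval. A global symbol is, in a given interval, at its first, its last or a middle appearance.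
The projection of the interval onto symbols at their first (or last) appearance has order `s - 1`,
since each of its letters occurs again on one side; the middle projection has order `s - 2`. The
middle projections together have as many letters as the contracted sequence has occurrences, less
two per global symbol. This bounds `λ_s` by itself (on intervals and on the contracted sequence),
`λ_{s-1}` and `λ_{s-2}` (`LengthBound.step`), which is good enough for orders three and four.

At order five it would multiply the coefficient of `n` by the order-three coefficient at each step.
Derivation trees avoid this. Call a middle appearance of `a` in interval `q` good if block `q` of
the contracted sequence is a double-feather of `a`. Good appearances are few, so the order-three
bound is affordable for them. The others split by whether they descend from the left or the right
head, and each half has order two (`IsBlocked.two_of_not_isDoubleFeather`), so the recurrence only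
doubles the coefficient (`LengthBound.orderFive_recurrence`).

The order drops to two for this reason. If `q` descends from the head of type `d` and is neither
wingtip nor double-feather, then some tree node above `q` misses the wingtip of type `d` but has an
occurrence further inwards below it. Comparing the levels of two such nodes, for `a` and for `b`,
shows that both patterns `ab` and `ba` can be found, each entirely on one side of `q`
(`nested_aux`). An `abab` inside the interval then extends to an alternation of length seven.

Feathers and double-feathers obey recurrences of their own. In a composed tree they come from a
local tree, or lift to the innermost occurrence below a feather of the global tree, or lie in the
interval of the first or last appearance. The last kind is counted by an order-three length for
feathers, and by feathers of the superimposed tree plus one wingtip for double-feathers.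

All bounds then follow from one induction (`acker_induction`): for index `(i + 1, j + 1)` use width
`w ^ 3` with `w = a_{i+1,j}`, index `(i + 1, j)` on the intervals and `(i, w)` on the contracted
sequence. The contracted bound has a factor `(3w) ^ e` with `e ≤ 3`, which the shrinking of the
number of blocks by `w ^ 3` absorbs. -/

theorem IsDS.of_sublist {α : Type*} {s : ℕ} {σ τ : List α} (h : IsDS s τ) (hs : σ.Sublist τ) :
    IsDS s σ :=
  fun a b hab h' => h a b hab (h'.trans hs)

theorem alternating_succ_eq_append {α : Type*} (a b : α) (k : ℕ) :
    alternating a b (k + 1) = alternating a b k ++ [if Even k then a else b] := by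
  induction k generalizing a b with
  | zero => simp [alternating]
  | succ k ih =>
    rw [alternating, ih b a, alternating]
    by_cases h : Even k <;> simp [h, Nat.even_add_one]

/-- Both letters of an alternation inside `M` recur in `R`, so whichever letter would come next is
available there and prolongs the alternation by one. The next two lemmas do the same on the left and
on both sides. -/
theorem IsDS.of_append_right {α : Type*} {s : ℕ} {M R : List α} (h : IsDS (s + 1) (M ++ R))
    (hR : ∀ a ∈ M, a ∈ R) : IsDS s M := by
  intro a b hab hs
  refine h a b hab ?_
  rw [show s + 1 + 2 = (s + 2) + 1 from rfl, alternating_succ_eq_append]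
  refine hs.append (List.singleton_sublist.2 (hR _ (hs.subset ?_)))
  split_ifs <;> simp [alternating]

theorem IsDS.of_append_left {α : Type*} {s : ℕ} {L M : List α} (h : IsDS (s + 1) (L ++ M))
    (hL : ∀ a ∈ M, a ∈ L) : IsDS s M := by
  intro a b hab hs
  refine h b a hab.symm ?_
  rw [show s + 1 + 2 = (s + 2) + 1 from rfl, alternating]
  exact (List.singleton_sublist.2 (hL b (hs.subset (by simp [alternating])))).append hs

theorem IsDS.of_append_append {α : Type*} {s : ℕ} {L M R : List α}
    (h : IsDS (s + 2) (L ++ M ++ R)) (hL : ∀ a ∈ M, a ∈ L) (hR : ∀ a ∈ M, a ∈ R) : IsDS s M := by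
  intro a b hab hs
  refine h b a hab.symm ?_
  rw [show s + 2 + 2 = (s + 3) + 1 from rfl, alternating, alternating_succ_eq_append]
  refine ((List.singleton_sublist.2 (hL b (hs.subset (by simp [alternating])))).append hs).append
    (List.singleton_sublist.2 (hR _ (hs.subset ?_)))
  split_ifs <;> simp [alternating]

/-! ### Blocked sequences and their uniform partitions -/

/-- A list of blocks whose concatenation is an order-`s` sequence. -/
structure IsBlocked (s : ℕ) (B : List (List ℕ)) : Prop where
  nodup : ∀ β ∈ B, β.Nodup
  isDS : IsDS s B.flatten

/-- The blocks of interval `q` in the uniform partition of width `2 ^ r`. -/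
def chunk (B : List (List ℕ)) (r q : ℕ) : List (List ℕ) := (B.drop (q * 2 ^ r)).take (2 ^ r)

/-- The projection of a blocked sequence onto the symbols satisfying `P`. -/
noncomputable def proj (P : ℕ → Prop) (C : List (List ℕ)) : List (List ℕ) :=
  C.map (List.filter (fun a => decide (P a)))

/-- Going inwards from the wing of type `d`, interval `q` is the first one containing `a`. -/
def IsExtreme {α : Type*} (S : ℕ → Set α) (r : ℕ) (d : Side) (q : ℕ) (a : α) : Prop :=
  ∀ q', a ∈ intervalAlphabet S r q' → d.Before q q'

/-- The contracted global sequence as a list of blocks. -/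
noncomputable def contractedList (B : List (List ℕ)) (r : ℕ) : List (List ℕ) :=
  (List.range (numIntervals B.length r)).map fun q =>
    ((chunk B r q).flatten.filter (fun a => decide (IsGlobal (blocksOf B) r a))).dedup

theorem flatten_proj (P : ℕ → Prop) (C : List (List ℕ)) :
    (proj P C).flatten = C.flatten.filter (fun a => decide (P a)) := by
  rw [proj, List.filter_flatten]

theorem length_proj (P : ℕ → Prop) (C : List (List ℕ)) : (proj P C).length = C.length := by
  simp [proj]

theorem length_chunk (B : List (List ℕ)) (r q : ℕ) :
    (chunk B r q).length = intervalSize B.length r q := by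
  simp [chunk, intervalSize]

theorem nodup_of_mem_proj_chunk {B : List (List ℕ)} (h : ∀ β ∈ B, β.Nodup) (P : ℕ → Prop)
    (r q : ℕ) : ∀ β ∈ proj P (chunk B r q), β.Nodup := by
  intro β hβ
  obtain ⟨γ, hγ, rfl⟩ := List.mem_map.1 hβ
  exact (h γ (List.mem_of_mem_drop (List.mem_of_mem_take hγ))).filter _

theorem le_numIntervals_mul (m r : ℕ) : m ≤ numIntervals m r * 2 ^ r := by
  have h2 : 0 < 2 ^ r := by positivity
  have := Nat.div_add_mod (m + 2 ^ r - 1) (2 ^ r)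
  have := Nat.mod_lt (m + 2 ^ r - 1) h2
  unfold numIntervals
  rw [mul_comm]; omega

theorem lt_numIntervals_iff {m r q : ℕ} : q < numIntervals m r ↔ q * 2 ^ r < m := by
  have h2 : 0 < 2 ^ r := by positivity
  rw [numIntervals, Nat.lt_iff_add_one_le, Nat.le_div_iff_mul_le h2, add_mul]
  omega

theorem numIntervals_le {m M r : ℕ} (h : m ≤ M * 2 ^ r) : numIntervals m r ≤ M := by
  by_contra hc
  have := lt_numIntervals_iff.1 (not_le.1 hc)
  omega

theorem numIntervals_pred_mul_le (m r : ℕ) : (numIntervals m r - 1) * 2 ^ r ≤ m - 1 := by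
  rcases Nat.eq_zero_or_pos (numIntervals m r) with h | h
  · simp [h]
  · have := lt_numIntervals_iff.1 (Nat.sub_lt h one_pos)
    omega

theorem flatten_map_chunk (B : List (List ℕ)) (r N : ℕ) :
    ((List.range N).map (chunk B r)).flatten = B.take (N * 2 ^ r) := by
  induction N with
  | zero => simp
  | succ N ih =>
    rw [List.range_succ, List.map_append, List.flatten_append, ih, add_mul, one_mul, List.take_add]
    simp [chunk]

theorem flatten_map_chunk_numIntervals (B : List (List ℕ)) (r : ℕ) :
    ((List.range (numIntervals B.length r)).map (chunk B r)).flatten = B := by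
  rw [flatten_map_chunk, List.take_of_length_le (le_numIntervals_mul _ _)]

theorem flatten_split (B : List (List ℕ)) (r q : ℕ) :
    B.flatten = (B.take (q * 2 ^ r)).flatten ++ (chunk B r q).flatten ++
      (B.drop ((q + 1) * 2 ^ r)).flatten := by
  conv_lhs => rw [← List.take_append_drop (q * 2 ^ r) B,
    ← List.take_append_drop (2 ^ r) (B.drop (q * 2 ^ r))]
  rw [List.drop_drop, List.flatten_append, List.flatten_append, List.append_assoc, chunk,
    add_mul, one_mul]

theorem mem_blocksOf_iff {B : List (List ℕ)} {p a : ℕ} :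
    a ∈ blocksOf B p ↔ ∃ h : p < B.length, a ∈ B[p] := by
  simp only [blocksOf, Set.mem_ofPred_eq]
  by_cases h : p < B.length
  · simp [h]
  · simp [h]

theorem mem_flatten_iff {B : List (List ℕ)} {a : ℕ} :
    a ∈ B.flatten ↔ ∃ p, a ∈ blocksOf B p := by
  rw [List.mem_flatten]
  simp only [mem_blocksOf_iff]
  constructor
  · rintro ⟨β, hβ, h⟩
    obtain ⟨p, hp, rfl⟩ := List.mem_iff_getElem.1 hβ
    exact ⟨p, hp, h⟩
  · rintro ⟨p, hp, h⟩; exact ⟨_, List.getElem_mem hp, h⟩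

theorem mem_blocksOf_take {B : List (List ℕ)} {N p a : ℕ} :
    a ∈ blocksOf (B.take N) p ↔ p < N ∧ a ∈ blocksOf B p := by
  simp only [mem_blocksOf_iff, List.length_take, List.getElem_take]
  constructor
  · rintro ⟨h, h'⟩; exact ⟨by omega, by omega, h'⟩
  · rintro ⟨h, h', h''⟩; exact ⟨by omega, h''⟩

theorem mem_blocksOf_drop {B : List (List ℕ)} {N p a : ℕ} :
    a ∈ blocksOf (B.drop N) p ↔ a ∈ blocksOf B (N + p) := by
  simp only [mem_blocksOf_iff, List.length_drop, List.getElem_drop]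
  constructor
  · rintro ⟨h, h'⟩; exact ⟨by omega, h'⟩
  · rintro ⟨h, h'⟩; exact ⟨by omega, h'⟩

theorem mem_blocksOf_proj {P : ℕ → Prop} {B : List (List ℕ)} {p a : ℕ} :
    a ∈ blocksOf (proj P B) p ↔ a ∈ blocksOf B p ∧ P a := by
  simp [mem_blocksOf_iff, proj, exists_and_right]

theorem mem_blocksOf_proj_chunk {P : ℕ → Prop} {B : List (List ℕ)} {r q p a : ℕ} :
    a ∈ blocksOf (proj P (chunk B r q)) p ↔
      p < 2 ^ r ∧ a ∈ blocksOf B (q * 2 ^ r + p) ∧ P a := by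
  rw [mem_blocksOf_proj, chunk, mem_blocksOf_take, mem_blocksOf_drop, and_assoc]

theorem mem_take_flatten {B : List (List ℕ)} {N a : ℕ} :
    a ∈ (B.take N).flatten ↔ ∃ p < N, a ∈ blocksOf B p := by
  simp only [mem_flatten_iff, mem_blocksOf_take]

theorem mem_drop_flatten {B : List (List ℕ)} {N a : ℕ} :
    a ∈ (B.drop N).flatten ↔ ∃ p, N ≤ p ∧ a ∈ blocksOf B p := by
  simp only [mem_flatten_iff, mem_blocksOf_drop]
  constructor
  · rintro ⟨p, h⟩; exact ⟨_, by omega, h⟩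
  · rintro ⟨p, h, h'⟩; exact ⟨p - N, by rwa [Nat.add_sub_cancel' h]⟩

theorem mem_chunk_flatten {B : List (List ℕ)} {r q a : ℕ} :
    a ∈ (chunk B r q).flatten ↔ a ∈ intervalAlphabet (blocksOf B) r q := by
  have h2 : 0 < 2 ^ r := by positivity
  rw [chunk, mem_take_flatten]
  simp only [mem_blocksOf_drop, intervalAlphabet, Set.mem_ofPred_eq]
  constructor
  · rintro ⟨p, hp, h⟩
    exact ⟨_, by rw [mul_comm, Nat.mul_add_div h2, Nat.div_eq_of_lt hp, add_zero], h⟩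
  · rintro ⟨p, rfl, h⟩
    exact ⟨p % 2 ^ r, Nat.mod_lt _ h2, by rwa [Nat.div_add_mod']⟩

theorem lt_length_of_mem_blocksOf {B : List (List ℕ)} {p a : ℕ} (h : a ∈ blocksOf B p) :
    p < B.length :=
  (mem_blocksOf_iff.1 h).1

theorem lt_numIntervals_of_mem {α : Type*} {S : ℕ → Set α} {m r q : ℕ} {a : α}
    (hS : ∀ p, a ∈ S p → p < m) (h : a ∈ intervalAlphabet S r q) : q < numIntervals m r := by
  obtain ⟨p, rfl, h⟩ := h
  exact lt_numIntervals_iff.2 ((Nat.div_mul_le_self _ _).trans_lt (hS p h))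

theorem mem_take_flatten_of_interval {B : List (List ℕ)} {r q q' a : ℕ}
    (h : a ∈ intervalAlphabet (blocksOf B) r q') (hq : q' < q) :
    a ∈ (B.take (q * 2 ^ r)).flatten := by
  obtain ⟨p, rfl, h⟩ := h
  exact mem_take_flatten.2 ⟨p, (Nat.div_lt_iff_lt_mul (by positivity)).1 hq, h⟩

theorem mem_drop_flatten_of_interval {B : List (List ℕ)} {r q q' a : ℕ}
    (h : a ∈ intervalAlphabet (blocksOf B) r q') (hq : q < q') :
    a ∈ (B.drop ((q + 1) * 2 ^ r)).flatten := by
  obtain ⟨p, rfl, h⟩ := h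
  exact mem_drop_flatten.2 ⟨p, (Nat.le_div_iff_mul_le (by positivity)).1 hq, h⟩

theorem blocksOf_contractedList (B : List (List ℕ)) (r : ℕ) :
    blocksOf (contractedList B r) = contracted (blocksOf B) r := by
  ext q a
  simp only [mem_blocksOf_iff, contractedList, List.length_map, List.length_range,
    List.getElem_map, List.getElem_range, List.mem_dedup, List.mem_filter, decide_eq_true_eq,
    mem_chunk_flatten, contracted, Set.mem_ofPred_eq]
  constructor
  · rintro ⟨-, h, h'⟩; exact ⟨h', h⟩
  · rintro ⟨h, h'⟩
    exact ⟨lt_numIntervals_of_mem (fun p => lt_length_of_mem_blocksOf) h', h', h⟩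

theorem blocksOf_local (B : List (List ℕ)) (r q : ℕ) :
    blocksOf (proj (fun a => ¬ IsGlobal (blocksOf B) r a) (chunk B r q)) =
      localPart (blocksOf B) r q := by
  ext p a
  rw [mem_blocksOf_proj_chunk]; rfl

theorem blocksOf_extreme (B : List (List ℕ)) (r : ℕ) (d : Side) (q : ℕ) :
    blocksOf (proj (fun a => IsGlobal (blocksOf B) r a ∧ IsExtreme (blocksOf B) r d q a)
      (chunk B r q)) = extremePart (blocksOf B) r d q := by
  ext p a
  rw [mem_blocksOf_proj_chunk]; rfl

theorem length_contractedList (B : List (List ℕ)) (r : ℕ) :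
    (contractedList B r).length = numIntervals B.length r := by
  simp [contractedList]

/-- Keeping one copy of each global symbol per interval deletes letters without reordering, so the
contracted sequence inherits the order `s`. -/
theorem flatten_contractedList_sublist (B : List (List ℕ)) (r : ℕ) :
    (contractedList B r).flatten.Sublist B.flatten := by
  conv_rhs => rw [← flatten_map_chunk_numIntervals B r]
  rw [List.flatten_flatten, contractedList, List.map_map]
  generalize List.range (numIntervals B.length r) = l
  induction l with
  | nil => simp
  | cons q l ih =>
    simp only [List.map_cons, List.flatten_cons]
    exact ((List.dedup_sublist _).trans List.filter_sublist).append ih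

theorem isBlocked_contractedList {s : ℕ} {B : List (List ℕ)} (h : IsBlocked s B) (r : ℕ) :
    IsBlocked s (contractedList B r) where
  nodup := by
    intro β hβ
    obtain ⟨q, -, rfl⟩ := List.mem_map.1 hβ
    exact List.nodup_dedup _
  isDS := h.isDS.of_sublist (flatten_contractedList_sublist B r)

theorem flatten_proj_chunk_sublist (P : ℕ → Prop) (B : List (List ℕ)) (r q : ℕ) :
    (proj P (chunk B r q)).flatten.Sublist (chunk B r q).flatten := by
  rw [flatten_proj]; exact List.filter_sublist

theorem IsBlocked.proj_chunk {s : ℕ} {B : List (List ℕ)} (h : IsBlocked s B) (P : ℕ → Prop)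
    (r q : ℕ) : IsBlocked s (proj P (chunk B r q)) where
  nodup := nodup_of_mem_proj_chunk h.nodup P r q
  isDS := h.isDS.of_sublist ((flatten_proj_chunk_sublist P B r q).trans (by
    rw [flatten_split B r q, List.append_assoc]
    exact (List.sublist_append_left _ _).trans (List.sublist_append_right _ _)))

theorem mem_proj_chunk_flatten {P : ℕ → Prop} {B : List (List ℕ)} {r q a : ℕ} :
    a ∈ (proj P (chunk B r q)).flatten ↔ a ∈ intervalAlphabet (blocksOf B) r q ∧ P a := by
  rw [flatten_proj, List.mem_filter, mem_chunk_flatten, decide_eq_true_eq]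

/-- If every symbol of the projection occurs later, the order drops by one. -/
theorem IsBlocked.proj_chunk_of_later {s : ℕ} {B : List (List ℕ)} (h : IsBlocked (s + 1) B)
    {P : ℕ → Prop} {r q : ℕ} (hP : ∀ a, a ∈ intervalAlphabet (blocksOf B) r q → P a →
      ∃ q', q < q' ∧ a ∈ intervalAlphabet (blocksOf B) r q') :
    IsBlocked s (proj P (chunk B r q)) where
  nodup := nodup_of_mem_proj_chunk h.nodup P r q
  isDS := by
    refine IsDS.of_append_right (R := (B.drop ((q + 1) * 2 ^ r)).flatten) (h.isDS.of_sublist ?_) ?_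
    · conv_rhs => rw [flatten_split B r q]
      exact ((flatten_proj_chunk_sublist P B r q).trans
        (List.sublist_append_right _ _)).append_right _
    · intro a ha
      obtain ⟨ha, hPa⟩ := mem_proj_chunk_flatten.1 ha
      obtain ⟨q', hq, ha'⟩ := hP a ha hPa
      exact mem_drop_flatten_of_interval ha' hq

/-- If every symbol of the projection occurs earlier, the order drops by one. -/
theorem IsBlocked.proj_chunk_of_earlier {s : ℕ} {B : List (List ℕ)} (h : IsBlocked (s + 1) B)
    {P : ℕ → Prop} {r q : ℕ} (hP : ∀ a, a ∈ intervalAlphabet (blocksOf B) r q → P a →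
      ∃ q', q' < q ∧ a ∈ intervalAlphabet (blocksOf B) r q') :
    IsBlocked s (proj P (chunk B r q)) where
  nodup := nodup_of_mem_proj_chunk h.nodup P r q
  isDS := by
    refine IsDS.of_append_left (L := (B.take (q * 2 ^ r)).flatten) (h.isDS.of_sublist ?_) ?_
    · conv_rhs => rw [flatten_split B r q, List.append_assoc]
      exact ((flatten_proj_chunk_sublist P B r q).trans
        (List.sublist_append_left _ _)).append_left _
    · intro a ha
      obtain ⟨ha, hPa⟩ := mem_proj_chunk_flatten.1 ha
      obtain ⟨q', hq, ha'⟩ := hP a ha hPa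
      exact mem_take_flatten_of_interval ha' hq

/-- If every symbol of the projection occurs both earlier and later, the order drops by two. -/
theorem IsBlocked.proj_chunk_of_middle {s : ℕ} {B : List (List ℕ)} (h : IsBlocked (s + 2) B)
    {P : ℕ → Prop} {r q : ℕ} (hP : ∀ a, a ∈ intervalAlphabet (blocksOf B) r q → P a →
      (∃ q', q' < q ∧ a ∈ intervalAlphabet (blocksOf B) r q') ∧
      ∃ q', q < q' ∧ a ∈ intervalAlphabet (blocksOf B) r q') :
    IsBlocked s (proj P (chunk B r q)) where
  nodup := nodup_of_mem_proj_chunk h.nodup P r q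
  isDS := by
    refine IsDS.of_append_append (L := (B.take (q * 2 ^ r)).flatten)
      (R := (B.drop ((q + 1) * 2 ^ r)).flatten) (h.isDS.of_sublist ?_) ?_ ?_
    · conv_rhs => rw [flatten_split B r q]
      exact ((flatten_proj_chunk_sublist P B r q).append_left _).append_right _
    all_goals
      intro a ha
      obtain ⟨ha, hPa⟩ := mem_proj_chunk_flatten.1 ha
    · obtain ⟨q', hq, ha'⟩ := (hP a ha hPa).1
      exact mem_take_flatten_of_interval ha' hq
    · obtain ⟨q', hq, ha'⟩ := (hP a ha hPa).2
      exact mem_drop_flatten_of_interval ha' hq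


/-! ### Counting along a uniform partition -/

/-- The number of distinct symbols of a blocked sequence. -/
def alphabetSize (B : List (List ℕ)) : ℕ := B.flatten.toFinset.card

/-- `α n + β (m - 1)` bounds the length of `m`-block order-`s` sequences over `n` letters,
for all `m ≤ M`. -/
def LengthBound (s α β M : ℕ) : Prop :=
  ∀ B, IsBlocked s B → B.length ≤ M →
    B.flatten.length ≤ α * alphabetSize B + β * (B.length - 1)

/-- Bounds linear in `m - 1` rather than `m` add up over the intervals without loss, since every
interval gives up one block. -/
theorem sum_intervalSize_pred_le (m r : ℕ) :
    ∑ q ∈ Finset.range (numIntervals m r), (intervalSize m r q - 1) ≤ m - 1 := by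
  have key : ∀ N ≤ numIntervals m r,
      ∑ q ∈ Finset.range N, (intervalSize m r q - 1) ≤ min (N * 2 ^ r) m - 1 := by
    intro N
    induction N with
    | zero => simp
    | succ N ih =>
      intro hN
      have h := lt_numIntervals_iff.1 hN
      have h2 : 0 < 2 ^ r := by positivity
      rw [Finset.sum_range_succ, add_mul, one_mul]
      have := ih (by omega)
      rw [intervalSize]
      rcases Nat.eq_zero_or_pos N with rfl | hN0
      · simp at this ⊢
      · have : 0 < N * 2 ^ r := by positivity
        omega
  exact (key _ le_rfl).trans (by omega)

theorem length_flatten_eq_sum (B : List (List ℕ)) (r : ℕ) :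
    B.flatten.length =
      ∑ q ∈ Finset.range (numIntervals B.length r), (chunk B r q).flatten.length := by
  have key : ∀ N, (B.take (N * 2 ^ r)).flatten.length =
      ∑ q ∈ Finset.range N, (chunk B r q).flatten.length := by
    intro N
    induction N with
    | zero => simp
    | succ N ih =>
      rw [Finset.sum_range_succ, ← ih, add_mul, one_mul, List.take_add, List.flatten_append,
        List.length_append, chunk]
  rw [← key, List.take_of_length_le (le_numIntervals_mul _ _)]

theorem length_flatten_proj_add (P Q : ℕ → Prop) (C : List (List ℕ)) :
    (proj P C).flatten.length = (proj (fun a => P a ∧ Q a) C).flatten.length +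
      (proj (fun a => P a ∧ ¬ Q a) C).flatten.length := by
  simp only [flatten_proj]
  induction C.flatten with
  | nil => simp
  | cons x l ih =>
    by_cases hP : P x <;> by_cases hQ : Q x <;> simp_all <;> omega

theorem length_flatten_eq_add (Q : ℕ → Prop) (C : List (List ℕ)) :
    C.flatten.length = (proj Q C).flatten.length + (proj (fun a => ¬ Q a) C).flatten.length := by
  have h := length_flatten_proj_add (fun _ => True) Q C
  simp only [flatten_proj, true_and, decide_true, List.filter_true] at h ⊢
  exact h

theorem alphabetSize_proj (P : ℕ → Prop) (C : List (List ℕ)) :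
    alphabetSize (proj P C) = (C.flatten.toFinset.filter P).card := by
  rw [alphabetSize, flatten_proj, List.toFinset_filter]
  simp

theorem alphabetSize_proj_add (P Q : ℕ → Prop) (C : List (List ℕ)) :
    alphabetSize (proj P C) = alphabetSize (proj (fun a => P a ∧ Q a) C) +
      alphabetSize (proj (fun a => P a ∧ ¬ Q a) C) := by
  simp only [alphabetSize_proj]
  have h := Finset.card_filter_add_card_filter_not (s := C.flatten.toFinset.filter P) Q
  rw [Finset.filter_filter, Finset.filter_filter] at h
  convert h.symm

theorem alphabetSize_eq_add (Q : ℕ → Prop) (C : List (List ℕ)) :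
    alphabetSize C = alphabetSize (proj Q C) + alphabetSize (proj (fun a => ¬ Q a) C) := by
  simp only [alphabetSize_proj]
  rw [Finset.card_filter_add_card_filter_not]; rfl

theorem proj_congr {P Q : ℕ → Prop} {C : List (List ℕ)} (h : ∀ a ∈ C.flatten, (P a ↔ Q a)) :
    proj P C = proj Q C := by
  refine List.map_congr_left fun β hβ => List.filter_congr fun a ha => ?_
  simp [h a (List.mem_flatten.2 ⟨β, hβ, ha⟩)]

/-! ### Positions ordered inwards from a wing, and alphabet counts over the intervals -/

theorem Side.before_antisymm {d : Side} {p q : ℕ} (h : d.Before p q) (h' : d.Before q p) :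
    p = q := by
  cases d <;> simp only [Side.Before] at h h' <;> omega

theorem Side.before_total (d : Side) (p q : ℕ) : d.Before p q ∨ d.Before q p := by
  cases d <;> simp only [Side.Before] <;> omega

theorem Side.before_refl (d : Side) (p : ℕ) : d.Before p p := by
  cases d <;> simp [Side.Before]

theorem Side.opp_before {d : Side} {p q : ℕ} : d.opp.Before p q ↔ d.Before q p := by
  cases d <;> rfl

theorem Side.before_div {d : Side} {p q : ℕ} (h : d.Before p q) (k : ℕ) :
    d.Before (p / k) (q / k) := by
  cases d <;> exact Nat.div_le_div_right h

/-- A nonempty bounded set of positions has an outermost element. -/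
theorem Side.exists_before (d : Side) {P : ℕ → Prop} {N : ℕ} (hN : ∀ p, P p → p < N)
    (h : ∃ p, P p) : ∃ p, P p ∧ ∀ p', P p' → d.Before p p' := by
  cases d with
  | dove => exact ⟨Nat.find h, Nat.find_spec h, fun p' hp' => Nat.find_min' h hp'⟩
  | hawk =>
    obtain ⟨p₀, hp₀⟩ := h
    refine ⟨Nat.findGreatest P N, Nat.findGreatest_spec (hN _ hp₀).le hp₀, fun p' hp' => ?_⟩
    exact Nat.le_findGreatest (hN _ hp').le hp'

/-- Every symbol has exactly one outermost interval of type `d`, so it is charged once. -/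
theorem sum_alphabetSize_extreme (B : List (List ℕ)) (r : ℕ) (d : Side) (A : ℕ → Prop) :
    ∑ q ∈ Finset.range (numIntervals B.length r),
      alphabetSize (proj (fun a => A a ∧ IsExtreme (blocksOf B) r d q a) (chunk B r q)) =
    alphabetSize (proj A B) := by
  simp only [alphabetSize_proj]
  rw [← Finset.card_biUnion]
  · congr 1
    ext a
    simp only [Finset.mem_biUnion, Finset.mem_range, Finset.mem_filter, List.mem_toFinset,
      mem_chunk_flatten]
    constructor
    · rintro ⟨q, -, ⟨p, -, hp⟩, hA, -⟩
      exact ⟨mem_flatten_iff.2 ⟨p, hp⟩, hA⟩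
    · rintro ⟨ha, hA⟩
      obtain ⟨p, hp⟩ := mem_flatten_iff.1 ha
      obtain ⟨q, hq, hq'⟩ := d.exists_before
        (P := fun q => a ∈ intervalAlphabet (blocksOf B) r q)
        (fun q => lt_numIntervals_of_mem fun p => lt_length_of_mem_blocksOf) ⟨_, p, rfl, hp⟩
      exact ⟨q, lt_numIntervals_of_mem (fun p => lt_length_of_mem_blocksOf) hq, hq, hA, hq'⟩
  · intro q _ q' _ hne
    refine Finset.disjoint_left.2 fun a ha ha' => hne ?_
    simp only [Finset.mem_filter, List.mem_toFinset, mem_chunk_flatten] at ha ha'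
    exact Side.before_antisymm (ha.2.2 _ ha'.1) (ha'.2.2 _ ha.1)

theorem isExtreme_of_not_isGlobal {S : ℕ → Set ℕ} {r q a : ℕ} (d : Side)
    (h : ¬ IsGlobal S r a) (ha : a ∈ intervalAlphabet S r q) : IsExtreme S r d q a := by
  intro q' ha'
  by_cases hq : q = q'
  · exact hq ▸ d.before_refl q
  · exact absurd ⟨q, q', hq, ha, ha'⟩ h

theorem sum_alphabetSize_local (B : List (List ℕ)) (r : ℕ) :
    ∑ q ∈ Finset.range (numIntervals B.length r),
      alphabetSize (proj (fun a => ¬ IsGlobal (blocksOf B) r a) (chunk B r q)) =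
    alphabetSize (proj (fun a => ¬ IsGlobal (blocksOf B) r a) B) := by
  rw [← sum_alphabetSize_extreme B r .dove]
  refine Finset.sum_congr rfl fun q _ => ?_
  rw [proj_congr fun a ha => ?_]
  exact ⟨fun h => ⟨h, isExtreme_of_not_isGlobal _ h (mem_chunk_flatten.1 ha)⟩, And.left⟩

theorem alphabetSize_contractedList (B : List (List ℕ)) (r : ℕ) :
    alphabetSize (contractedList B r) = alphabetSize (proj (IsGlobal (blocksOf B) r) B) := by
  rw [alphabetSize_proj, alphabetSize]
  congr 1
  ext a
  simp only [List.mem_toFinset, mem_flatten_iff, blocksOf_contractedList, Finset.mem_filter,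
    contracted, Set.mem_ofPred_eq]
  constructor
  · rintro ⟨q, h, p, -, hp⟩; exact ⟨⟨p, hp⟩, h⟩
  · rintro ⟨⟨p, hp⟩, h⟩; exact ⟨_, h, p, rfl, hp⟩

theorem length_flatten_contractedList (B : List (List ℕ)) (r : ℕ) :
    (contractedList B r).flatten.length = ∑ q ∈ Finset.range (numIntervals B.length r),
      alphabetSize (proj (IsGlobal (blocksOf B) r) (chunk B r q)) := by
  rw [contractedList, List.length_flatten, List.map_map, Finset.sum_range]
  rw [← List.sum_ofFn, List.ofFn_eq_map, ← List.map_coe_finRange_eq_range, List.map_map]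
  congr 1
  refine List.map_congr_left fun q _ => ?_
  simp [alphabetSize, flatten_proj, List.card_toFinset]

theorem sum_alphabetSize_local_add (B : List (List ℕ)) (r : ℕ) :
    ∑ q ∈ Finset.range (numIntervals B.length r),
      alphabetSize (proj (fun a => ¬ IsGlobal (blocksOf B) r a) (chunk B r q)) +
    alphabetSize (contractedList B r) = alphabetSize B := by
  rw [sum_alphabetSize_local, alphabetSize_contractedList, add_comm, ← alphabetSize_eq_add]

/-- The global symbols of interval `q` appearing both in earlier and in later intervals. -/
def IsMiddle (S : ℕ → Set ℕ) (r q a : ℕ) : Prop :=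
  IsGlobal S r a ∧ ¬ IsExtreme S r .dove q a ∧ ¬ IsExtreme S r .hawk q a

theorem exists_of_not_isExtreme_dove {S : ℕ → Set ℕ} {r q a : ℕ}
    (h : ¬ IsExtreme S r .dove q a) : ∃ q', q' < q ∧ a ∈ intervalAlphabet S r q' := by
  simp only [IsExtreme, Side.Before, not_forall, not_le] at h
  obtain ⟨q', h1, h2⟩ := h; exact ⟨q', h2, h1⟩

theorem exists_of_not_isExtreme_hawk {S : ℕ → Set ℕ} {r q a : ℕ}
    (h : ¬ IsExtreme S r .hawk q a) : ∃ q', q < q' ∧ a ∈ intervalAlphabet S r q' := by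
  simp only [IsExtreme, Side.Before, not_forall, not_le] at h
  obtain ⟨q', h1, h2⟩ := h; exact ⟨q', h2, h1⟩

theorem IsGlobal.not_isExtreme_hawk {S : ℕ → Set ℕ} {r q a : ℕ} (h : IsGlobal S r a)
    (hd : IsExtreme S r .dove q a) : ¬ IsExtreme S r .hawk q a := by
  obtain ⟨q₁, q₂, hne, h1, h2⟩ := h
  intro hh
  have := hd _ h1; have := hd _ h2; have := hh _ h1; have := hh _ h2
  simp only [Side.Before] at *
  omega

/-- The projection onto symbols with first or last appearance here has lower order. -/
theorem IsBlocked.extreme {s : ℕ} {B : List (List ℕ)} (h : IsBlocked (s + 1) B) (r : ℕ)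
    (d : Side) (q : ℕ) : IsBlocked s
      (proj (fun a => IsGlobal (blocksOf B) r a ∧ IsExtreme (blocksOf B) r d q a)
        (chunk B r q)) := by
  cases d with
  | dove => exact h.proj_chunk_of_later fun a _ ha =>
      exists_of_not_isExtreme_hawk (ha.1.not_isExtreme_hawk ha.2)
  | hawk => exact h.proj_chunk_of_earlier fun a _ ha =>
      exists_of_not_isExtreme_dove fun hd => ha.1.not_isExtreme_hawk hd ha.2

theorem proj_and_not_dove_and_hawk (S : ℕ → Set ℕ) (r q : ℕ) (C : List (List ℕ)) :
    proj (fun a => (IsGlobal S r a ∧ ¬ IsExtreme S r .dove q a) ∧ IsExtreme S r .hawk q a) C =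
      proj (fun a => IsGlobal S r a ∧ IsExtreme S r .hawk q a) C :=
  proj_congr fun _ _ => ⟨fun h => ⟨h.1.1, h.2⟩,
    fun h => ⟨⟨h.1, fun hd => h.1.not_isExtreme_hawk hd h.2⟩, h.2⟩⟩

theorem proj_and_not_dove_and_not_hawk (S : ℕ → Set ℕ) (r q : ℕ) (C : List (List ℕ)) :
    proj (fun a => (IsGlobal S r a ∧ ¬ IsExtreme S r .dove q a) ∧ ¬ IsExtreme S r .hawk q a) C =
      proj (IsMiddle S r q) C :=
  proj_congr fun _ _ => and_assoc

/-- An occurrence in the contracted sequence is a first, a last or a middle appearance, and a global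
symbol has one first and one last appearance, in different intervals. -/
theorem sum_alphabetSize_middle (B : List (List ℕ)) (r : ℕ) :
    ∑ q ∈ Finset.range (numIntervals B.length r),
      alphabetSize (proj (IsMiddle (blocksOf B) r q) (chunk B r q)) +
    2 * alphabetSize (contractedList B r) = (contractedList B r).flatten.length := by
  rw [length_flatten_contractedList, two_mul]
  nth_rewrite 1 [alphabetSize_contractedList, ← sum_alphabetSize_extreme B r .dove]
  rw [alphabetSize_contractedList, ← sum_alphabetSize_extreme B r .hawk,
    ← Finset.sum_add_distrib, ← Finset.sum_add_distrib]
  refine Finset.sum_congr rfl fun q _ => ?_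
  rw [alphabetSize_proj_add (IsGlobal (blocksOf B) r) (IsExtreme (blocksOf B) r .dove q)
      (chunk B r q),
    alphabetSize_proj_add (fun a => _ ∧ ¬ _) (IsExtreme (blocksOf B) r .hawk q) (chunk B r q),
    add_comm, add_assoc, proj_and_not_dove_and_hawk, proj_and_not_dove_and_not_hawk]

theorem length_chunk_eq_add (B : List (List ℕ)) (r q : ℕ) :
    (chunk B r q).flatten.length =
      (proj (fun a => ¬ IsGlobal (blocksOf B) r a) (chunk B r q)).flatten.length +
      (proj (fun a => IsGlobal (blocksOf B) r a ∧ IsExtreme (blocksOf B) r .dove q a)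
        (chunk B r q)).flatten.length +
      (proj (fun a => IsGlobal (blocksOf B) r a ∧ IsExtreme (blocksOf B) r .hawk q a)
        (chunk B r q)).flatten.length +
      (proj (IsMiddle (blocksOf B) r q) (chunk B r q)).flatten.length := by
  rw [length_flatten_eq_add (IsGlobal (blocksOf B) r) (chunk B r q),
    length_flatten_proj_add _ (IsExtreme (blocksOf B) r .dove q) (chunk B r q),
    length_flatten_proj_add (fun a => _ ∧ ¬ _) (IsExtreme (blocksOf B) r .hawk q) (chunk B r q)]
  rw [proj_and_not_dove_and_hawk, proj_and_not_dove_and_not_hawk]; omega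

/-! ### The general recurrence for sequence lengths -/

theorem LengthBound.sum_le {s α β r : ℕ} (hb : LengthBound s α β (2 ^ r)) {B : List (List ℕ)}
    {P : ℕ → ℕ → Prop} (hP : ∀ q, IsBlocked s (proj (P q) (chunk B r q))) :
    ∑ q ∈ Finset.range (numIntervals B.length r), (proj (P q) (chunk B r q)).flatten.length ≤
      α * ∑ q ∈ Finset.range (numIntervals B.length r), alphabetSize (proj (P q) (chunk B r q)) +
        β * (B.length - 1) := by
  refine (Finset.sum_le_sum fun q _ => hb _ (hP q) ?_).trans ?_
  · rw [length_proj, length_chunk]; exact min_le_left _ _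
  · rw [Finset.sum_add_distrib, ← Finset.mul_sum, ← Finset.mul_sum]
    refine Nat.add_le_add_left (Nat.mul_le_mul_left _ ?_) _
    simpa only [length_proj, length_chunk] using sum_intervalSize_pred_le B.length r

/-- The part common to the general recurrence and to the one for order five, which differ only in
how the middle sum is estimated. Here `n` is the number of local symbols. -/
theorem IsBlocked.length_le_add_middle {s r α β α₁ β₁ : ℕ} {B : List (List ℕ)}
    (hB : IsBlocked (s + 1) B) (hloc : LengthBound (s + 1) α β (2 ^ r))
    (hext : LengthBound s α₁ β₁ (2 ^ r)) :
    ∃ n, n + alphabetSize (contractedList B r) = alphabetSize B ∧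
      B.flatten.length ≤ α * n + β * (B.length - 1) +
        2 * (α₁ * alphabetSize (contractedList B r) + β₁ * (B.length - 1)) +
        ∑ q ∈ Finset.range (numIntervals B.length r),
          (proj (IsMiddle (blocksOf B) r q) (chunk B r q)).flatten.length := by
  refine ⟨_, sum_alphabetSize_local_add B r, ?_⟩
  rw [length_flatten_eq_sum B r]
  simp only [length_chunk_eq_add, Finset.sum_add_distrib]
  have h1 := hloc.sum_le (P := fun _ a => ¬ IsGlobal (blocksOf B) r a)
    fun q => hB.proj_chunk _ r q
  have h2 := hext.sum_le fun q => hB.extreme r .dove q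
  have h3 := hext.sum_le fun q => hB.extreme r .hawk q
  rw [sum_alphabetSize_extreme, ← alphabetSize_contractedList] at h2 h3
  omega

theorem IsBlocked.middle {s : ℕ} {B : List (List ℕ)} (h : IsBlocked (s + 2) B) (r q : ℕ) :
    IsBlocked s (proj (IsMiddle (blocksOf B) r q) (chunk B r q)) :=
  h.proj_chunk_of_middle fun _ _ ha =>
    ⟨exists_of_not_isExtreme_dove ha.2.1, exists_of_not_isExtreme_hawk ha.2.2⟩

theorem LengthBound.mono {s α β M α' β' M' : ℕ} (h : LengthBound s α β M) (hα : α ≤ α')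
    (hβ : β ≤ β') (hM : M' ≤ M) : LengthBound s α' β' M' := fun B hB hl =>
  (h B hB (hl.trans hM)).trans
    (Nat.add_le_add (Nat.mul_le_mul_right _ hα) (Nat.mul_le_mul_right _ hβ))

/-- Contraction divides the number of blocks by `2 ^ r`, so a large coefficient for the contracted
sequence costs only `γ` per original block. -/
theorem mul_numIntervals_pred_le {β γ r m : ℕ} (h : β ≤ γ * 2 ^ r) :
    β * (numIntervals m r - 1) ≤ γ * (m - 1) :=
  calc β * (numIntervals m r - 1) ≤ γ * 2 ^ r * (numIntervals m r - 1) := Nat.mul_le_mul_right _ h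
    _ = γ * ((numIntervals m r - 1) * 2 ^ r) := by ring
    _ ≤ γ * (m - 1) := Nat.mul_le_mul_left _ (numIntervals_pred_mul_le m r)

/-- The recurrence for `λ_s`: local symbols, first and last appearances, middle appearances. -/
theorem LengthBound.step {s r M M' α β₀ α' β' γ α₁ β₁ α₂ β₂ β : ℕ}
    (hloc : LengthBound (s + 2) α β₀ (2 ^ r)) (hcon : LengthBound (s + 2) α' β' M')
    (h₁ : LengthBound (s + 1) α₁ β₁ (2 ^ r)) (h₂ : LengthBound s α₂ β₂ (2 ^ r))
    (hM : M ≤ M' * 2 ^ r) (hγ : β' ≤ γ * 2 ^ r)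
    (hα : 2 * α₁ + α₂ * α' ≤ α + 2 * α₂) (hβ : β₀ + 2 * β₁ + α₂ * γ + β₂ ≤ β) :
    LengthBound (s + 2) α β M := by
  intro B hB hl
  obtain ⟨n, hn, hlen⟩ := hB.length_le_add_middle hloc h₁
  have hmid := h₂.sum_le fun q => hB.middle r q
  have hcount := sum_alphabetSize_middle B r
  have hc := hcon _ (isBlocked_contractedList hB r)
    (by rw [length_contractedList]; exact numIntervals_le (hl.trans hM))
  rw [length_contractedList] at hc
  have hγ' := mul_numIntervals_pred_le (m := B.length) hγ
  rw [← hn]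
  generalize alphabetSize (contractedList B r) = N at *
  generalize B.length - 1 = k at *
  generalize ∑ q ∈ Finset.range (numIntervals B.length r),
    alphabetSize (proj (IsMiddle (blocksOf B) r q) (chunk B r q)) = X at *
  -- `X` counts middle appearances; adding the `2 * N` first and last ones gives the length of the
  -- contracted sequence.
  have e1 : X + 2 * N ≤ α' * N + γ * k := by omega
  have e2 := Nat.mul_le_mul_left α₂ e1
  have e3 := Nat.mul_le_mul_right N hα
  have e4 := Nat.mul_le_mul_right k hβ
  refine hlen.trans ((Nat.add_le_add_left hmid _).trans ?_)
  nlinarith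

/-! ### Orders one and two -/

theorem IsBlocked.nodup_flatten {s : ℕ} {C : List (List ℕ)} (h : IsBlocked s C)
    (hC : C.length ≤ 1) : C.flatten.Nodup := by
  match C, hC with
  | [], _ => simp
  | [β], _ => simpa using h.nodup β

theorem IsBlocked.length_flatten_eq {s : ℕ} {C : List (List ℕ)} (h : IsBlocked s C)
    (hC : C.length ≤ 1) : C.flatten.length = alphabetSize C :=
  (List.toFinset_card_of_nodup (h.nodup_flatten hC)).symm

theorem IsBlocked.length_flatten_le_one {C : List (List ℕ)} (h : IsBlocked 0 C)
    (hC : C.length ≤ 1) : C.flatten.length ≤ 1 := by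
  have hn := h.nodup_flatten hC
  have hd := h.isDS
  match C.flatten, hn, hd with
  | [], _, _ => simp
  | [a], _, _ => simp
  | a :: b :: l, hn, hd =>
    refine absurd ?_ (hd a b (by simp at hn; tauto))
    exact List.prefix_append [a, b] l |>.sublist

theorem length_proj_chunk_zero_le (P : ℕ → Prop) (B : List (List ℕ)) (q : ℕ) :
    (proj P (chunk B 0 q)).length ≤ 1 := by
  rw [length_proj, length_chunk]; exact min_le_left _ _

theorem numIntervals_zero (m : ℕ) : numIntervals m 0 = m := by simp [numIntervals]

/-- Intervals of width `2 ^ 0` are single blocks. An order-zero block holds at most one letter, and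
the first block holds no letter seen before; hence the saving of one. -/
theorem sum_le_pred_of_earlier {B : List (List ℕ)} {P : ℕ → ℕ → Prop}
    (hB : ∀ q, IsBlocked 0 (proj (P q) (chunk B 0 q)))
    (hP : ∀ q a, P q a → ¬ IsExtreme (blocksOf B) 0 .dove q a) :
    ∑ q ∈ Finset.range B.length, (proj (P q) (chunk B 0 q)).flatten.length ≤ B.length - 1 := by
  rcases Nat.eq_zero_or_eq_succ_pred B.length with h | h
  · simp [h]
  · rw [h, Finset.sum_range_succ']
    have h0 : (proj (P 0) (chunk B 0 0)).flatten = [] := by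
      refine List.eq_nil_iff_forall_not_mem.2 fun a ha => ?_
      obtain ⟨q', hq', -⟩ := exists_of_not_isExtreme_dove (hP 0 a (mem_proj_chunk_flatten.1 ha).2)
      omega
    rw [h0]
    refine (Nat.add_le_add_right (Finset.sum_le_card_nsmul _ _ 1 fun q _ =>
      (hB _).length_flatten_le_one (length_proj_chunk_zero_le _ _ _)) _).trans ?_
    simp

/-- First appearances contribute one per symbol; the letters of a block that were seen before form a
sequence of order zero. -/
theorem lengthBound_one (M : ℕ) : LengthBound 1 1 1 M := by
  intro B hB _
  have h1 := length_flatten_eq_sum B 0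
  have h2 := sum_alphabetSize_extreme B 0 .dove (fun _ => True)
  rw [numIntervals_zero] at h1 h2
  have h3 := sum_le_pred_of_earlier (B := B)
    (P := fun q a => ¬ IsExtreme (blocksOf B) 0 .dove q a)
    (fun q => hB.proj_chunk_of_earlier fun a _ ha => exists_of_not_isExtreme_dove ha)
    fun _ _ h => h
  have h4 : alphabetSize (proj (fun _ => True) B) = alphabetSize B := by
    rw [alphabetSize_proj, Finset.filter_true, alphabetSize]
  have h5 : ∀ q, (chunk B 0 q).flatten.length =
      alphabetSize (proj (fun a => True ∧ IsExtreme (blocksOf B) 0 .dove q a) (chunk B 0 q)) +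
      (proj (fun a => ¬ IsExtreme (blocksOf B) 0 .dove q a) (chunk B 0 q)).flatten.length := by
    intro q
    rw [length_flatten_eq_add (IsExtreme (blocksOf B) 0 .dove q) (chunk B 0 q),
      (hB.proj_chunk _ 0 q).length_flatten_eq (length_proj_chunk_zero_le _ _ _)]
    simp only [true_and]
  rw [h1]
  simp only [h5, Finset.sum_add_distrib]
  omega

/-- First and last appearances contribute at most two per symbol; the middle letters of each block
form a sequence of order zero. -/
theorem lengthBound_two (M : ℕ) : LengthBound 2 2 1 M := by
  intro B hB _
  have h1 := length_flatten_eq_sum B 0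
  have h2 := sum_alphabetSize_extreme B 0 .dove (IsGlobal (blocksOf B) 0)
  have h3 := sum_alphabetSize_extreme B 0 .hawk (IsGlobal (blocksOf B) 0)
  have h4 := sum_alphabetSize_local_add B 0
  rw [← alphabetSize_contractedList] at h2 h3
  rw [numIntervals_zero] at h1 h2 h3 h4
  have h5 := sum_le_pred_of_earlier (B := B) (P := IsMiddle (blocksOf B) 0)
    (fun q => hB.middle 0 q) fun _ _ h => h.2.1
  have h6 : ∀ P q, (proj P (chunk B 0 q)).flatten.length = alphabetSize (proj P (chunk B 0 q)) :=
    fun P q => (hB.proj_chunk _ 0 q).length_flatten_eq (length_proj_chunk_zero_le _ _ _)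
  rw [h1]
  simp only [length_chunk_eq_add, Finset.sum_add_distrib]
  simp only [h6] at h5 ⊢
  omega


/-! ### Nodes -/

theorem anc_leaf_iff {u : Node} {p : ℕ} : Anc u (0, p) ↔ p / 2 ^ u.1 = u.2 := by
  simp [Anc]

theorem div_pow_div_pow (p : ℕ) {k l : ℕ} (h : k ≤ l) : p / 2 ^ k / 2 ^ (l - k) = p / 2 ^ l := by
  rw [Nat.div_div_eq_div_mul, ← pow_add, Nat.add_sub_cancel' h]

theorem Anc.trans {u v w : Node} (h : Anc u v) (h' : Anc v w) : Anc u w := by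
  obtain ⟨h1, h2⟩ := h
  obtain ⟨h3, h4⟩ := h'
  refine ⟨h3.trans h1, ?_⟩
  rw [← h2, ← h4, Nat.div_div_eq_div_mul, ← pow_add]
  congr 2; omega

theorem anc_of_anc_leaf {u w : Node} {p : ℕ} (h : Anc u (0, p)) (h' : Anc w (0, p))
    (hl : u.1 ≤ w.1) : Anc w u := by
  rw [anc_leaf_iff] at h h'
  exact ⟨hl, by rw [← h, ← h', div_pow_div_pow _ hl]⟩

theorem Anc.level_lt {w z : Node} (h : Anc w z) (hne : w ≠ z) : z.1 < w.1 := by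
  refine lt_of_le_of_ne h.1 fun he => hne ?_
  have := h.2
  rw [he, Nat.sub_self, pow_zero, Nat.div_one] at this
  exact Prod.ext he.symm this.symm

theorem mul_pow_add_div (q p : ℕ) {r l : ℕ} (h : l ≤ r) :
    (q * 2 ^ r + p) / 2 ^ l = q * 2 ^ (r - l) + p / 2 ^ l := by
  obtain ⟨k, rfl⟩ := Nat.exists_eq_add_of_le h
  have h2 : 0 < 2 ^ l := by positivity
  rw [Nat.add_sub_cancel_left, pow_add, show q * (2 ^ l * 2 ^ k) = 2 ^ l * (q * 2 ^ k) by ring,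
    Nat.mul_add_div h2]

/-- The node of the main tree that corresponds to node `v` of the tree of interval `q`. -/
def liftNode (r q : ℕ) (v : Node) : Node := (v.1, q * 2 ^ (r - v.1) + v.2)

theorem liftNode_injective (r q : ℕ) : Function.Injective (liftNode r q) := by
  rintro ⟨l, k⟩ ⟨l', k'⟩ h
  simp only [liftNode, Prod.mk.injEq] at h
  obtain ⟨rfl, h⟩ := h
  simpa using h

theorem anc_liftNode_iff {r q : ℕ} {u v : Node} (hu : u.1 ≤ r) :
    Anc (liftNode r q u) (liftNode r q v) ↔ Anc u v := by
  simp only [Anc, liftNode]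
  refine and_congr_right fun h => ?_
  rw [show r - v.1 = (r - u.1) + (u.1 - v.1) by omega, mul_pow_add_div _ _ (by omega),
    show r - u.1 + (u.1 - v.1) - (u.1 - v.1) = r - u.1 by omega]
  omega

theorem liftNode_leaf (r q p : ℕ) : liftNode r q (0, p) = (0, q * 2 ^ r + p) := by
  simp [liftNode]

/-! ### Blocks of a composed tree -/

section
variable {α : Type*} {S : ℕ → Set α} {a : α} {m r q : ℕ} {d : Side}

theorem mem_interval_div {p : ℕ} (h : a ∈ S p) : a ∈ intervalAlphabet S r (p / 2 ^ r) :=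
  ⟨p, rfl, h⟩

theorem interval_unique (hg : ¬ IsGlobal S r a) {q q' : ℕ} (h : a ∈ intervalAlphabet S r q)
    (h' : a ∈ intervalAlphabet S r q') : q = q' := by
  by_contra hne; exact hg ⟨q, q', hne, h, h'⟩

theorem support_contracted (hS : ∀ a p, a ∈ S p → p < m) (r : ℕ) :
    ∀ a q, a ∈ contracted S r q → q < numIntervals m r :=
  fun a _ h => lt_numIntervals_of_mem (hS a) h.2

theorem support_localPart (hS : ∀ a p, a ∈ S p → p < m) (r q : ℕ) :
    ∀ a p, a ∈ localPart S r q p → p < intervalSize m r q := by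
  rintro a p ⟨h1, h2, -⟩
  have := hS a _ h2
  rw [intervalSize]; omega

theorem support_extremePart (hS : ∀ a p, a ∈ S p → p < m) (r : ℕ) (d : Side) (q : ℕ) :
    ∀ a p, a ∈ extremePart S r d q p → p < intervalSize m r q := by
  rintro a p ⟨h1, h2, -⟩
  have := hS a _ h2
  rw [intervalSize]; omega

namespace DTree

theorem block_leaf (T : DTree m) (S : ℕ → Set α) {v : Node} (hv : v.1 = 0) :
    T.block S v = S v.2 := by
  cases T <;> simp [block, hv]

theorem exists_leaf_of_mem_block (T : DTree m) {S : ℕ → Set α} {v : Node}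
    (h : a ∈ T.block S v) : ∃ p, a ∈ S p ∧ p / 2 ^ v.1 = v.2 := by
  induction T generalizing S v with
  | base hm =>
    by_cases hv : v.1 = 0 <;> simp [block, hv] at h
    exact ⟨v.2, h, by simp [hv]⟩
  | comp r hr hm top loc ihtop ihloc =>
    rw [block] at h
    split_ifs at h with h1 h2
    · exact ⟨v.2, h, by simp [h1]⟩
    · obtain ⟨p, ⟨-, hp, -⟩, hp'⟩ := ihloc _ h
      refine ⟨_, hp, ?_⟩
      rw [mul_pow_add_div _ _ h2.le]
      simp only at hp'
      rw [hp', Nat.div_add_mod']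
    · obtain ⟨q, ⟨-, p, rfl, hp⟩, hq⟩ := ihtop h
      refine ⟨p, hp, ?_⟩
      rw [← hq, div_pow_div_pow _ (not_lt.1 h2)]

/-- Serves to keep the nodes of a local tree that carry a symbol strictly below level `r`, where the
global tree begins. -/
theorem two_pow_lt_of_mem_block (T : DTree m) {S : ℕ → Set α} {v : Node}
    (h : a ∈ T.block S v) (hv : v.1 ≠ 0) : 2 ^ v.1 < m := by
  induction T generalizing S v with
  | base hm => simp [block, hv] at h
  | @comp m r hr hm top loc ihtop ihloc =>
    rw [block, if_neg hv] at h
    split_ifs at h with h2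
    · exact (ihloc _ h hv).trans_le ((min_le_right _ _).trans (Nat.sub_le _ _))
    · rcases eq_or_lt_of_le (not_lt.1 h2) with h3 | h3
      · rwa [← h3]
      · have := ihtop h (by simp only; omega)
        rw [lt_numIntervals_iff, ← pow_add] at this
        rwa [show v.1 = v.1 - r + r by omega]

/-- A block above leaf level originates as a leaf of a global tree, in a composition where its
symbols are global and so occur in another interval. Hence such a node lies strictly below the
crown. -/
theorem exists_leaf_not_below (T : DTree m) {S : ℕ → Set α} {v : Node}
    (h : a ∈ T.block S v) (hv : v.1 ≠ 0) : ∃ p, a ∈ S p ∧ p / 2 ^ v.1 ≠ v.2 := by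
  induction T generalizing S v with
  | base hm => simp [block, hv] at h
  | @comp m r hr hm top loc ihtop ihloc =>
    rw [block, if_neg hv] at h
    split_ifs at h with h2
    · obtain ⟨p, ⟨-, hp, -⟩, hp'⟩ := ihloc _ h hv
      refine ⟨_, hp, ?_⟩
      rw [mul_pow_add_div _ _ h2.le]
      intro hc
      refine hp' ?_
      simp only
      rw [← Nat.div_add_mod' v.2 (2 ^ (r - v.1))] at hc
      rw [Nat.div_add_mod'] at hc
      have := Nat.div_add_mod' v.2 (2 ^ (r - v.1))
      omega
    · rcases eq_or_lt_of_le (not_lt.1 h2) with h3 | h3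
      · have h4 := (block_leaf top (contracted S r) (v := (v.1 - r, v.2)) (by simp [h3])) ▸ h
        obtain ⟨q₁, q₂, hne, ⟨p₁, rfl, hp₁⟩, ⟨p₂, rfl, hp₂⟩⟩ := h4.1
        rw [← h3]
        by_cases h5 : p₁ / 2 ^ r = v.2
        · exact ⟨p₂, hp₂, fun h6 => hne (h5.trans h6.symm)⟩
        · exact ⟨p₁, hp₁, h5⟩
      · obtain ⟨q, ⟨-, p, rfl, hp⟩, hq⟩ := ihtop h (by simp only; omega)
        refine ⟨p, hp, ?_⟩
        rwa [div_pow_div_pow _ h3.le] at hq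

variable {hr : 1 ≤ r} {hm : 2 ^ r < m} {top : DTree (numIntervals m r)}
  {loc : ∀ q : ℕ, DTree (intervalSize m r q)}

/-- Levels strictly between `0` and `r` come from the local trees and hold no global symbol. -/
theorem mem_block_of_isGlobal (hg : IsGlobal S r a) {v : Node} :
    a ∈ (comp r hr hm top loc).block S v ↔
      (v.1 = 0 ∧ a ∈ S v.2) ∨ (r ≤ v.1 ∧ a ∈ top.block (contracted S r) (v.1 - r, v.2)) := by
  rw [block]
  split_ifs with h1 h2
  · simp only [h1, true_and]
    constructor
    · exact .inl
    · rintro (h | h)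
      · exact h
      · omega
  · constructor
    · intro h
      obtain ⟨p, ⟨-, -, hp⟩, -⟩ := exists_leaf_of_mem_block _ h
      exact absurd hg hp
    · omega
  · simp only [h1, false_and, false_or, not_lt.1 h2, true_and]

/-- The alternative `r = 0` is the degenerate width, which no composition uses. -/
theorem local_mem_block {v : Node} (h : a ∈ (loc q).block (localPart S r q) v) :
    v.1 < r ∧ v.2 < 2 ^ (r - v.1) ∨ r = 0 := by
  by_cases hr : r = 0
  · exact .inr hr
  · left
    have h1 : v.1 < r := by
      by_cases hv : v.1 = 0
      · omega
      · have := (two_pow_lt_of_mem_block _ h hv).trans_le (min_le_left _ _)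
        exact (Nat.pow_lt_pow_iff_right one_lt_two).1 this
    refine ⟨h1, ?_⟩
    obtain ⟨p, ⟨hp, -⟩, hp'⟩ := exists_leaf_of_mem_block _ h
    rw [← hp', Nat.div_lt_iff_lt_mul (by positivity), ← pow_add, Nat.sub_add_cancel h1.le]
    exact hp

theorem mem_block_of_isLocal (hg : ¬ IsGlobal S r a) (ha : a ∈ intervalAlphabet S r q)
    {v : Node} : a ∈ (comp r hr hm top loc).block S v ↔
      ∃ v', v = liftNode r q v' ∧ a ∈ (loc q).block (localPart S r q) v' := by
  constructor
  · intro h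
    rw [block] at h
    split_ifs at h with h1 h2
    · refine ⟨(0, v.2 % 2 ^ r), ?_, ?_⟩
      · rw [interval_unique hg ha (mem_interval_div h), liftNode_leaf, Nat.div_add_mod']
        exact Prod.ext h1 rfl
      · rw [block_leaf _ _ rfl, interval_unique hg ha (mem_interval_div h)]
        exact ⟨Nat.mod_lt _ (by positivity), by simpa [Nat.div_add_mod'] using h, hg⟩
    · obtain ⟨p, ⟨hp, hp', -⟩, -⟩ := exists_leaf_of_mem_block _ h
      have hq := interval_unique hg ha (mem_interval_div hp')
      rw [mul_comm, Nat.mul_add_div (by positivity), Nat.div_eq_of_lt hp, add_zero] at hq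
      subst hq
      refine ⟨_, ?_, h⟩
      rw [liftNode, Nat.div_add_mod']
    · obtain ⟨q', ⟨hg', -⟩, -⟩ := exists_leaf_of_mem_block _ h
      exact absurd hg' hg
  · rintro ⟨v', rfl, h⟩
    rcases local_mem_block h with ⟨h1, h2⟩ | h0
    · rw [block]
      simp only [liftNode, h1, if_true]
      split_ifs with h3
      · rw [block_leaf _ _ h3] at h
        simpa [h3] using h.2.1
      · rw [mul_comm q, Nat.mul_add_div (by positivity), Nat.div_eq_of_lt h2, add_zero,
          Nat.mul_add_mod, Nat.mod_eq_of_lt h2]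
        exact h
    · omega

/-! ### Parents in a composed tree -/

theorem IsParent.level_lt {T : DTree m} {w z : Node} (h : T.IsParent S a w z) : z.1 < w.1 :=
  h.2.2.2.1.level_lt h.2.2.1

theorem not_isParent_base {hm : m ≤ 2} {w z : Node} : ¬ (base hm).IsParent S a w z := by
  intro h
  have h1 := h.level_lt
  have h2 := h.1
  simp [block, show w.1 ≠ 0 by omega] at h2

/-- For a global symbol the tree is the global tree raised by `r` levels, with each leaf hung
directly under the node of its interval. -/
theorem isParent_of_isGlobal (hg : IsGlobal S r a) {w z : Node} :
    (comp r hr hm top loc).IsParent S a w z ↔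
      (r ≤ z.1 ∧ r ≤ w.1 ∧
        top.IsParent (contracted S r) a (w.1 - r, w.2) (z.1 - r, z.2)) ∨
      (z.1 = 0 ∧ a ∈ S z.2 ∧ w = (r, z.2 / 2 ^ r)) := by
  have hblk := fun v => mem_block_of_isGlobal (hr := hr) (hm := hm) (top := top) (loc := loc) hg
    (v := v)
  have hleaf : ∀ p, a ∈ S p → a ∈ top.block (contracted S r) (0, p / 2 ^ r) := fun p hp => by
    rw [block_leaf _ _ rfl]; exact ⟨hg, mem_interval_div hp⟩
  constructor
  · intro h
    obtain ⟨hw, hz, hne, hanc, hmin⟩ := h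
    have hlt := hanc.level_lt hne
    rcases (hblk z).1 hz with ⟨hz0, hz⟩ | ⟨hzr, hz⟩
    · right
      refine ⟨hz0, hz, ?_⟩
      have hz' : z = (0, z.2) := Prod.ext hz0 rfl
      rcases (hblk w).1 hw with ⟨hw0, -⟩ | ⟨hwr, -⟩
      · omega
      have h3 := hmin (r, z.2 / 2 ^ r) ((hblk _).2 (.inr ⟨le_rfl, by simpa using hleaf _ hz⟩))
        (by rw [hz']; simp; omega) (by rw [hz']; exact anc_leaf_iff.2 rfl)
      by_contra hne'
      have := h3.level_lt (Ne.symm hne')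
      simp only at this
      omega
    · left
      rcases (hblk w).1 hw with ⟨hw0, -⟩ | ⟨hwr, hw⟩
      · omega
      refine ⟨hzr, hwr, hw, hz, ?_, ?_, ?_⟩
      · intro h
        simp only [Prod.mk.injEq] at h
        omega
      · refine ⟨by simp only; omega, ?_⟩
        rw [← hanc.2]; simp only; congr 2; omega
      · intro u hu hne' hanc'
        have h1 := hmin (u.1 + r, u.2) ((hblk _).2 (.inr ⟨by simp, by simpa using hu⟩))
          (fun h => hne' (by rw [← h]; simp))
          ⟨by have := hanc'.1; simp only at this ⊢; omega, by
            have := hanc'.2; simp only at this ⊢; rw [← this]; congr 2; omega⟩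
        exact ⟨by have := h1.1; simp only at this ⊢; omega, by
            have := h1.2; simp only at this ⊢; rw [← this]; congr 2; omega⟩
  · rintro (⟨hzr, hwr, hw, hz, hne, hanc, hmin⟩ | ⟨hz0, hz, rfl⟩)
    · have hlt := hanc.level_lt hne
      simp only at hlt
      refine ⟨(hblk w).2 (.inr ⟨hwr, hw⟩), (hblk z).2 (.inr ⟨hzr, hz⟩), ?_, ?_, ?_⟩
      · rintro rfl; exact hne rfl
      · refine ⟨by omega, ?_⟩
        have := hanc.2; simp only at this; rw [← this]; congr 2; omega
      · intro u hu hne' hanc'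
        have h0 := hanc'.level_lt hne'
        rcases (hblk u).1 hu with ⟨hu0, -⟩ | ⟨hur, hu⟩
        · omega
        have h1 := hmin (u.1 - r, u.2) hu (fun h => hne' (by
            simp only [Prod.mk.injEq] at h; exact Prod.ext (by omega) h.2))
          ⟨by simp only; omega, by
            have := hanc'.2; simp only at this ⊢; rw [← this]; congr 2; omega⟩
        exact ⟨by have := h1.1; simp only at this ⊢; omega, by
            have := h1.2; simp only at this ⊢; rw [← this]; congr 2; omega⟩
    · have hz' : z = (0, z.2) := Prod.ext hz0 rfl
      refine ⟨(hblk _).2 (.inr ⟨le_rfl, by simpa using hleaf _ hz⟩), (hblk z).2 (.inl ⟨hz0, hz⟩),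
        ?_, ?_, ?_⟩
      · rw [hz']; simp; omega
      · rw [hz']; exact anc_leaf_iff.2 rfl
      · intro u hu hne' hanc'
        have h0 := hanc'.level_lt hne'
        rcases (hblk u).1 hu with ⟨hu0, -⟩ | ⟨hur, hu⟩
        · omega
        rw [hz'] at hanc'
        exact anc_of_anc_leaf (p := z.2) (anc_leaf_iff.2 rfl) hanc' hur

theorem isParent_of_isLocal (hg : ¬ IsGlobal S r a) (ha : a ∈ intervalAlphabet S r q)
    {w z : Node} : (comp r hr hm top loc).IsParent S a w z ↔
      ∃ w' z', w = liftNode r q w' ∧ z = liftNode r q z' ∧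
        (loc q).IsParent (localPart S r q) a w' z' := by
  have hblk := fun v => mem_block_of_isLocal (hr := hr) (hm := hm) (top := top) (loc := loc) hg
    ha (v := v)
  have hlt : ∀ v, a ∈ (loc q).block (localPart S r q) v → v.1 ≤ r := fun v hv => by
    rcases local_mem_block hv with h | h <;> omega
  constructor
  · rintro ⟨hw, hz, hne, hanc, hmin⟩
    obtain ⟨w', rfl, hw'⟩ := (hblk _).1 hw
    obtain ⟨z', rfl, hz'⟩ := (hblk _).1 hz
    refine ⟨w', z', rfl, rfl, hw', hz', fun h => hne (by rw [h]),
      (anc_liftNode_iff (hlt _ hw')).1 hanc, fun u hu hne' hanc' => ?_⟩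
    exact (anc_liftNode_iff (hlt _ hu)).1 (hmin _ ((hblk _).2 ⟨u, rfl, hu⟩)
      ((liftNode_injective r q).ne hne') ((anc_liftNode_iff (hlt _ hu)).2 hanc'))
  · rintro ⟨w', z', rfl, rfl, hw', hz', hne, hanc, hmin⟩
    refine ⟨(hblk _).2 ⟨w', rfl, hw'⟩, (hblk _).2 ⟨z', rfl, hz'⟩, (liftNode_injective r q).ne hne,
      (anc_liftNode_iff (hlt _ hw')).2 hanc, fun u hu hne' hanc' => ?_⟩
    obtain ⟨u', rfl, hu'⟩ := (hblk _).1 hu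
    exact (anc_liftNode_iff (hlt _ hu')).2 (hmin u' hu' (fun h => hne' (by rw [h]))
      ((anc_liftNode_iff (hlt _ hu')).1 hanc'))

/-! ### Crowns -/

/-- Whatever widths are chosen, the crown is the lowest common ancestor of all occurrences in the
binary tree of dyadic intervals: both of its halves are occupied. -/
theorem crown_spec (T : DTree m) {S : ℕ → Set α} (hS : ∀ a p, a ∈ S p → p < m) {p₁ p₂ : ℕ}
    (h₁ : a ∈ S p₁) (h₂ : a ∈ S p₂) (hne : p₁ ≠ p₂) :
    ∃ l k, T.crown S a = (l + 1, k) ∧ (∀ p, a ∈ S p → p / 2 ^ (l + 1) = k) ∧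
      (∃ p, a ∈ S p ∧ p / 2 ^ l = 2 * k) ∧ ∃ p, a ∈ S p ∧ p / 2 ^ l = 2 * k + 1 := by
  induction T generalizing S p₁ p₂ with
  | base hm =>
    have hp := fun p hp => (hS a p hp).trans_le hm
    have := hp _ h₁
    have := hp _ h₂
    refine ⟨0, 0, rfl, fun p h => ?_, ?_⟩
    · have := hp _ h; simp; omega
    · rcases (by omega : p₁ = 0 ∧ p₂ = 1 ∨ p₁ = 1 ∧ p₂ = 0) with ⟨rfl, rfl⟩ | ⟨rfl, rfl⟩
      · exact ⟨⟨0, h₁, rfl⟩, 1, h₂, rfl⟩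
      · exact ⟨⟨0, h₂, rfl⟩, 1, h₁, rfl⟩
  | @comp m r hr hm top loc ihtop ihloc =>
    by_cases hg : IsGlobal S r a
    · obtain ⟨q₁, q₂, hne', hq₁, hq₂⟩ := id hg
      obtain ⟨l, k, hc, hall, ⟨_, ⟨-, p₃, rfl, hp₃⟩, h₃⟩, _, ⟨-, p₄, rfl, hp₄⟩, h₄⟩ :=
        ihtop (support_contracted hS r) ⟨hg, hq₁⟩ ⟨hg, hq₂⟩ hne'
      refine ⟨l + r, k, ?_, fun p hp => ?_, ⟨p₃, hp₃, ?_⟩, p₄, hp₄, ?_⟩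
      · simp only [crown, hg, if_true, hc]
        congr 1; omega
      · have := hall _ ⟨hg, mem_interval_div hp⟩
        rwa [Nat.div_div_eq_div_mul, ← pow_add, show r + (l + 1) = l + r + 1 by omega] at this
      · rwa [Nat.div_div_eq_div_mul, ← pow_add, add_comm] at h₃
      · rwa [Nat.div_div_eq_div_mul, ← pow_add, add_comm] at h₄
    · have key : ∀ p, a ∈ S p → p = p₁ / 2 ^ r * 2 ^ r + p % 2 ^ r ∧
          a ∈ localPart S r (p₁ / 2 ^ r) (p % 2 ^ r) := by
        intro p hp
        have := interval_unique hg (mem_interval_div hp) (mem_interval_div h₁)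
        rw [← this, Nat.div_add_mod']
        exact ⟨rfl, Nat.mod_lt _ (by positivity), by rwa [Nat.div_add_mod'], hg⟩
      have hq : sInf {q | a ∈ intervalAlphabet S r q} = p₁ / 2 ^ r := by
        have : {q | a ∈ intervalAlphabet S r q} = {p₁ / 2 ^ r} := by
          ext q
          exact ⟨fun h => interval_unique hg h (mem_interval_div h₁),
            fun h => h ▸ mem_interval_div h₁⟩
        rw [this, csInf_singleton]
      obtain ⟨l, k, hc, hall, ⟨p₃, hp₃, h₃⟩, p₄, hp₄, h₄⟩ :=
        ihloc (p₁ / 2 ^ r) (support_localPart hS r _) (key _ h₁).2 (key _ h₂).2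
          fun h => hne (by rw [(key _ h₁).1, h, ← (key _ h₂).1])
      -- At `l ≥ r` every local position has quotient `0`, whereas `p₄` has an odd quotient.
      have hl : l + 1 ≤ r := by
        by_contra hl
        have : p₄ < 2 ^ l := hp₄.1.trans_le (Nat.pow_le_pow_right two_pos (by omega))
        rw [Nat.div_eq_of_lt this] at h₄
        omega
      refine ⟨l, p₁ / 2 ^ r * 2 ^ (r - (l + 1)) + k, ?_, fun p hp => ?_,
        ⟨_, hp₃.2.1, ?_⟩, _, hp₄.2.1, ?_⟩
      · simp only [crown, hg, if_false]
        rw [hq, hc]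
      · rw [(key p hp).1, mul_pow_add_div _ _ hl, hall _ (key p hp).2]
      · rw [mul_pow_add_div _ _ (by omega), h₃, show r - l = r - (l + 1) + 1 by omega, pow_succ]
        ring
      · rw [mul_pow_add_div _ _ (by omega), h₄, show r - l = r - (l + 1) + 1 by omega, pow_succ]
        ring

end DTree

/-! ### Wingtips and quills -/

theorem IsWingtip.unique {p p' : ℕ} (h : IsWingtip S a d p) (h' : IsWingtip S a d p') : p = p' :=
  Side.before_antisymm (h.2 _ h'.1) (h'.2 _ h.1)

namespace DTree

/-- A child leaves the wing exactly when it loses the wingtip. -/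
theorem isQuill_iff (T : DTree m) (hS : ∀ a p, a ∈ S p → p < m) {w z : Node} :
    T.IsQuill S a d w z ↔ T.IsParent S a w z ∧
      ∃ t, IsWingtip S a d t ∧ Anc w (0, t) ∧ ¬ Anc z (0, t) := by
  constructor
  · rintro ⟨⟨hw, hhead, t, ht, hwt⟩, hp, hz⟩
    exact ⟨hp, t, ht, hwt, fun hzt => hz ⟨hp.2.1, hhead.trans hp.2.2.2.1, t, ht, hzt⟩⟩
  · rintro ⟨hp, t, ht, hwt, hzt⟩
    refine ⟨⟨hp.1, ?_, t, ht, hwt⟩, hp, ?_⟩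
    · have hw0 : w.1 ≠ 0 := by have := hp.level_lt; omega
      obtain ⟨p₀, hp₀, hne⟩ := T.exists_leaf_not_below hp.1 hw0
      rw [anc_leaf_iff] at hwt
      obtain ⟨l, k, hc, hall, ⟨p₃, hp₃, h₃⟩, p₄, hp₄, h₄⟩ :=
        T.crown_spec hS ht.1 hp₀ (by rintro rfl; exact hne hwt)
      -- A node at the level of the crown or higher that contains `t` would contain `p₀` as well.
      have hl : w.1 ≤ l := by
        by_contra hl
        apply hne
        rw [← hwt, ← div_pow_div_pow _ (show l + 1 ≤ w.1 by omega), hall _ hp₀, ← hall _ ht.1,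
          div_pow_div_pow _ (by omega)]
      have htl : t / 2 ^ l / 2 = k := by
        rw [Nat.div_div_eq_div_mul, ← pow_succ]; exact hall _ ht.1
      -- Both halves of the crown are occupied, so the wingtip, being outermost, lies in the half of
      -- type `d`; thus the head is an ancestor of `w`.
      have h5 := Side.before_div (ht.2 _ hp₃) (2 ^ l)
      have h6 := Side.before_div (ht.2 _ hp₄) (2 ^ l)
      cases d <;> simp only [Side.Before] at h5 h6 <;>
        exact ⟨by simpa [head, hc] using hl, by
          simp only [head, hc, Nat.add_sub_cancel]; rw [← hwt, div_pow_div_pow _ hl]; omega⟩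
    · rintro ⟨-, -, t', ht', h⟩
      exact hzt (ht.unique ht' ▸ h)

end DTree
end

section
variable {α : Type*} {S : ℕ → Set α} {a : α} {m r q : ℕ} {d : Side}

/-! ### Feathers of composed trees -/

theorem Side.before_of_div {d : Side} {p q k : ℕ} (h : d.Before (p / k) (q / k))
    (hne : p / k ≠ q / k) : d.Before p q := by
  cases d <;> simp only [Side.Before] at h ⊢ <;> by_contra hc
  · exact hne (le_antisymm h (Nat.div_le_div_right (not_le.1 hc).le))
  · exact hne (le_antisymm (Nat.div_le_div_right (not_le.1 hc).le) h)

theorem Side.before_add_left {d : Side} {p q k : ℕ} :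
    d.Before (k + p) (k + q) ↔ d.Before p q := by
  cases d <;> simp [Side.Before]

theorem exists_isWingtip (hS : ∀ a p, a ∈ S p → p < m) {p : ℕ} (h : a ∈ S p) (d : Side) :
    ∃ t, IsWingtip S a d t :=
  d.exists_before (hS a) ⟨p, h⟩

theorem IsWingtip.to_contracted (hg : IsGlobal S r a) {t : ℕ} (ht : IsWingtip S a d t) :
    IsWingtip (contracted S r) a d (t / 2 ^ r) := by
  refine ⟨⟨hg, mem_interval_div ht.1⟩, ?_⟩
  rintro _ ⟨-, p, rfl, hp⟩
  exact Side.before_div (ht.2 p hp) _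

theorem anc_shift_iff {w : Node} (hw : r ≤ w.1) {t : ℕ} :
    Anc (w.1 - r, w.2) (0, t / 2 ^ r) ↔ Anc w (0, t) := by
  rw [anc_leaf_iff, anc_leaf_iff, div_pow_div_pow _ hw]

theorem isInnermost_leaf_iff {z : Node} (hz : z.1 = 0) {p : ℕ} :
    DTree.IsInnermost S a d z p ↔ a ∈ S p ∧ p = z.2 := by
  simp only [DTree.IsInnermost, anc_leaf_iff, hz, pow_zero, Nat.div_one]
  constructor
  · rintro ⟨h, h', -⟩; exact ⟨h, h'⟩
  · rintro ⟨h, rfl⟩; exact ⟨h, rfl, fun p' _ h => h ▸ d.before_refl _⟩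

/-- Innermost below `z` means: innermost interval below `z`, and innermost within that interval. -/
theorem isInnermost_of_isGlobal (hg : IsGlobal S r a) {z : Node} (hz : r ≤ z.1) {p : ℕ} :
    DTree.IsInnermost S a d z p ↔
      DTree.IsInnermost (contracted S r) a d (z.1 - r, z.2) (p / 2 ^ r) ∧
        DTree.IsInnermost S a d (r, p / 2 ^ r) p := by
  constructor
  · rintro ⟨h1, h2, h3⟩
    refine ⟨⟨⟨hg, mem_interval_div h1⟩, (anc_shift_iff hz).2 h2, ?_⟩, h1, anc_leaf_iff.2 rfl, ?_⟩
    · rintro _ ⟨-, p', rfl, hp'⟩ h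
      exact Side.before_div (h3 p' hp' ((anc_shift_iff hz).1 h)) _
    · intro p' hp' h
      refine h3 p' hp' ((anc_shift_iff hz).1 ?_)
      rw [anc_leaf_iff.1 h]
      exact (anc_shift_iff hz).2 h2
  · rintro ⟨⟨-, h2, h3⟩, h4, -, h5⟩
    refine ⟨h4, (anc_shift_iff hz).1 h2, fun p' hp' h => ?_⟩
    by_cases he : p' / 2 ^ r = p / 2 ^ r
    · exact h5 p' hp' (anc_leaf_iff.2 he)
    · exact Side.before_of_div (h3 _ ⟨hg, mem_interval_div hp'⟩ ((anc_shift_iff hz).2 h)) he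

theorem mem_iff_of_isLocal (hg : ¬ IsGlobal S r a) (ha : a ∈ intervalAlphabet S r q) {p : ℕ} :
    a ∈ S p ↔ ∃ p', p = q * 2 ^ r + p' ∧ a ∈ localPart S r q p' := by
  constructor
  · intro h
    refine ⟨p % 2 ^ r, ?_, Nat.mod_lt _ (by positivity), ?_, hg⟩ <;>
      rw [interval_unique hg ha (mem_interval_div h), Nat.div_add_mod']
    exact h
  · rintro ⟨p', rfl, h⟩; exact h.2.1

theorem isWingtip_of_isLocal (hg : ¬ IsGlobal S r a) (ha : a ∈ intervalAlphabet S r q) {p : ℕ} :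
    IsWingtip S a d p ↔ ∃ p', p = q * 2 ^ r + p' ∧ IsWingtip (localPart S r q) a d p' := by
  have hmem := fun p => mem_iff_of_isLocal hg ha (p := p)
  constructor
  · rintro ⟨h1, h2⟩
    obtain ⟨p', rfl, h⟩ := (hmem p).1 h1
    exact ⟨p', rfl, h, fun t ht => Side.before_add_left.1 (h2 _ ht.2.1)⟩
  · rintro ⟨p', rfl, h1, h2⟩
    refine ⟨h1.2.1, fun t ht => ?_⟩
    obtain ⟨t', rfl, ht'⟩ := (hmem t).1 ht
    exact Side.before_add_left.2 (h2 _ ht')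

theorem anc_liftNode_leaf_iff {u : Node} (hu : u.1 ≤ r) {p : ℕ} :
    Anc (liftNode r q u) (0, q * 2 ^ r + p) ↔ Anc u (0, p) := by
  rw [← liftNode_leaf, anc_liftNode_iff hu]

theorem isInnermost_of_isLocal (hg : ¬ IsGlobal S r a) (ha : a ∈ intervalAlphabet S r q)
    {z : Node} (hz : z.1 ≤ r) {p : ℕ} :
    DTree.IsInnermost S a d (liftNode r q z) p ↔
      ∃ p', p = q * 2 ^ r + p' ∧ DTree.IsInnermost (localPart S r q) a d z p' := by
  have hmem := fun p => mem_iff_of_isLocal hg ha (p := p)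
  constructor
  · rintro ⟨h1, h2, h3⟩
    obtain ⟨p', rfl, h⟩ := (hmem p).1 h1
    exact ⟨p', rfl, h, (anc_liftNode_leaf_iff hz).1 h2, fun t ht hzt =>
      Side.before_add_left.1 (h3 _ ht.2.1 ((anc_liftNode_leaf_iff hz).2 hzt))⟩
  · rintro ⟨p', rfl, h1, h2, h3⟩
    refine ⟨h1.2.1, (anc_liftNode_leaf_iff hz).2 h2, fun t ht hzt => ?_⟩
    obtain ⟨t', rfl, ht'⟩ := (hmem t).1 ht
    exact Side.before_add_left.2 (h3 _ ht' ((anc_liftNode_leaf_iff hz).1 hzt))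

namespace DTree

theorem IsQuill.level_lt {T : DTree m} {w z : Node} (h : T.IsQuill S a d w z) : z.1 < w.1 :=
  h.2.1.level_lt

theorem not_isQuill_base {hm : m ≤ 2} {w z : Node} : ¬ (base hm).IsQuill S a d w z :=
  fun h => not_isParent_base h.2.1

theorem not_isFeather_base {hm : m ≤ 2} {p : ℕ} : ¬ (base hm).IsFeather S a d p :=
  fun ⟨_, _, h, _⟩ => not_isQuill_base h

variable {hr : 1 ≤ r} {hm : 2 ^ r < m} {top : DTree (numIntervals m r)}
  {loc : ∀ q : ℕ, DTree (intervalSize m r q)}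

theorem isQuill_of_isGlobal (hS : ∀ a p, a ∈ S p → p < m) (hg : IsGlobal S r a) {w z : Node} :
    (comp r hr hm top loc).IsQuill S a d w z ↔
      (r ≤ z.1 ∧ r ≤ w.1 ∧
        top.IsQuill (contracted S r) a d (w.1 - r, w.2) (z.1 - r, z.2)) ∨
      (z.1 = 0 ∧ w = (r, z.2 / 2 ^ r) ∧ a ∈ S z.2 ∧
        IsWingtip (contracted S r) a d (z.2 / 2 ^ r) ∧ ¬ IsWingtip S a d z.2) := by
  rw [isQuill_iff _ hS, isQuill_iff _ (support_contracted hS r), isParent_of_isGlobal hg]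
  constructor
  · rintro ⟨⟨hz, hw, hp⟩ | ⟨hz, ha, rfl⟩, t, ht, hwt, hzt⟩
    · exact .inl ⟨hz, hw, hp, _, ht.to_contracted hg, (anc_shift_iff hw).2 hwt,
        fun h => hzt ((anc_shift_iff hz).1 h)⟩
    · refine .inr ⟨hz, rfl, ha, ?_, fun h => hzt ?_⟩
      · have h := anc_leaf_iff.1 hwt
        simp only at h
        exact h ▸ ht.to_contracted hg
      · rw [anc_leaf_iff, hz, ht.unique h]; simp
  · rintro (⟨hz, hw, hp, t', ht', hwt, hzt⟩ | ⟨hz, rfl, ha, ht', hzt⟩)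
    · obtain ⟨-, p, rfl, hp'⟩ := ht'.1
      obtain ⟨t, ht⟩ := exists_isWingtip hS hp' d
      rw [ht'.unique (ht.to_contracted hg)] at hwt hzt
      exact ⟨.inl ⟨hz, hw, hp⟩, t, ht, (anc_shift_iff hw).1 hwt,
        fun h => hzt ((anc_shift_iff hz).2 h)⟩
    · obtain ⟨t, ht⟩ := exists_isWingtip hS ha d
      refine ⟨.inr ⟨hz, ha, rfl⟩, t, ht, ?_, fun h => hzt ?_⟩
      · rw [anc_leaf_iff]; exact (ht.to_contracted hg).unique ht'
      · rw [anc_leaf_iff, hz] at h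
        simp at h
        exact h ▸ ht

/-- The node of the interval holding the wingtip is on the wing and its other leaves are quills,
hence all feathers. Any other quill is a quill of the global tree, whose feather is refined to the
innermost occurrence in its interval. -/
theorem isFeather_of_isGlobal (hS : ∀ a p, a ∈ S p → p < m) (hg : IsGlobal S r a) {p : ℕ} :
    (comp r hr hm top loc).IsFeather S a d p ↔
      (IsWingtip (contracted S r) a d (p / 2 ^ r) ∧ a ∈ S p ∧ ¬ IsWingtip S a d p) ∨
      (IsInnermost S a d (r, p / 2 ^ r) p ∧ top.IsFeather (contracted S r) a d (p / 2 ^ r)) := by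
  simp only [IsFeather, isQuill_of_isGlobal hS hg]
  constructor
  · rintro ⟨w, z, ⟨hz, hw, hq⟩ | ⟨hz, rfl, ha, ht, hzt⟩, hin⟩
    · rw [isInnermost_of_isGlobal hg hz] at hin
      exact .inr ⟨hin.2, _, _, hq, hin.1⟩
    · rw [isInnermost_leaf_iff hz] at hin
      obtain ⟨-, rfl⟩ := hin
      exact .inl ⟨ht, ha, hzt⟩
  · rintro (⟨h1, h2, h3⟩ | ⟨h1, w, z, h2, h3⟩)
    · exact ⟨(r, p / 2 ^ r), (0, p), .inr ⟨rfl, rfl, h2, h1, h3⟩,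
        (isInnermost_leaf_iff rfl).2 ⟨h2, rfl⟩⟩
    · exact ⟨(w.1 + r, w.2), (z.1 + r, z.2), .inl ⟨by simp, by simp, by simpa using h2⟩,
        (isInnermost_of_isGlobal hg (by simp)).2 ⟨by simpa using h3, h1⟩⟩

theorem IsParent.level_le_of_local {w z : Node}
    (hp : (loc q).IsParent (localPart S r q) a w z) : w.1 ≤ r ∧ z.1 ≤ r := by
  have := hp.level_lt
  rcases local_mem_block hp.1 with ⟨h, -⟩ | h
  · omega
  · have : w.1 = 0 := by
      by_contra hw
      have h1 := two_pow_lt_of_mem_block _ hp.1 hw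
      have h2 : intervalSize m r q ≤ 2 ^ r := min_le_left _ _
      have h3 : 1 ≤ 2 ^ w.1 := Nat.one_le_two_pow
      have h4 : 2 ^ r = 1 := by rw [h, pow_zero]
      omega
    omega

theorem isQuill_of_isLocal (hS : ∀ a p, a ∈ S p → p < m) (hg : ¬ IsGlobal S r a)
    (ha : a ∈ intervalAlphabet S r q) {w z : Node} :
    (comp r hr hm top loc).IsQuill S a d w z ↔
      ∃ w' z', w = liftNode r q w' ∧ z = liftNode r q z' ∧
        (loc q).IsQuill (localPart S r q) a d w' z' := by
  rw [isQuill_iff _ hS, isParent_of_isLocal hg ha]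
  simp only [isQuill_iff _ (support_localPart hS r q)]
  constructor
  · rintro ⟨⟨w', z', rfl, rfl, hp⟩, t, ht, hwt, hzt⟩
    obtain ⟨t', rfl, ht'⟩ := (isWingtip_of_isLocal hg ha).1 ht
    have hl := hp.level_le_of_local
    rw [anc_liftNode_leaf_iff hl.1] at hwt
    rw [anc_liftNode_leaf_iff hl.2] at hzt
    exact ⟨w', z', rfl, rfl, hp, t', ht', hwt, hzt⟩
  · rintro ⟨w', z', rfl, rfl, hp, t', ht', hwt, hzt⟩
    have hl := hp.level_le_of_local
    refine ⟨⟨w', z', rfl, rfl, hp⟩, _, (isWingtip_of_isLocal hg ha).2 ⟨t', rfl, ht'⟩, ?_⟩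
    rw [anc_liftNode_leaf_iff hl.1, anc_liftNode_leaf_iff hl.2]
    exact ⟨hwt, hzt⟩

theorem isFeather_of_isLocal (hS : ∀ a p, a ∈ S p → p < m) (hg : ¬ IsGlobal S r a)
    (ha : a ∈ intervalAlphabet S r q) {p : ℕ} :
    (comp r hr hm top loc).IsFeather S a d p ↔
      ∃ p', p = q * 2 ^ r + p' ∧ (loc q).IsFeather (localPart S r q) a d p' := by
  simp only [IsFeather, isQuill_of_isLocal hS hg ha]
  constructor
  · rintro ⟨_, _, ⟨w', z', rfl, rfl, hq⟩, hin⟩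
    obtain ⟨p', rfl, hin'⟩ :=
      (isInnermost_of_isLocal hg ha hq.2.1.level_le_of_local.2).1 hin
    exact ⟨p', rfl, w', z', hq, hin'⟩
  · rintro ⟨p', rfl, w', z', hq, hin'⟩
    exact ⟨_, _, ⟨w', z', rfl, rfl, hq⟩,
      (isInnermost_of_isLocal hg ha hq.2.1.level_le_of_local.2).2 ⟨p', rfl, hin'⟩⟩

end DTree

/-! ### Double-feathers of composed ensembles -/

namespace Ensemble

theorem not_isDoubleFeather_base {hm : m ≤ 2} {p : ℕ} :
    ¬ (base hm).IsDoubleFeather S a d p :=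
  fun ⟨_, _, h, _⟩ => DTree.not_isQuill_base h

variable {hr : 1 ≤ r} {hm : 2 ^ r < m} {top : Ensemble (numIntervals m r)}
  {loc : ∀ q : ℕ, Ensemble (intervalSize m r q)}
  {sup : Side → ∀ q : ℕ, DTree (intervalSize m r q)}

/-- As for feathers; for the new quills the parent is the leaf `x_q` of the global tree, so the
superimposed tree consulted is the one chosen in this composition. -/
theorem isDoubleFeather_of_isGlobal (hS : ∀ a p, a ∈ S p → p < m) (hg : IsGlobal S r a)
    {p : ℕ} : (comp r hr hm top loc sup).IsDoubleFeather S a d p ↔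
      (IsWingtip (contracted S r) a d (p / 2 ^ r) ∧ a ∈ S p ∧ ¬ IsWingtip S a d p ∧
        ((sup d (p / 2 ^ r)).IsFeather (extremePart S r d (p / 2 ^ r)) a d (p % 2 ^ r) ∨
          IsWingtip (extremePart S r d (p / 2 ^ r)) a d.opp (p % 2 ^ r))) ∨
      (DTree.IsInnermost S a d (r, p / 2 ^ r) p ∧
        top.IsDoubleFeather (contracted S r) a d (p / 2 ^ r)) := by
  simp only [IsDoubleFeather, toDTree, DTree.isQuill_of_isGlobal hS hg]
  constructor
  · rintro ⟨w, z, ⟨hz, hw, hq⟩ | ⟨hz, rfl, ha, ht, hzt⟩, hin, X, hX, p', hzp, hp'⟩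
    · rw [isInnermost_of_isGlobal hg hz] at hin
      have hlt := hq.level_lt
      simp only at hlt
      rw [superimposed, if_neg (by omega), if_pos (by omega), Option.map_eq_some_iff] at hX
      obtain ⟨Y, hY, rfl⟩ := hX
      refine .inr ⟨hin.2, _, _, hq, hin.1, Y, hY, p', ?_, hp'⟩
      rw [hzp]; simp
    · rw [isInnermost_leaf_iff hz] at hin
      obtain ⟨-, rfl⟩ := hin
      rw [superimposed, if_pos rfl, Option.some_inj] at hX
      subst hX
      have : z.2 % 2 ^ r = p' := by
        have h1 := congrArg Prod.snd hzp
        have h2 := Nat.div_add_mod' z.2 (2 ^ r)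
        simp only at h1
        omega
      exact .inl ⟨ht, ha, hzt, this ▸ hp'⟩
  · rintro (⟨h1, h2, h3, h4⟩ | ⟨h1, w, z, h2, h3, Y, hY, p', hzp, hp'⟩)
    · refine ⟨(r, p / 2 ^ r), (0, p), .inr ⟨rfl, rfl, h2, h1, h3⟩,
        (isInnermost_leaf_iff rfl).2 ⟨h2, rfl⟩, _, by rw [superimposed, if_pos rfl],
        p % 2 ^ r, ?_, h4⟩
      simp [Nat.div_add_mod']
    · have hlt := h2.level_lt
      refine ⟨(w.1 + r, w.2), (z.1 + r, z.2), .inl ⟨by simp, by simp, by simpa using h2⟩,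
        (isInnermost_of_isGlobal hg (by simp)).2 ⟨by simpa using h3, h1⟩,
        ⟨Y.size, Y.tree, Y.seq, Y.level + r, Y.offset⟩, ?_, p', ?_, hp'⟩
      · rw [superimposed, if_neg (by simp only; omega), if_pos (by simp only; omega),
          Option.map_eq_some_iff]
        exact ⟨Y, by simpa using hY, rfl⟩
      · rw [hzp]

theorem isDoubleFeather_of_isLocal (hS : ∀ a p, a ∈ S p → p < m) (hg : ¬ IsGlobal S r a)
    (ha : a ∈ intervalAlphabet S r q) {p : ℕ} :
    (comp r hr hm top loc sup).IsDoubleFeather S a d p ↔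
      ∃ p', p = q * 2 ^ r + p' ∧ (loc q).IsDoubleFeather (localPart S r q) a d p' := by
  simp only [IsDoubleFeather, toDTree, DTree.isQuill_of_isLocal hS hg ha]
  have hlev : ∀ {w z : Node}, (loc q).toDTree.IsQuill (localPart S r q) a d w z → z.1 ≤ r :=
    fun h => (DTree.IsParent.level_le_of_local (loc := fun q => (loc q).toDTree) h.2.1).2
  -- A wing node of a local tree sits below level `r`, so its superimposed tree is that of the local
  -- ensemble, with the offset shifted to interval `q`.
  have hsup : ∀ w z : Node, (loc q).toDTree.IsQuill (localPart S r q) a d w z →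
      (comp r hr hm top loc sup).superimposed S d (liftNode r q w) =
        ((loc q).superimposed (localPart S r q) d w).map
          fun X => ⟨X.size, X.tree, X.seq, X.level, q * 2 ^ (r - X.level) + X.offset⟩ := by
    intro w z h
    rcases DTree.local_mem_block (loc := fun q => (loc q).toDTree) h.1.1 with ⟨h1, h2⟩ | h0
    · have h3 : (q * 2 ^ (r - w.1) + w.2) / 2 ^ (r - w.1) = q := by
        rw [mul_comm q, Nat.mul_add_div (by positivity), Nat.div_eq_of_lt h2, add_zero]
      have h4 : (q * 2 ^ (r - w.1) + w.2) % 2 ^ (r - w.1) = w.2 := by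
        rw [mul_comm q, Nat.mul_add_mod, Nat.mod_eq_of_lt h2]
      rw [superimposed]
      simp only [liftNode, h1.ne, if_false, not_lt.2 h1.le]
      rw [h4, h3]
    · omega
  constructor
  · rintro ⟨_, _, ⟨w', z', rfl, rfl, hq⟩, hin, X, hX, p', hzp, hp'⟩
    obtain ⟨t, rfl, hin'⟩ := (isInnermost_of_isLocal hg ha (hlev hq)).1 hin
    rw [hsup _ _ hq, Option.map_eq_some_iff] at hX
    obtain ⟨Y, hY, rfl⟩ := hX
    refine ⟨t, rfl, w', z', hq, hin', Y, hY, p', ?_, hp'⟩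
    simp only [liftNode, Prod.mk.injEq] at hzp
    refine Prod.ext hzp.1 ?_
    have := hzp.2
    rw [hzp.1] at this
    simp only
    omega
  · rintro ⟨t, rfl, w', z', hq, hin', Y, hY, p', hzp, hp'⟩
    refine ⟨_, _, ⟨w', z', rfl, rfl, hq⟩,
      (isInnermost_of_isLocal hg ha (hlev hq)).2 ⟨t, rfl, hin'⟩,
      ⟨Y.size, Y.tree, Y.seq, Y.level, q * 2 ^ (r - Y.level) + Y.offset⟩, ?_, p', ?_, hp'⟩
    · rw [hsup _ _ hq, hY]; rfl
    · rw [hzp, liftNode]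
      simp only
      rw [add_assoc]

end Ensemble
end

section
variable {α : Type*} {S : ℕ → Set α} {a b : α} {m r q : ℕ} {d : Side}

/-! ### Occurrences that are not feathers -/

/-- Occurrence `p` and the wingtip of type `d` lie below a node that misses some occurrence. -/
def SameSide (S : ℕ → Set α) (a : α) (d : Side) (p : ℕ) : Prop :=
  ∃ l t, IsWingtip S a d t ∧ p / 2 ^ l = t / 2 ^ l ∧ ∃ p', a ∈ S p' ∧ p' / 2 ^ l ≠ t / 2 ^ l

/-- Some node above `p` misses the wingtip of type `d` but has an occurrence strictly inwards
of `p` below it. -/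
def HasInner (S : ℕ → Set α) (a : α) (d : Side) (p : ℕ) : Prop :=
  ∃ l, (∀ t, IsWingtip S a d t → t / 2 ^ l ≠ p / 2 ^ l) ∧
    ∃ p', a ∈ S p' ∧ p' / 2 ^ l = p / 2 ^ l ∧ d.Before p p' ∧ p ≠ p'

theorem Side.div_eq_of_between {d : Side} {t p t' k : ℕ} (h : d.Before t p) (h' : d.Before p t')
    (he : t / k = t' / k) : p / k = t / k :=
  Side.before_antisymm (he ▸ Side.before_div h' k) (Side.before_div h k)

/-- At the lowest level where the two wingtips meet, all occurrences meet. One level below, the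
wingtips occupy the two children, and `p` is below one of them. -/
theorem sameSide_or (hS : ∀ a p, a ∈ S p → p < m) {p p₂ : ℕ} (hp : a ∈ S p) (hp₂ : a ∈ S p₂)
    (hne : p ≠ p₂) (d : Side) : SameSide S a d p ∨ SameSide S a d.opp p := by
  obtain ⟨t, ht⟩ := exists_isWingtip hS hp d
  obtain ⟨t', ht'⟩ := exists_isWingtip hS hp d.opp
  have hex : ∃ l, t / 2 ^ l = t' / 2 ^ l := by
    refine ⟨m, ?_⟩
    rw [Nat.div_eq_of_lt ((hS _ _ ht.1).trans Nat.lt_two_pow_self),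
      Nat.div_eq_of_lt ((hS _ _ ht'.1).trans Nat.lt_two_pow_self)]
  classical
  have hspec := Nat.find_spec hex
  have hmin := fun k => Nat.find_min hex (m := k)
  generalize Nat.find hex = l at hspec hmin
  have hbet : ∀ x, a ∈ S x → x / 2 ^ l = t / 2 ^ l := fun x hx =>
    Side.div_eq_of_between (ht.2 x hx) (Side.opp_before.1 (ht'.2 x hx)) hspec
  obtain _ | l := l
  · have := hbet _ hp; have := hbet _ hp₂; simp at *; omega
  · have hne' := hmin l (by omega)
    have h1 := hbet _ hp
    rw [pow_succ, ← Nat.div_div_eq_div_mul, ← Nat.div_div_eq_div_mul] at h1 hspec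
    by_cases hc : p / 2 ^ l = t / 2 ^ l
    · exact .inl ⟨l, t, ht, hc, t', ht'.1, Ne.symm hne'⟩
    · exact .inr ⟨l, t', ht', by omega, t, ht.1, hne'⟩

/-- Transport of `HasInner` from a sequence embedded in interval `q`. -/
theorem HasInner.of_interval {S' : ℕ → Set α} {p : ℕ}
    (hS' : ∀ p, a ∈ S' p → p < 2 ^ r ∧ a ∈ S (q * 2 ^ r + p))
    (hw : ∀ t, IsWingtip S a d t → ∃ t', t = q * 2 ^ r + t' ∧ IsWingtip S' a d t')
    (ht : ∃ t, IsWingtip S a d t) (hp : a ∈ S' p) (h : HasInner S' a d p) :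
    HasInner S a d (q * 2 ^ r + p) := by
  obtain ⟨l, h1, p', h2, h3, h4, h5⟩ := h
  -- A node higher than `r` contains the whole interval, hence the wingtip too.
  have hl : l ≤ r := by
    obtain ⟨t, ht⟩ := ht
    obtain ⟨t', -, ht'⟩ := hw t ht
    by_contra hl
    have hlt : 2 ^ r ≤ 2 ^ l := Nat.pow_le_pow_right two_pos (by omega)
    apply h1 t' ht'
    rw [Nat.div_eq_of_lt ((hS' _ ht'.1).1.trans_le hlt),
      Nat.div_eq_of_lt ((hS' _ hp).1.trans_le hlt)]
  refine ⟨l, fun t ht => ?_, _, (hS' _ h2).2, ?_, Side.before_add_left.2 h4, by omega⟩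
  · obtain ⟨t', rfl, ht'⟩ := hw t ht
    rw [mul_pow_add_div _ _ hl, mul_pow_add_div _ _ hl]
    have := h1 t' ht'
    omega
  · rw [mul_pow_add_div _ _ hl, mul_pow_add_div _ _ hl, h3]

theorem HasInner.of_contracted (hg : IsGlobal S r a) {p : ℕ}
    (h : HasInner (contracted S r) a d (p / 2 ^ r)) : HasInner S a d p := by
  obtain ⟨l, h1, _, ⟨-, p', rfl, hp'⟩, h3, h4, h5⟩ := h
  simp only [Nat.div_div_eq_div_mul, ← pow_add] at h1 h3
  refine ⟨r + l, fun t ht => ?_, p', hp', h3, Side.before_of_div h4 h5, fun h => h5 (by rw [h])⟩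
  have := h1 _ (ht.to_contracted hg)
  rwa [Nat.div_div_eq_div_mul, ← pow_add] at this

theorem SameSide.to_contracted (hg : IsGlobal S r a) {p : ℕ} (h : SameSide S a d p)
    (hw : ¬ IsWingtip (contracted S r) a d (p / 2 ^ r)) :
    SameSide (contracted S r) a d (p / 2 ^ r) := by
  obtain ⟨l, t, ht, h1, p', hp', h2⟩ := h
  -- Below level `r`, sharing a node with the wingtip would put `p` in the interval of the wingtip.
  have hl : r ≤ l := by
    by_contra hl
    apply hw
    rw [← div_pow_div_pow p (not_le.1 hl).le, h1, div_pow_div_pow _ (not_le.1 hl).le]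
    exact ht.to_contracted hg
  refine ⟨l - r, _, ht.to_contracted hg, ?_, _, ⟨hg, mem_interval_div hp'⟩, ?_⟩ <;>
    simpa only [div_pow_div_pow _ hl]

theorem SameSide.to_localPart (hg : ¬ IsGlobal S r a) (ha : a ∈ intervalAlphabet S r q) {p : ℕ}
    (h : SameSide S a d (q * 2 ^ r + p)) :
    SameSide (localPart S r q) a d p := by
  obtain ⟨l, t, ht, h1, p', hp', h2⟩ := h
  obtain ⟨t, rfl, ht'⟩ := (isWingtip_of_isLocal hg ha).1 ht
  obtain ⟨p', rfl, hp''⟩ := (mem_iff_of_isLocal hg ha).1 hp'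
  -- A node higher than `r` contains the whole interval, hence every occurrence of a local symbol.
  have hl : l ≤ r := by
    by_contra hl
    apply h2
    rw [← div_pow_div_pow _ (not_le.1 hl).le, ← div_pow_div_pow (_ + t) (not_le.1 hl).le]
    rw [mul_pow_add_div _ _ le_rfl, mul_pow_add_div _ _ le_rfl, Nat.div_eq_of_lt hp''.1,
      Nat.div_eq_of_lt ht'.1.1]
  rw [mul_pow_add_div _ _ hl, mul_pow_add_div _ _ hl] at h1 h2
  exact ⟨l, t, ht', by omega, p', hp'', by omega⟩

theorem HasInner.of_localPart (hS : ∀ a p, a ∈ S p → p < m) (hg : ¬ IsGlobal S r a)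
    (ha : a ∈ intervalAlphabet S r q) {p : ℕ} (hp : a ∈ localPart S r q p)
    (h : HasInner (localPart S r q) a d p) : HasInner S a d (q * 2 ^ r + p) :=
  h.of_interval (fun _ h => ⟨h.1, h.2.1⟩) (fun _ => (isWingtip_of_isLocal hg ha).1)
    (exists_isWingtip hS hp.2.1 d) hp

/-- If the interval of `p` is not the wingtip of the contracted sequence, then either `p` is
innermost in its interval or it has an occurrence further inwards there. -/
theorem hasInner_of_not_isInnermost (hg : IsGlobal S r a) {p : ℕ} (hp : a ∈ S p)
    (hw : ¬ IsWingtip (contracted S r) a d (p / 2 ^ r))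
    (h : ¬ DTree.IsInnermost S a d (r, p / 2 ^ r) p) : HasInner S a d p := by
  simp only [DTree.IsInnermost, hp, anc_leaf_iff, true_and, not_forall] at h
  obtain ⟨p', hp', h1, h2⟩ := h
  refine ⟨r, fun t ht he => hw (he ▸ ht.to_contracted hg), p', hp', h1, ?_, ?_⟩
  · exact (d.before_total p p').resolve_right h2
  · rintro rfl; exact h2 (d.before_refl _)

/-- In the wingtip's interval everything but the wingtip is a feather. Elsewhere, either the node of
the interval of `p` is a witness, or `p` is innermost in its interval and the question passes to the
global tree. -/
theorem DTree.hasInner_of_not_isFeather (T : DTree m) {S : ℕ → Set α}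
    (hS : ∀ a p, a ∈ S p → p < m) {p : ℕ} (hp : a ∈ S p) (hs : SameSide S a d p)
    (hw : ¬ IsWingtip S a d p) (hf : ¬ T.IsFeather S a d p) : HasInner S a d p := by
  induction T generalizing S p with
  | base hm =>
    obtain ⟨l, t, ht, h1, p', hp', h2⟩ := hs
    have hne : p ≠ t := by rintro rfl; exact hw ht
    have := hS _ _ hp; have := hS _ _ hp'; have := hS _ _ ht.1
    -- With at most two positions, a node containing both `p` and the wingtip contains everything,
    -- against `SameSide`.
    exfalso
    obtain _ | l := l
    · simp at h1; exact hne h1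
    · apply h2
      rw [pow_succ']
      rw [← Nat.div_div_eq_div_mul, ← Nat.div_div_eq_div_mul, Nat.div_eq_of_lt (by omega : p' < 2),
        Nat.div_eq_of_lt (by omega : t < 2)]
  | @comp m r hr hm top loc ihtop ihloc =>
    by_cases hg : IsGlobal S r a
    · rw [isFeather_of_isGlobal hS hg, not_or] at hf
      have hw' : ¬ IsWingtip (contracted S r) a d (p / 2 ^ r) := fun h => hf.1 ⟨h, hp, hw⟩
      by_cases hin : IsInnermost S a d (r, p / 2 ^ r) p
      · exact (ihtop (support_contracted hS r) ⟨hg, mem_interval_div hp⟩ (hs.to_contracted hg hw')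
          hw' fun h => hf.2 ⟨hin, h⟩).of_contracted hg
      · exact hasInner_of_not_isInnermost hg hp hw' hin
    · have ha := mem_interval_div (r := r) hp
      obtain ⟨p', he, hp'⟩ := (mem_iff_of_isLocal hg ha).1 hp
      rw [isFeather_of_isLocal hS hg ha] at hf
      rw [isWingtip_of_isLocal hg ha] at hw
      rw [he] at hs ⊢
      exact (ihloc _ (support_localPart hS r _) hp' (hs.to_localPart hg ha)
        (fun h => hw ⟨p', he, h⟩) fun h => hf ⟨p', he, h⟩).of_localPart hS hg ha hp'

theorem IsWingtip.to_extremePart (hg : IsGlobal S r a)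
    (hq : IsWingtip (contracted S r) a d q) {t : ℕ} (ht : IsWingtip S a d t) :
    ∃ t', t = q * 2 ^ r + t' ∧ IsWingtip (extremePart S r d q) a d t' := by
  obtain rfl := (ht.to_contracted hg).unique hq
  refine ⟨t % 2 ^ r, (Nat.div_add_mod' _ _).symm, ⟨Nat.mod_lt _ (by positivity), ?_, hg, ?_⟩, ?_⟩
  · rw [Nat.div_add_mod']; exact ht.1
  · intro q' hq'
    exact hq.2 q' ⟨hg, hq'⟩
  · rintro t' ⟨-, ht', -⟩
    rw [← Side.before_add_left (k := t / 2 ^ r * 2 ^ r), Nat.div_add_mod']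
    exact ht.2 _ ht'

/-- Only the wingtip's interval differs from the case of feathers: there the superimposed tree takes
over, and a witness for the projected interval is one for `S`. -/
theorem Ensemble.hasInner_of_not_isDoubleFeather (E : Ensemble m) {S : ℕ → Set α}
    (hS : ∀ a p, a ∈ S p → p < m) {p : ℕ} (hp : a ∈ S p) (hs : SameSide S a d p)
    (hw : ¬ IsWingtip S a d p) (hf : ¬ E.IsDoubleFeather S a d p) : HasInner S a d p := by
  induction E generalizing S p with
  | base hm =>
    exact DTree.hasInner_of_not_isFeather (.base hm) hS hp hs hw DTree.not_isFeather_base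
  | @comp m r hr hm top loc sup ihtop ihloc =>
    by_cases hg : IsGlobal S r a
    · rw [isDoubleFeather_of_isGlobal hS hg, not_or] at hf
      by_cases hw' : IsWingtip (contracted S r) a d (p / 2 ^ r)
      · have hf1 := fun h => hf.1 ⟨hw', hp, hw, h⟩
        replace hf1 := not_or.1 hf1
        have hSe := support_extremePart hS r d (p / 2 ^ r)
        have hp0 : a ∈ extremePart S r d (p / 2 ^ r) (p % 2 ^ r) :=
          ⟨Nat.mod_lt _ (by positivity), by rwa [Nat.div_add_mod'], hg,
            fun q' hq' => hw'.2 q' ⟨hg, hq'⟩⟩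
        have hwt := fun t (ht : IsWingtip S a d t) => hw'.to_extremePart hg ht
        obtain ⟨t, ht⟩ := exists_isWingtip hS hp d
        obtain ⟨t', het, ht'⟩ := hwt t ht
        have hne : p % 2 ^ r ≠ t' := fun h => hw (by
          rw [← Nat.div_add_mod' p (2 ^ r), h, ← het]; exact ht)
        suffices HasInner (extremePart S r d (p / 2 ^ r)) a d (p % 2 ^ r) by
          have h := this.of_interval (S := S) (q := p / 2 ^ r) (fun _ h => ⟨h.1, h.2.1⟩) hwt
            ⟨t, ht⟩ hp0
          rwa [Nat.div_add_mod'] at h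
        rcases sameSide_or hSe hp0 ht'.1 hne d with h | h
        · exact (sup d (p / 2 ^ r)).hasInner_of_not_isFeather hSe hp0 h
            (fun h => hne (h.unique ht')) hf1.1
        -- Here `p` is on the opposite side of the superimposed tree. The node shared by `p` and the
        -- opposite wingtip `u` misses some occurrence, so it misses the wingtip of type `d`, and
        -- `u` is the occurrence further inwards.
        · obtain ⟨l, u, hu, h1, p', hp', h2⟩ := h
          refine ⟨l, fun x hx he => h2 ?_, u, hu.1, h1.symm, Side.opp_before.1 (hu.2 _ hp0),
            fun h => hf1.2 (h ▸ hu)⟩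
          rw [← h1, ← he]
          exact Side.div_eq_of_between (hx.2 _ hp') (Side.opp_before.1 (hu.2 _ hp'))
            (he.trans h1)
      · by_cases hin : DTree.IsInnermost S a d (r, p / 2 ^ r) p
        · exact (ihtop (support_contracted hS r) ⟨hg, mem_interval_div hp⟩
            (hs.to_contracted hg hw') hw' fun h => hf.2 ⟨hin, h⟩).of_contracted hg
        · exact hasInner_of_not_isInnermost hg hp hw' hin
    · have ha := mem_interval_div (r := r) hp
      obtain ⟨p', he, hp'⟩ := (mem_iff_of_isLocal hg ha).1 hp
      rw [isDoubleFeather_of_isLocal hS hg ha] at hf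
      rw [isWingtip_of_isLocal hg ha] at hw
      rw [he] at hs ⊢
      exact (ihloc _ (support_localPart hS r _) hp' (hs.to_localPart hg ha)
        (fun h => hw ⟨p', he, h⟩) fun h => hf ⟨p', he, h⟩).of_localPart hS hg ha hp'

/-! ### Nested occurrences -/

/-- `p` comes strictly before `p'`, going inwards from the wing of type `d`. -/
def Side.Strict (d : Side) (p p' : ℕ) : Prop := d.Before p p' ∧ p ≠ p'

theorem Side.Strict.of_div {d : Side} {u v u' v' k : ℕ} (h : d.Before u v)
    (hne : u / k ≠ v / k) (hu : u' / k = u / k) (hv : v' / k = v / k) : d.Strict u' v' := by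
  have h1 : d.Before (u' / k) (v' / k) := by rw [hu, hv]; exact Side.before_div h k
  have h2 : u' / k ≠ v' / k := by rwa [hu, hv]
  exact ⟨Side.before_of_div h1 h2, fun h => h2 (by rw [h])⟩

theorem div_ne_of_le {p p' l k : ℕ} (hl : l ≤ k) (h : p / 2 ^ k ≠ p' / 2 ^ k) :
    p / 2 ^ l ≠ p' / 2 ^ l := fun he => h (by
  rw [← div_pow_div_pow p hl, he, div_pow_div_pow _ hl])

/-- Let `a` have the lower witness node. Inwards of `p` lie an `a` inside the node of `b` and then a
`b` outside it. For the reverse order, either the wingtip of `a` lies in the node of `b`, which the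
wingtip of `b` precedes, giving `b a` outwards of `p`; or an `a` lies beyond this node on the inner
side, giving `b a` inwards. -/
theorem nested_aux {p : ℕ} (ha : a ∈ S p) (hb : b ∈ S p)
    (has : SameSide S a d p) (hbs : SameSide S b d p)
    {la lb : ℕ} (hl : la ≤ lb)
    (hta : ∀ t, IsWingtip S a d t → t / 2 ^ la ≠ p / 2 ^ la)
    (hia : ∃ p', a ∈ S p' ∧ p' / 2 ^ la = p / 2 ^ la ∧ d.Before p p' ∧ p ≠ p')
    (htb : ∀ t, IsWingtip S b d t → t / 2 ^ lb ≠ p / 2 ^ lb)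
    (hib : ∃ p', b ∈ S p' ∧ p' / 2 ^ lb = p / 2 ^ lb ∧ d.Before p p' ∧ p ≠ p') :
    (∃ p₁ p₂, d.Strict p p₁ ∧ d.Strict p₁ p₂ ∧ a ∈ S p₁ ∧ b ∈ S p₂) ∧
    ((∃ p₁ p₂, d.Strict p p₁ ∧ d.Strict p₁ p₂ ∧ b ∈ S p₁ ∧ a ∈ S p₂) ∨
      ∃ p₁ p₂, d.Strict p₁ p₂ ∧ d.Strict p₂ p ∧ b ∈ S p₁ ∧ a ∈ S p₂) := by
  have key : ∀ {x l}, SameSide S x d p → x ∈ S p →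
      (∀ t, IsWingtip S x d t → t / 2 ^ l ≠ p / 2 ^ l) →
      ∃ L h, l < L ∧ x ∈ S h ∧ d.Before p h ∧ h / 2 ^ L ≠ p / 2 ^ L ∧
        ∃ t, IsWingtip S x d t ∧ t / 2 ^ L = p / 2 ^ L := by
    rintro x l ⟨L, t, ht, h1, h, hh, h2⟩ hx htl
    -- The node at level `L` holds both `p` and the wingtip; the one at level `l` misses the
    -- wingtip.
    have hL : l < L := by
      by_contra hc
      exact div_ne_of_le (not_lt.1 hc) (htl t ht) h1.symm
    refine ⟨L, h, hL, hh, ?_, by rwa [h1], t, ht, h1.symm⟩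
    refine (d.before_total p h).resolve_right fun hc => h2 ?_
    exact Side.div_eq_of_between (ht.2 _ hh) hc h1.symm
  obtain ⟨a', ha', ea', ba', na'⟩ := hia
  obtain ⟨b', hb', eb', bb', nb'⟩ := hib
  obtain ⟨La, h_a, hLa, hha, bha, nha, ta, hta', eta⟩ := key has ha hta
  obtain ⟨Lb, h_b, hLb, hhb, bhb, nhb, tb, htb', etb⟩ := key hbs hb htb
  have eab : a' / 2 ^ lb = p / 2 ^ lb := by
    rw [← div_pow_div_pow a' hl, ea', div_pow_div_pow _ hl]
  refine ⟨⟨a', h_b, ⟨ba', na'⟩, ?_, ha', hhb⟩, ?_⟩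
  · exact Side.Strict.of_div bhb (div_ne_of_le hLb.le nhb).symm eab rfl
  · by_cases hc : ta / 2 ^ lb = p / 2 ^ lb
    · right
      exact ⟨tb, ta, Side.Strict.of_div (htb'.2 _ hb) (htb _ htb') rfl hc,
        ⟨hta'.2 _ ha, fun h => hta _ hta' (by rw [h])⟩, htb'.1, hta'.1⟩
    · left
      have hL : lb < La := by
        by_contra h
        exact div_ne_of_le (not_lt.1 h) hc eta
      exact ⟨b', h_a, ⟨bb', nb'⟩,
        Side.Strict.of_div bha (div_ne_of_le hL.le nha).symm eb' rfl, hb', hha⟩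

/-- Two symbols without double-feather at `p` form the pattern `a b` on one side of `p`. -/
theorem exists_pair_of_hasInner {p : ℕ} (ha : a ∈ S p)
    (hb : b ∈ S p) (has : SameSide S a d p) (hbs : SameSide S b d p)
    (hia : HasInner S a d p) (hib : HasInner S b d p) :
    (∃ p₁ p₂, p₁ < p₂ ∧ p₂ < p ∧ a ∈ S p₁ ∧ b ∈ S p₂) ∨
      ∃ p₁ p₂, p < p₁ ∧ p₁ < p₂ ∧ a ∈ S p₁ ∧ b ∈ S p₂ := by
  obtain ⟨la, hta, hia⟩ := hia
  obtain ⟨lb, htb, hib⟩ := hib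
  have key : ∀ {x y : α}, ((∃ p₁ p₂, d.Strict p p₁ ∧ d.Strict p₁ p₂ ∧ x ∈ S p₁ ∧ y ∈ S p₂) ∨
      ∃ p₁ p₂, d.Strict p₁ p₂ ∧ d.Strict p₂ p ∧ x ∈ S p₁ ∧ y ∈ S p₂) ↔
      match d with
      | .dove => (∃ p₁ p₂, p < p₁ ∧ p₁ < p₂ ∧ x ∈ S p₁ ∧ y ∈ S p₂) ∨
        (∃ p₁ p₂, p₁ < p₂ ∧ p₂ < p ∧ x ∈ S p₁ ∧ y ∈ S p₂)
      | .hawk => (∃ p₁ p₂, p₁ < p ∧ p₂ < p₁ ∧ x ∈ S p₁ ∧ y ∈ S p₂) ∨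
        (∃ p₁ p₂, p₂ < p₁ ∧ p < p₂ ∧ x ∈ S p₁ ∧ y ∈ S p₂) := by
    intro x y
    cases d
    · simp only [Side.Strict, Side.Before, ← lt_iff_le_and_ne]
    · have : ∀ u v : ℕ, (v ≤ u ∧ u ≠ v) ↔ v < u := fun u v => by omega
      simp only [Side.Strict, Side.Before, this]
  have hab : ∀ x y, (x = a ∧ y = b) ∨ (x = b ∧ y = a) →
      (∃ p₁ p₂, d.Strict p p₁ ∧ d.Strict p₁ p₂ ∧ x ∈ S p₁ ∧ y ∈ S p₂) ∨
      ∃ p₁ p₂, d.Strict p₁ p₂ ∧ d.Strict p₂ p ∧ x ∈ S p₁ ∧ y ∈ S p₂ := by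
    rcases le_total la lb with h | h
    · obtain ⟨h1, h2⟩ := nested_aux ha hb has hbs h hta hia htb hib
      rintro x y (⟨rfl, rfl⟩ | ⟨rfl, rfl⟩)
      · exact .inl h1
      · exact h2
    · obtain ⟨h1, h2⟩ := nested_aux hb ha hbs has h htb hib hta hia
      rintro x y (⟨rfl, rfl⟩ | ⟨rfl, rfl⟩)
      · exact h2
      · exact .inl h1
  -- For hawks inwards means right to left, so `a b` in reading order is the pair `b a` going
  -- inwards.
  cases d
  · exact (key.1 (hab a b (.inl ⟨rfl, rfl⟩))).symm
  · rcases key.1 (hab b a (.inr ⟨rfl, rfl⟩)) with ⟨p₁, p₂, h1, h2, h3, h4⟩ | ⟨p₁, p₂, h1, h2, h3, h4⟩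
    · exact .inl ⟨p₂, p₁, h2, h1, h4, h3⟩
    · exact .inr ⟨p₂, p₁, h2, h1, h4, h3⟩

end

/-! ### Counting feathers -/

theorem occurrences_finite (C : List (List ℕ)) :
    {x : ℕ × ℕ | x.1 ∈ blocksOf C x.2}.Finite := by
  refine ((C.flatten.toFinset ×ˢ Finset.range C.length).finite_toSet).subset ?_
  rintro ⟨a, p⟩ h
  simp only [Finset.coe_product, Set.mem_prod, Finset.mem_coe, List.mem_toFinset, Finset.mem_range]
  exact ⟨mem_flatten_iff.2 ⟨p, h⟩, lt_length_of_mem_blocksOf h⟩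

theorem ncard_occurrences_le (C : List (List ℕ)) :
    {x : ℕ × ℕ | x.1 ∈ blocksOf C x.2}.ncard ≤ C.flatten.length := by
  have h : {x : ℕ × ℕ | x.1 ∈ blocksOf C x.2} ⊆
      ⋃ p ∈ Finset.range C.length, (fun a => (a, p)) '' (↑(C.getD p []).toFinset : Set ℕ) := by
    rintro ⟨a, p⟩ h
    simp only [Set.mem_iUnion, Finset.mem_range, Set.mem_image, Finset.mem_coe, List.mem_toFinset]
    exact ⟨p, lt_length_of_mem_blocksOf h, a, h, rfl⟩
  refine (Set.ncard_le_ncard h (Set.Finite.biUnion (Finset.finite_toSet _) fun p _ =>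
    (Finset.finite_toSet _).image _)).trans ((Finset.set_ncard_biUnion_le _ _).trans ?_)
  have h2 : C.flatten.length = ∑ p ∈ Finset.range C.length, (C.getD p []).length := by
    rw [List.length_flatten]
    induction C using List.reverseRecOn with
    | nil => simp
    | append_singleton C β ih =>
      rw [List.map_append, List.sum_append, ih ?_, List.length_append, List.length_singleton,
        Finset.sum_range_succ]
      · congr 1
        · refine Finset.sum_congr rfl fun p hp => ?_
          rw [List.getD_append _ _ _ _ (Finset.mem_range.1 hp)]
        · simp
      · rintro ⟨a, p⟩ h
        simp only [Set.mem_iUnion, Finset.mem_range, Set.mem_image, Finset.mem_coe,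
          List.mem_toFinset]
        exact ⟨p, lt_length_of_mem_blocksOf h, a, h, rfl⟩
  rw [h2]
  refine Finset.sum_le_sum fun p _ => ?_
  refine (Set.ncard_image_le (Finset.finite_toSet _)).trans ?_
  rw [Set.ncard_coe_finset]
  exact List.toFinset_card_le _

theorem ncard_wingtips (C : List (List ℕ)) (d : Side) :
    {x : ℕ × ℕ | IsWingtip (blocksOf C) x.1 d x.2}.ncard = alphabetSize C := by
  rw [← Set.InjOn.ncard_image (f := Prod.fst), alphabetSize, ← Set.ncard_coe_finset]
  · congr 1
    ext a
    simp only [Set.mem_image, Set.mem_ofPred_eq, Prod.exists, exists_and_right, exists_eq_right,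
      Finset.mem_coe, List.mem_toFinset, mem_flatten_iff]
    constructor
    · rintro ⟨p, h⟩; exact ⟨p, h.1⟩
    · rintro ⟨p, h⟩
      exact exists_isWingtip (fun _ _ => lt_length_of_mem_blocksOf) h d
  · rintro ⟨a, p⟩ h ⟨a', p'⟩ h' (rfl : a = a')
    exact Prod.ext rfl (IsWingtip.unique h h')

/-- The one wingtip per symbol is the source of the saving in `α' + α₁ ≤ α + 1` in the recurrence
for feathers. -/
theorem ncard_not_wingtips_add_le (C : List (List ℕ)) (d : Side) :
    {x : ℕ × ℕ | x.1 ∈ blocksOf C x.2 ∧ ¬ IsWingtip (blocksOf C) x.1 d x.2}.ncard +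
      alphabetSize C ≤ C.flatten.length := by
  have hf := occurrences_finite C
  rw [← ncard_wingtips C d, ← Set.ncard_union_eq (Set.disjoint_left.2 fun x h h' => h.2 h')
    (hf.subset fun x h => h.1) (hf.subset fun x h => h.1)]
  refine (Set.ncard_le_ncard ?_ hf).trans (ncard_occurrences_le C)
  rintro x (h | h)
  · exact h.1
  · exact h.1

/-- Counting a set of occurrences in a composed tree, by cases: inherited from a local tree, from
the global tree, or new. -/
theorem ncard_le_of_cover {S : ℕ → Set ℕ} {d : Side} {r N : ℕ} {X T : Set (ℕ × ℕ)}
    {L V : ℕ → Set (ℕ × ℕ)} (hT : T.Finite) (hL : ∀ q, (L q).Finite) (hV : ∀ q, (V q).Finite)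
    (h : ∀ a p, (a, p) ∈ X →
      (∃ q < N, ∃ p', p = q * 2 ^ r + p' ∧ (a, p') ∈ L q) ∨
      (DTree.IsInnermost S a d (r, p / 2 ^ r) p ∧ (a, p / 2 ^ r) ∈ T) ∨
      ∃ q < N, ∃ p', p = q * 2 ^ r + p' ∧ (a, p') ∈ V q) :
    X.ncard ≤ ∑ q ∈ Finset.range N, (L q).ncard + T.ncard +
      ∑ q ∈ Finset.range N, (V q).ncard := by
  let φ : ℕ → ℕ × ℕ → ℕ × ℕ := fun q x => (x.1, q * 2 ^ r + x.2)
  let G : Set (ℕ × ℕ) := {x | DTree.IsInnermost S x.1 d (r, x.2 / 2 ^ r) x.2 ∧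
    (x.1, x.2 / 2 ^ r) ∈ T}
  -- A symbol has only one innermost occurrence in an interval, so an occurrence in the global tree
  -- yields at most one below it.
  have hinj : Set.InjOn (fun x : ℕ × ℕ => (x.1, x.2 / 2 ^ r)) G := by
    rintro ⟨a, p⟩ ⟨h1, -⟩ ⟨a', p'⟩ ⟨h2, -⟩ he
    simp only [Prod.mk.injEq] at he h1 h2
    obtain ⟨rfl, he⟩ := he
    refine Prod.ext rfl (Side.before_antisymm (d := d) ?_ ?_)
    · exact h2.2.2 _ h1.1 (anc_leaf_iff.2 he)
    · exact h1.2.2 _ h2.1 (anc_leaf_iff.2 he.symm)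
  have himg : (fun x : ℕ × ℕ => (x.1, x.2 / 2 ^ r)) '' G ⊆ T := by
    rintro _ ⟨x, hx, rfl⟩; exact hx.2
  have hG : G.Finite := Set.Finite.of_finite_image (hT.subset himg) hinj
  have hGc : G.ncard ≤ T.ncard := by
    rw [← hinj.ncard_image]
    exact Set.ncard_le_ncard himg hT
  have hsub : X ⊆ (⋃ q ∈ Finset.range N, φ q '' L q) ∪ G ∪ ⋃ q ∈ Finset.range N, φ q '' V q := by
    rintro ⟨a, p⟩ hx
    rcases h a p hx with ⟨q, hq, p', rfl, h⟩ | h | ⟨q, hq, p', rfl, h⟩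
    · refine .inl (.inl ?_)
      simp only [Set.mem_iUnion]
      exact ⟨q, Finset.mem_range.2 hq, _, h, rfl⟩
    · exact .inl (.inr h)
    · refine .inr ?_
      simp only [Set.mem_iUnion]
      exact ⟨q, Finset.mem_range.2 hq, _, h, rfl⟩
  have hU : ∀ K : ℕ → Set (ℕ × ℕ), (∀ q, (K q).Finite) →
      (⋃ q ∈ Finset.range N, φ q '' K q).Finite ∧
      (⋃ q ∈ Finset.range N, φ q '' K q).ncard ≤ ∑ q ∈ Finset.range N, (K q).ncard :=
    fun K hK => ⟨Set.Finite.biUnion (Finset.finite_toSet _) fun q _ => (hK q).image _,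
      (Finset.set_ncard_biUnion_le _ _).trans
        (Finset.sum_le_sum fun q _ => Set.ncard_image_le (hK q))⟩
  obtain ⟨hL1, hL2⟩ := hU L hL
  obtain ⟨hV1, hV2⟩ := hU V hV
  have h1 := Set.ncard_le_ncard hsub ((hL1.union hG).union hV1)
  have h2 := Set.ncard_union_le ((⋃ q ∈ Finset.range N, φ q '' L q) ∪ G)
    (⋃ q ∈ Finset.range N, φ q '' V q)
  have h3 := Set.ncard_union_le (⋃ q ∈ Finset.range N, φ q '' L q) G
  omega

theorem DTree.IsFeather.mem {α : Type*} {m : ℕ} {T : DTree m} {S : ℕ → Set α} {a : α} {d : Side}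
    {p : ℕ} (h : T.IsFeather S a d p) : a ∈ S p := by
  obtain ⟨w, z, -, h, -⟩ := h; exact h

theorem Ensemble.IsDoubleFeather.mem {α : Type*} {m : ℕ} {E : Ensemble m} {S : ℕ → Set α} {a : α}
    {d : Side} {p : ℕ} (h : E.IsDoubleFeather S a d p) : a ∈ S p := by
  obtain ⟨w, z, -, h, -⟩ := h; exact h.1

/-- `α n + β (m - 1)` bounds the number of feathers of either type in a suitable derivation tree
of any `m`-block order-`4` sequence over `n` letters, for all `m ≤ M`. -/
def FeatherBound (α β M : ℕ) : Prop :=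
  ∀ B, IsBlocked 4 B → B.length ≤ M → ∀ d, ∃ T : DTree B.length,
    T.featherCount (blocksOf B) d ≤ α * alphabetSize B + β * (B.length - 1)

/-- The number of double-feathers of type `d`. -/
noncomputable def Ensemble.sideCount {m : ℕ} (E : Ensemble m) (S : ℕ → Set ℕ) (d : Side) : ℕ :=
  {x : ℕ × ℕ | E.IsDoubleFeather S x.1 d x.2}.ncard

/-- `α n + β (m - 1)` bounds the number of double-feathers in a suitable ensemble of any `m`-block
order-`5` sequence over `n` letters, for all `m ≤ M`. -/
def DoubleFeatherBound (α β M : ℕ) : Prop :=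
  ∀ B, IsBlocked 5 B → B.length ≤ M → ∃ E : Ensemble B.length,
    E.sideCount (blocksOf B) .dove + E.sideCount (blocksOf B) .hawk ≤
      α * alphabetSize B + β * (B.length - 1)

/-- The type `DTree B.length` depends on a length that equals `numIntervals` or `intervalSize` only
propositionally; taking the equalities as hypotheses lets them be substituted away. -/
theorem FeatherBound.exists {α β M : ℕ} (h : FeatherBound α β M) {B : List (List ℕ)}
    (hB : IsBlocked 4 B) (hl : B.length ≤ M) (d : Side) {m : ℕ} {S : ℕ → Set ℕ}
    (hm : B.length = m) (hS : blocksOf B = S) :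
    ∃ T : DTree m, T.featherCount S d ≤ α * alphabetSize B + β * (m - 1) := by
  subst hm hS; exact h B hB hl d

theorem DoubleFeatherBound.exists {α β M : ℕ} (h : DoubleFeatherBound α β M) {B : List (List ℕ)}
    (hB : IsBlocked 5 B) (hl : B.length ≤ M) {m : ℕ} {S : ℕ → Set ℕ}
    (hm : B.length = m) (hS : blocksOf B = S) :
    ∃ E : Ensemble m, E.sideCount S .dove + E.sideCount S .hawk ≤
      α * alphabetSize B + β * (m - 1) := by
  subst hm hS; exact h B hB hl

theorem FeatherBound.mono {α β M α' β' M' : ℕ} (h : FeatherBound α β M) (hα : α ≤ α')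
    (hβ : β ≤ β') (hM : M' ≤ M) : FeatherBound α' β' M' := fun B hB hl d =>
  (h B hB (hl.trans hM) d).imp fun _ hT => hT.trans
    (Nat.add_le_add (Nat.mul_le_mul_right _ hα) (Nat.mul_le_mul_right _ hβ))

theorem DoubleFeatherBound.mono {α β M α' β' M' : ℕ} (h : DoubleFeatherBound α β M) (hα : α ≤ α')
    (hβ : β ≤ β') (hM : M' ≤ M) : DoubleFeatherBound α' β' M' := fun B hB hl =>
  (h B hB (hl.trans hM)).imp fun _ hT => hT.trans
    (Nat.add_le_add (Nat.mul_le_mul_right _ hα) (Nat.mul_le_mul_right _ hβ))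

theorem featherBound_two : FeatherBound 0 0 2 := by
  intro B _ hl d
  refine ⟨.base hl, ?_⟩
  simp [DTree.featherCount, DTree.not_isFeather_base]

theorem doubleFeatherBound_two : DoubleFeatherBound 0 0 2 := by
  intro B _ hl
  refine ⟨.base hl, ?_⟩
  simp [Ensemble.sideCount, Ensemble.not_isDoubleFeather_base]

theorem finite_of_subset_occurrences {X : Set (ℕ × ℕ)} {C : List (List ℕ)} {S : ℕ → Set ℕ}
    (hC : blocksOf C = S) (h : ∀ x ∈ X, x.1 ∈ S x.2) : X.Finite :=
  (occurrences_finite C).subset fun x hx => by rw [hC]; exact h x hx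

theorem sum_linear_le {B : List (List ℕ)} {r α β : ℕ} {f n : ℕ → ℕ}
    (h : ∀ q, f q ≤ α * n q + β * (intervalSize B.length r q - 1)) :
    ∑ q ∈ Finset.range (numIntervals B.length r), f q ≤
      α * ∑ q ∈ Finset.range (numIntervals B.length r), n q + β * (B.length - 1) := by
  refine (Finset.sum_le_sum fun q _ => h q).trans ?_
  rw [Finset.sum_add_distrib, ← Finset.mul_sum, ← Finset.mul_sum]
  exact Nat.add_le_add_left (Nat.mul_le_mul_left _ (sum_intervalSize_pred_le _ _)) _

/-- The recurrence for the number of feathers. -/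
theorem FeatherBound.step {r M M' α β₀ α' β' γ α₁ β₁ β : ℕ} (hr : 1 ≤ r)
    (hloc : FeatherBound α β₀ (2 ^ r)) (hcon : FeatherBound α' β' M')
    (h₁ : LengthBound 3 α₁ β₁ (2 ^ r)) (hM : M ≤ M' * 2 ^ r) (hγ : β' ≤ γ * 2 ^ r)
    (hα : α' + α₁ ≤ α + 1) (hβ : β₀ + γ + β₁ ≤ β) : FeatherBound α β M := by
  intro B hB hl d
  -- A composition needs more than one interval; a shorter sequence is covered by the local bound.
  by_cases hm : 2 ^ r < B.length
  swap
  · exact hloc.mono le_rfl (by omega) le_rfl B hB (not_lt.1 hm) d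
  set S := blocksOf B with hSdef
  have hS : ∀ a p, a ∈ S p → p < B.length := fun a p => lt_length_of_mem_blocksOf
  have hsz : ∀ q, intervalSize B.length r q ≤ 2 ^ r := fun q => min_le_left _ _
  have hlen : ∀ P q, (proj P (chunk B r q)).length = intervalSize B.length r q :=
    fun P q => by rw [length_proj, length_chunk]
  obtain ⟨top, htop⟩ := hcon.exists (isBlocked_contractedList hB r)
    (by rw [length_contractedList]; exact numIntervals_le (hl.trans hM)) d
    (length_contractedList B r) (blocksOf_contractedList B r)
  choose loc hlocq using fun q => hloc.exists (hB.proj_chunk (fun a => ¬ IsGlobal S r a) r q)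
    ((hlen _ q).trans_le (hsz q)) d (hlen _ q) (blocksOf_local B r q)
  refine ⟨.comp r hr hm top loc, ?_⟩
  have hcover : (DTree.comp r hr hm top loc).featherCount S d ≤
      ∑ q ∈ Finset.range (numIntervals B.length r), (loc q).featherCount (localPart S r q) d +
      top.featherCount (contracted S r) d +
      ∑ q ∈ Finset.range (numIntervals B.length r), {x : ℕ × ℕ | x.1 ∈ extremePart S r d q x.2 ∧
        ¬ IsWingtip (extremePart S r d q) x.1 d x.2}.ncard := by
    refine ncard_le_of_cover (S := S) (d := d) (r := r)
      (finite_of_subset_occurrences (blocksOf_contractedList B r) fun _ h => h.mem)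
      (fun q => finite_of_subset_occurrences (blocksOf_local B r q) fun _ h => h.mem)
      (fun q => finite_of_subset_occurrences (blocksOf_extreme B r d q) fun _ h => h.1) ?_
    intro a p hx
    have hp : a ∈ S p := DTree.IsFeather.mem hx
    have ha := mem_interval_div (r := r) hp
    have hq := lt_numIntervals_of_mem (hS a) ha
    by_cases hg : IsGlobal S r a
    · rcases (DTree.isFeather_of_isGlobal hS hg).1 hx with ⟨h1, -, h3⟩ | h
      · refine .inr (.inr ⟨_, hq, _, (Nat.div_add_mod' _ _).symm,
          ⟨Nat.mod_lt _ (by positivity), by rwa [Nat.div_add_mod'], hg,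
            fun q' hq' => h1.2 q' ⟨hg, hq'⟩⟩, fun h => h3 ?_⟩)
        obtain ⟨t, ht⟩ := exists_isWingtip hS hp d
        obtain ⟨t', het, ht'⟩ := h1.to_extremePart hg ht
        have he : p % 2 ^ r = t' := h.unique ht'
        rw [← Nat.div_add_mod' p (2 ^ r), he, ← het]
        exact ht
      · exact .inr (.inl h)
    · obtain ⟨p', he, h⟩ := (DTree.isFeather_of_isLocal hS hg ha).1 hx
      exact .inl ⟨_, hq, p', he, h⟩
  have e1 := sum_linear_le hlocq
  -- The projections onto first (or last) appearances have order three.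
  have e2 : ∑ q ∈ Finset.range (numIntervals B.length r),
      {x : ℕ × ℕ | x.1 ∈ extremePart S r d q x.2 ∧
        ¬ IsWingtip (extremePart S r d q) x.1 d x.2}.ncard + alphabetSize (contractedList B r) ≤
      α₁ * alphabetSize (contractedList B r) + β₁ * (B.length - 1) := by
    have h := h₁.sum_le fun q => hB.extreme r d q
    rw [sum_alphabetSize_extreme, ← alphabetSize_contractedList] at h
    refine le_trans ?_ h
    rw [alphabetSize_contractedList, ← sum_alphabetSize_extreme B r d, ← Finset.sum_add_distrib]
    refine Finset.sum_le_sum fun q _ => ?_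
    rw [hSdef, ← blocksOf_extreme]
    exact ncard_not_wingtips_add_le _ d
  have e3 := sum_alphabetSize_local_add B r
  have e4 := mul_numIntervals_pred_le (m := B.length) hγ
  rw [← e3]
  have e5 := Nat.mul_le_mul_right (alphabetSize (contractedList B r)) hα
  have e6 := Nat.mul_le_mul_right (B.length - 1) hβ
  clear_value S
  subst hSdef
  generalize alphabetSize (contractedList B r) = N at *
  nlinarith

/-- The recurrence for the number of double-feathers. -/
theorem DoubleFeatherBound.step {r M M' α β₀ α' β' γ α₁ β₁ β : ℕ} (hr : 1 ≤ r)
    (hloc : DoubleFeatherBound α β₀ (2 ^ r)) (hcon : DoubleFeatherBound α' β' M')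
    (h₁ : FeatherBound α₁ β₁ (2 ^ r)) (hM : M ≤ M' * 2 ^ r) (hγ : β' ≤ γ * 2 ^ r)
    (hα : α' + 2 * (α₁ + 1) ≤ α) (hβ : β₀ + γ + 2 * β₁ ≤ β) : DoubleFeatherBound α β M := by
  intro B hB hl
  by_cases hm : 2 ^ r < B.length
  swap
  · exact hloc.mono le_rfl (by omega) le_rfl B hB (not_lt.1 hm)
  set S := blocksOf B with hSdef
  have hS : ∀ a p, a ∈ S p → p < B.length := fun a p => lt_length_of_mem_blocksOf
  have hsz : ∀ q, intervalSize B.length r q ≤ 2 ^ r := fun q => min_le_left _ _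
  have hlen : ∀ P q, (proj P (chunk B r q)).length = intervalSize B.length r q :=
    fun P q => by rw [length_proj, length_chunk]
  obtain ⟨top, htop⟩ := hcon.exists (isBlocked_contractedList hB r)
    (by rw [length_contractedList]; exact numIntervals_le (hl.trans hM))
    (length_contractedList B r) (blocksOf_contractedList B r)
  choose loc hlocq using fun q => hloc.exists (hB.proj_chunk (fun a => ¬ IsGlobal S r a) r q)
    ((hlen _ q).trans_le (hsz q)) (hlen _ q) (blocksOf_local B r q)
  choose sup hsup using fun d q => h₁.exists (hB.extreme r d q)
    ((hlen _ q).trans_le (hsz q)) d (hlen _ q) (blocksOf_extreme B r d q)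
  refine ⟨.comp r hr hm top loc sup, ?_⟩
  have hcover : ∀ d, (Ensemble.comp r hr hm top loc sup).sideCount S d ≤
      ∑ q ∈ Finset.range (numIntervals B.length r), (loc q).sideCount (localPart S r q) d +
      top.sideCount (contracted S r) d +
      ∑ q ∈ Finset.range (numIntervals B.length r), {x : ℕ × ℕ |
        (sup d q).IsFeather (extremePart S r d q) x.1 d x.2 ∨
        IsWingtip (extremePart S r d q) x.1 d.opp x.2}.ncard := by
    intro d
    refine ncard_le_of_cover (S := S) (d := d) (r := r)
      (finite_of_subset_occurrences (blocksOf_contractedList B r) fun _ h => h.mem)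
      (fun q => finite_of_subset_occurrences (blocksOf_local B r q) fun _ h => h.mem)
      (fun q => finite_of_subset_occurrences (blocksOf_extreme B r d q) fun _ h =>
        h.elim (fun h => h.mem) fun h => h.1) ?_
    intro a p hx
    have hp : a ∈ S p := Ensemble.IsDoubleFeather.mem hx
    have ha := mem_interval_div (r := r) hp
    have hq := lt_numIntervals_of_mem (hS a) ha
    by_cases hg : IsGlobal S r a
    · rcases (Ensemble.isDoubleFeather_of_isGlobal hS hg).1 hx with ⟨-, -, -, h⟩ | h
      · exact .inr (.inr ⟨_, hq, _, (Nat.div_add_mod' _ _).symm, h⟩)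
      · exact .inr (.inl h)
    · obtain ⟨p', he, h⟩ := (Ensemble.isDoubleFeather_of_isLocal hS hg ha).1 hx
      exact .inl ⟨_, hq, p', he, h⟩
  have e1 := sum_linear_le hlocq
  rw [Finset.sum_add_distrib] at e1
  -- Each global symbol adds, on each side, the feathers of its superimposed tree and one opposite
  -- wingtip; hence `2 * (α₁ + 1)`.
  have e2 : ∀ d, ∑ q ∈ Finset.range (numIntervals B.length r), {x : ℕ × ℕ |
        (sup d q).IsFeather (extremePart S r d q) x.1 d x.2 ∨
        IsWingtip (extremePart S r d q) x.1 d.opp x.2}.ncard ≤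
      α₁ * alphabetSize (contractedList B r) + β₁ * (B.length - 1) +
        alphabetSize (contractedList B r) := by
    intro d
    have h := sum_linear_le (hsup d)
    rw [sum_alphabetSize_extreme, ← alphabetSize_contractedList] at h
    refine le_trans ?_ (Nat.add_le_add_right h _)
    nth_rewrite 1 [alphabetSize_contractedList]
    rw [← sum_alphabetSize_extreme B r d, ← Finset.sum_add_distrib]
    refine Finset.sum_le_sum fun q _ => ?_
    refine (Set.ncard_union_le _ _).trans (Nat.add_le_add_left ?_ _)
    rw [hSdef, ← blocksOf_extreme]
    exact (ncard_wingtips _ d.opp).le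
  have e3 := sum_alphabetSize_local_add B r
  have e4 := mul_numIntervals_pred_le (m := B.length) hγ
  rw [← e3]
  have e5 := Nat.mul_le_mul_right (alphabetSize (contractedList B r)) hα
  have e6 := Nat.mul_le_mul_right (B.length - 1) hβ
  have e7 := hcover .dove
  have e8 := hcover .hawk
  have e9 := e2 .dove
  have e10 := e2 .hawk
  clear_value S
  subst hSdef
  generalize alphabetSize (contractedList B r) = N at *
  nlinarith


/-! ### The recurrence for order five -/

theorem pair_sublist_flatten {C : List (List ℕ)} {p₁ p₂ a b : ℕ} (h : p₁ < p₂)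
    (ha : a ∈ blocksOf C p₁) (hb : b ∈ blocksOf C p₂) : [a, b].Sublist C.flatten := by
  rw [← List.take_append_drop p₂ C, List.flatten_append]
  exact (List.singleton_sublist.2 (mem_take_flatten.2 ⟨p₁, h, ha⟩)).append
    (List.singleton_sublist.2 (mem_drop_flatten.2 ⟨p₂, le_rfl, hb⟩))

theorem pair_sublist_take {B : List (List ℕ)} {r q q₁ q₂ a b : ℕ} (h : q₁ < q₂) (hq : q₂ < q)
    (ha : a ∈ intervalAlphabet (blocksOf B) r q₁) (hb : b ∈ intervalAlphabet (blocksOf B) r q₂) :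
    [a, b].Sublist (B.take (q * 2 ^ r)).flatten := by
  obtain ⟨p₁, rfl, ha⟩ := ha
  obtain ⟨p₂, rfl, hb⟩ := hb
  have h1 := lt_of_not_ge fun hc => h.not_ge (Nat.div_le_div_right (c := 2 ^ r) hc)
  have h2 := (Nat.div_lt_iff_lt_mul (by positivity)).1 hq
  exact pair_sublist_flatten h1 (mem_blocksOf_take.2 ⟨h1.trans h2, ha⟩)
    (mem_blocksOf_take.2 ⟨h2, hb⟩)

theorem pair_sublist_drop {B : List (List ℕ)} {r q q₁ q₂ a b : ℕ} (hq : q < q₁) (h : q₁ < q₂)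
    (ha : a ∈ intervalAlphabet (blocksOf B) r q₁) (hb : b ∈ intervalAlphabet (blocksOf B) r q₂) :
    [a, b].Sublist (B.drop ((q + 1) * 2 ^ r)).flatten := by
  obtain ⟨p₁, rfl, ha⟩ := ha
  obtain ⟨p₂, rfl, hb⟩ := hb
  have h1 := lt_of_not_ge fun hc => h.not_ge (Nat.div_le_div_right (c := 2 ^ r) hc)
  have h2 : (q + 1) * 2 ^ r ≤ p₁ := (Nat.le_div_iff_mul_le (by positivity)).1 hq
  refine pair_sublist_flatten (p₁ := p₁ - (q + 1) * 2 ^ r) (p₂ := p₂ - (q + 1) * 2 ^ r)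
    (by omega) (mem_blocksOf_drop.2 ?_) (mem_blocksOf_drop.2 ?_)
  · rwa [Nat.add_sub_cancel' h2]
  · rwa [Nat.add_sub_cancel' (h2.trans h1.le)]

/-- Middle symbols of one side without double-feathers form an order-`2` sequence. -/
theorem IsBlocked.two_of_not_isDoubleFeather {B : List (List ℕ)} (hB : IsBlocked 5 B) {r q : ℕ}
    (E : Ensemble (numIntervals B.length r)) (d : Side) {P : ℕ → Prop}
    (hP : ∀ a, P a → IsMiddle (blocksOf B) r q a ∧
      ¬ E.IsDoubleFeather (contracted (blocksOf B) r) a d q ∧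
      (a ∈ intervalAlphabet (blocksOf B) r q → SameSide (contracted (blocksOf B) r) a d q)) :
    IsBlocked 2 (proj P (chunk B r q)) where
  nodup := nodup_of_mem_proj_chunk hB.nodup P r q
  isDS := by
    intro a b hab hs
    have hS := support_contracted (S := blocksOf B)
      (fun _ _ => lt_length_of_mem_blocksOf) r
    have key : ∀ x ∈ (proj P (chunk B r q)).flatten,
        x ∈ contracted (blocksOf B) r q ∧ SameSide (contracted (blocksOf B) r) x d q ∧
        HasInner (contracted (blocksOf B) r) x d q ∧ x ∈ (B.take (q * 2 ^ r)).flatten ∧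
        x ∈ (B.drop ((q + 1) * 2 ^ r)).flatten := by
      intro x hx
      obtain ⟨hx, hPx⟩ := mem_proj_chunk_flatten.1 hx
      obtain ⟨⟨hg, hd, hh⟩, hdf, hss⟩ := hP x hPx
      obtain ⟨q₁, h1, h1'⟩ := exists_of_not_isExtreme_dove hd
      obtain ⟨q₂, h2, h2'⟩ := exists_of_not_isExtreme_hawk hh
      -- A middle appearance is neither the first nor the last, so `q` is no wingtip.
      have hw : ¬ IsWingtip (contracted (blocksOf B) r) x d q := by
        intro hw
        cases d
        · exact hd fun q' hq' => hw.2 q' ⟨hg, hq'⟩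
        · exact hh fun q' hq' => hw.2 q' ⟨hg, hq'⟩
      exact ⟨⟨hg, hx⟩, hss hx, E.hasInner_of_not_isDoubleFeather hS ⟨hg, hx⟩ (hss hx) hw hdf,
        mem_take_flatten_of_interval h1' h1, mem_drop_flatten_of_interval h2' h2⟩
    obtain ⟨ha1, ha2, ha3, -, ha5⟩ := key a (hs.subset (by simp [alternating]))
    obtain ⟨hb1, hb2, hb3, hb4, -⟩ := key b (hs.subset (by simp [alternating]))
    have hs' := hs.trans (flatten_proj_chunk_sublist P B r q)
    -- With `ab` before the interval the alternation is `ab·abab·a`; with `ab` after it,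
    -- `b·abab·ab`. Both have length seven.
    rcases exists_pair_of_hasInner ha1 hb1 ha2 hb2 ha3 hb3 with
      ⟨q₁, q₂, h1, h2, h3, h4⟩ | ⟨q₁, q₂, h1, h2, h3, h4⟩
    · refine hB.isDS a b hab ?_
      rw [flatten_split B r q]
      exact ((pair_sublist_take h1 h2 h3.2 h4.2).append hs').append (List.singleton_sublist.2 ha5)
    · refine hB.isDS b a hab.symm ?_
      rw [flatten_split B r q]
      exact ((List.singleton_sublist.2 hb4).append hs').append (pair_sublist_drop h1 h2 h3.2 h4.2)

theorem sum_alphabetSize_doubleFeather_le (B : List (List ℕ)) (r : ℕ)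
    (E : Ensemble (numIntervals B.length r)) :
    ∑ q ∈ Finset.range (numIntervals B.length r), alphabetSize
      (proj (fun a => IsMiddle (blocksOf B) r q a ∧
        ∃ d, E.IsDoubleFeather (contracted (blocksOf B) r) a d q) (chunk B r q)) ≤
    E.sideCount (contracted (blocksOf B) r) .dove +
      E.sideCount (contracted (blocksOf B) r) .hawk := by
  simp only [alphabetSize_proj]
  rw [← Finset.card_sigma]
  have hf : ∀ d, {x : ℕ × ℕ | E.IsDoubleFeather (contracted (blocksOf B) r) x.1 d x.2}.Finite :=
    fun d => finite_of_subset_occurrences (blocksOf_contractedList B r) fun _ h => h.mem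
  refine le_trans ?_ (Set.ncard_union_le _ _)
  rw [← Set.ncard_coe_finset]
  refine Set.ncard_le_ncard_of_injOn (fun y : (_ : ℕ) × ℕ => (y.2, y.1)) ?_ ?_
    ((hf .dove).union (hf .hawk))
  · rintro ⟨q, a⟩ h
    simp only [Finset.coe_sigma, Set.mem_sigma_iff, Finset.mem_coe, Finset.mem_filter] at h
    obtain ⟨d, hd⟩ := h.2.2.2
    cases d
    · exact .inl hd
    · exact .inr hd
  · rintro ⟨q, a⟩ - ⟨q', a'⟩ - h
    simp only [Prod.mk.injEq] at h
    obtain ⟨rfl, rfl⟩ := h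
    rfl

/-- `Xᵢ` and `Yᵢ` are alphabet sizes and lengths of the three classes of middle appearances:
double-feathers, the rest on the left, the rest on the right. Since `X₂ + X₃ ≤ α' N + γ k - 2 N`,
the order-two coefficient `2` accounts for `2 * α'` and for the `4` gained. -/
theorem orderFive_recurrence_arith {l n N k X₁ X₂ X₃ Y₁ Y₂ Y₃ α β₀ α' γ α₃ β₃ α₄ β₄ αD γD β : ℕ}
    (hl : l ≤ α * n + β₀ * k + 2 * (α₄ * N + β₄ * k) + (Y₁ + (Y₂ + Y₃)))
    (h₁ : Y₁ ≤ α₃ * X₁ + β₃ * k) (h₂ : Y₂ ≤ 2 * X₂ + 1 * k) (h₃ : Y₃ ≤ 2 * X₃ + 1 * k)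
    (hD : α₃ * X₁ ≤ α₃ * (αD * N + γD * k)) (hX : X₁ + (X₂ + X₃) + 2 * N ≤ α' * N + γ * k)
    (hα : (2 * α₄ + α₃ * αD + 2 * α') * N ≤ (α + 4) * N)
    (hβ : (β₀ + 2 * β₄ + α₃ * γD + β₃ + 2 * γ + 2) * k ≤ β * k) : l ≤ α * (n + N) + β * k := by
  nlinarith

/-- The recurrence for `λ_5`: middle appearances are separated according to whether they are
double-feathers in the ensemble of the contracted sequence. -/
theorem LengthBound.orderFive_recurrence {r M M' α β₀ α' β' γ α₃ β₃ α₄ β₄ αD βD γD β : ℕ}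
    (hloc : LengthBound 5 α β₀ (2 ^ r)) (hcon : LengthBound 5 α' β' M')
    (hD : DoubleFeatherBound αD βD M') (h₄ : LengthBound 4 α₄ β₄ (2 ^ r))
    (h₃ : LengthBound 3 α₃ β₃ (2 ^ r)) (hM : M ≤ M' * 2 ^ r) (hγ : β' ≤ γ * 2 ^ r)
    (hγD : βD ≤ γD * 2 ^ r) (hα : 2 * α₄ + α₃ * αD + 2 * α' ≤ α + 4)
    (hβ : β₀ + 2 * β₄ + α₃ * γD + β₃ + 2 * γ + 2 ≤ β) : LengthBound 5 α β M := by
  intro B hB hl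
  obtain ⟨n, hn, hlen⟩ := hB.length_le_add_middle hloc h₄
  have hM' : numIntervals B.length r ≤ M' := numIntervals_le (hl.trans hM)
  have hc := hcon _ (isBlocked_contractedList hB r) (by rwa [length_contractedList])
  obtain ⟨E, hE⟩ := hD.exists (isBlocked_contractedList hB r) (by rwa [length_contractedList])
    (length_contractedList B r) (blocksOf_contractedList B r)
  rw [length_contractedList] at hc
  let DF : ℕ → ℕ → Prop := fun q a =>
    ∃ d, E.IsDoubleFeather (contracted (blocksOf B) r) a d q
  let SD : ℕ → ℕ → Prop := fun q a => SameSide (contracted (blocksOf B) r) a .dove q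
  have hS := support_contracted (S := blocksOf B) (fun _ _ => lt_length_of_mem_blocksOf) r
  have s1 := h₃.sum_le (B := B) (P := fun q a => IsMiddle (blocksOf B) r q a ∧ DF q a)
    fun q => hB.proj_chunk_of_middle fun _ _ ha =>
      ⟨exists_of_not_isExtreme_dove ha.1.2.1, exists_of_not_isExtreme_hawk ha.1.2.2⟩
  have s2 := (lengthBound_two (2 ^ r)).sum_le (B := B)
    (P := fun q a => (IsMiddle (blocksOf B) r q a ∧ ¬ DF q a) ∧ SD q a)
    fun q => hB.two_of_not_isDoubleFeather E .dove fun a ha =>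
      ⟨ha.1.1, fun h => ha.1.2 ⟨_, h⟩, fun _ => ha.2⟩
  have s3 := (lengthBound_two (2 ^ r)).sum_le (B := B)
    (P := fun q a => (IsMiddle (blocksOf B) r q a ∧ ¬ DF q a) ∧ ¬ SD q a)
    -- A middle symbol has a second occurrence, so one not on the left side is on the right side.
    fun q => hB.two_of_not_isDoubleFeather E .hawk fun a ha => by
      refine ⟨ha.1.1, fun h => ha.1.2 ⟨_, h⟩, fun hi => ?_⟩
      obtain ⟨q', hq', hi'⟩ := exists_of_not_isExtreme_dove ha.1.1.2.1
      exact (sameSide_or hS ⟨ha.1.1.1, hi⟩ ⟨ha.1.1.1, hi'⟩ hq'.ne' .dove).resolve_left ha.2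
  have hD' := (sum_alphabetSize_doubleFeather_le B r E).trans hE
  have hlen3 : ∑ q ∈ Finset.range (numIntervals B.length r),
      (proj (IsMiddle (blocksOf B) r q) (chunk B r q)).flatten.length = _ :=
    Finset.sum_congr rfl fun q _ => by
      rw [length_flatten_proj_add (IsMiddle (blocksOf B) r q) (DF q) (chunk B r q),
        length_flatten_proj_add (fun a => IsMiddle (blocksOf B) r q a ∧ ¬ DF q a) (SD q)
          (chunk B r q)]
  have halph3 : ∑ q ∈ Finset.range (numIntervals B.length r),
      alphabetSize (proj (IsMiddle (blocksOf B) r q) (chunk B r q)) = _ :=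
    Finset.sum_congr rfl fun q _ => by
      rw [alphabetSize_proj_add (IsMiddle (blocksOf B) r q) (DF q) (chunk B r q),
        alphabetSize_proj_add (fun a => IsMiddle (blocksOf B) r q a ∧ ¬ DF q a) (SD q)
          (chunk B r q)]
  rw [Finset.sum_add_distrib, Finset.sum_add_distrib] at hlen3 halph3
  have hcount := sum_alphabetSize_middle B r
  have e1 := mul_numIntervals_pred_le (m := B.length) hγ
  have e2 := mul_numIntervals_pred_le (m := B.length) hγD
  rw [← hn]
  have e3 := Nat.mul_le_mul_right (alphabetSize (contractedList B r)) hα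
  have e4 := Nat.mul_le_mul_right (B.length - 1) hβ
  have e5 := Nat.mul_le_mul_left α₃ (hD'.trans (Nat.add_le_add_left e2 _))
  have e6 := hc.trans (Nat.add_le_add_left e1 _)
  rw [← hcount, halph3] at e6
  rw [hlen3] at hlen
  exact orderFive_recurrence_arith hlen s1 s2 s3 e5 e6 e3 e4


/-! ### Ackermann induction -/

theorem acker_one (j : ℕ) : acker 1 j = 2 ^ j := by rw [acker]

theorem acker_at_one {i : ℕ} (hi : 1 ≤ i) : acker i 1 = 2 := by
  obtain _ | _ | i := i
  · omega
  · rw [acker_one, pow_one]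
  · rw [acker]

theorem acker_succ_succ {i j : ℕ} (hi : 1 ≤ i) (hj : 1 ≤ j) :
    acker (i + 1) (j + 1) = acker (i + 1) j * acker i (acker (i + 1) j) := by
  obtain _ | i := i
  · omega
  obtain _ | j := j
  · omega
  rw [acker]

/-- Permissible partitions have widths that are powers of two, so `w ^ 3` has to be one. -/
theorem exists_acker_eq_two_pow {i : ℕ} (hi : 1 ≤ i) :
    ∀ {j : ℕ}, 1 ≤ j → ∃ e, 1 ≤ e ∧ acker i j = 2 ^ e := by
  induction i, hi using Nat.le_induction with
  | base => exact fun {j} hj => ⟨j, hj, acker_one j⟩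
  | succ i hi ih =>
    intro j hj
    induction j, hj using Nat.le_induction with
    | base => exact ⟨1, le_rfl, acker_at_one (by omega)⟩
    | succ j hj ihj =>
      obtain ⟨e, he, hw⟩ := ihj
      obtain ⟨e', -, hw'⟩ := ih (j := acker (i + 1) j) (by rw [hw]; exact Nat.one_le_two_pow)
      exact ⟨e + e', by omega, by rw [acker_succ_succ hi hj, hw', hw, pow_add]⟩

/-- Since `a_{i+1,j+1} = w * a_{i,w}`, intervals of `w ^ 3` blocks number at most `a_{i,w} ^ 3`: the
intervals fall under `R (i + 1) j` and the contracted sequence under `R i w`. -/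
theorem acker_induction {R : ℕ → ℕ → Prop} (base : ∀ j, 1 ≤ j → R 1 j)
    (one : ∀ i, 1 ≤ i → R i 1 → R (i + 1) 1)
    (step : ∀ i j r w, 1 ≤ i → 1 ≤ j → 1 ≤ r → w = acker (i + 1) j → 2 ^ r = w ^ 3 →
      acker (i + 1) (j + 1) ^ 3 = acker i w ^ 3 * 2 ^ r →
      R (i + 1) j → R i w → R (i + 1) (j + 1)) :
    ∀ i j, 1 ≤ i → 1 ≤ j → R i j := by
  intro i j hi
  induction i, hi using Nat.le_induction generalizing j with
  | base => exact base j
  | succ i hi ih =>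
    intro hj
    induction j, hj using Nat.le_induction with
    | base => exact one i hi (ih 1 le_rfl)
    | succ j hj ihj =>
      obtain ⟨e, he, hw⟩ := exists_acker_eq_two_pow (i := i + 1) (by omega) hj
      have h2 : 2 ^ (3 * e) = acker (i + 1) j ^ 3 := by rw [hw, ← pow_mul, mul_comm]
      refine step i j (3 * e) _ hi hj (by omega) rfl h2 ?_ ihj
        (ih _ (by rw [hw]; exact Nat.one_le_two_pow))
      rw [h2, acker_succ_succ hi hj]; ring

/-- This is where `c = 3` matters: the width `w ^ 3` must absorb the factor `w ^ e` for every
exponent up to that of order five. -/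
theorem mul_three_pow_le {a w r : ℕ} (h : 2 ^ r = w ^ 3) (hw : 1 ≤ w) {e : ℕ} (he : e ≤ 3) :
    a * (3 * w) ^ e ≤ a * 3 ^ e * 2 ^ r := by
  rw [h, mul_pow, mul_assoc]
  exact Nat.mul_le_mul_left _ (Nat.mul_le_mul_left _ (Nat.pow_le_pow_right hw he))

theorem one_le_of_two_pow_eq {w r : ℕ} (h : 2 ^ r = w ^ 3) : 1 ≤ w := by
  rcases Nat.eq_zero_or_pos w with rfl | hw
  · simp at h
  · exact hw

/-! ### Orders three to five -/

theorem lengthBound_self (s M : ℕ) : LengthBound s M 0 M := by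
  intro B hB hl
  have h := IsBlockedDS.length_flatten_le (s := s) (n := alphabetSize B) (m := M)
    ⟨hB.nodup, hl, rfl, hB.isDS⟩
  rw [mul_comm]; omega

/-- Binary halving, the case `i = 1`: with two intervals there are no middle appearances, so the
contracted sequence needs only the trivial length bound, with `γ = 0`. -/
theorem lengthBound_three_two_pow (k : ℕ) : LengthBound 3 4 (4 * k) (2 ^ k) := by
  induction k with
  | zero => exact (lengthBound_self 3 1).mono (by omega) (by omega) le_rfl
  | succ k ih =>
    exact LengthBound.step (s := 1) (γ := 0) ih (lengthBound_self 3 2) (lengthBound_two _)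
      (lengthBound_one _) (by rw [pow_succ']) (by omega) (by omega) (by omega)

theorem lengthBound_three (i j : ℕ) (hi : 1 ≤ i) (hj : 1 ≤ j) :
    LengthBound 3 (2 * i + 2) ((2 * i + 2) * (3 * j) ^ 1) (acker i j ^ 3) := by
  refine acker_induction (R := fun i j =>
    LengthBound 3 (2 * i + 2) ((2 * i + 2) * (3 * j) ^ 1) (acker i j ^ 3)) ?_ ?_ ?_ i j hi hj
  · intro j _
    rw [acker_one, ← pow_mul, mul_comm j 3, pow_one]
    exact lengthBound_three_two_pow _
  · intro i hi h
    rw [acker_at_one (by omega)] at h ⊢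
    exact h.mono (by omega) (by omega) le_rfl
  · intro i j r w _ _ _ hw hr hM hloc hcon
    rw [← hw, ← hr] at hloc
    refine LengthBound.step (s := 1) hloc hcon (lengthBound_two _) (lengthBound_one _) hM.le
      (mul_three_pow_le hr (one_le_of_two_pow_eq hr) (by omega)) (by omega) ?_
    nlinarith

theorem lengthBound_four_two_pow (k : ℕ) : LengthBound 4 8 (8 * k ^ 2) (2 ^ k) := by
  induction k with
  | zero => exact (lengthBound_self 4 1).mono (by omega) (by omega) le_rfl
  | succ k ih =>
    exact LengthBound.step (s := 2) (γ := 0) ih (lengthBound_self 4 2)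
      (lengthBound_three_two_pow k) (lengthBound_two _) (by rw [pow_succ']) (by omega) (by omega)
      (by nlinarith)

/-- The coefficient `10 · 2^i - 4i - 8` of `n` in the bound for order four. -/
def fourCoeff : ℕ → ℕ
  -- The value at `0` is chosen to give `8` at `1`; the recursion is the case of equality in the
  -- condition on `α` in `LengthBound.step`.
  | 0 => 2
  | i + 1 => 2 * fourCoeff i + 4 * (i + 1)

theorem fourCoeff_add (i : ℕ) : fourCoeff i + 4 * i + 8 = 10 * 2 ^ i := by
  induction i with
  | zero => rfl
  | succ i ih => rw [fourCoeff, pow_succ]; omega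

theorem lengthBound_four (i j : ℕ) (hi : 1 ≤ i) (hj : 1 ≤ j) :
    LengthBound 4 (fourCoeff i) (fourCoeff i * (3 * j) ^ 2) (acker i j ^ 3) := by
  refine acker_induction (R := fun i j =>
    LengthBound 4 (fourCoeff i) (fourCoeff i * (3 * j) ^ 2) (acker i j ^ 3)) ?_ ?_ ?_ i j hi hj
  · intro j _
    rw [acker_one, ← pow_mul, mul_comm j 3]
    exact lengthBound_four_two_pow _
  · intro i hi h
    rw [acker_at_one (by omega)] at h ⊢
    have h1 : fourCoeff i ≤ fourCoeff (i + 1) := by rw [fourCoeff]; omega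
    exact h.mono h1 (Nat.mul_le_mul_right _ h1) le_rfl
  · intro i j r w _ hj _ hw hr hM hloc hcon
    have h3 := lengthBound_three (i + 1) j (by omega) hj
    rw [← hw, ← hr] at hloc h3
    refine LengthBound.step (s := 2) hloc hcon h3 (lengthBound_two _) hM.le
      (mul_three_pow_le hr (one_le_of_two_pow_eq hr) (by omega)) ?_ ?_
    · rw [fourCoeff]; omega
    · rw [fourCoeff]
      generalize fourCoeff i = a
      have : 0 ≤ a * j := by positivity
      have : 0 ≤ i * j := by positivity
      nlinarith

/-! ### Feathers and double-feathers -/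

theorem featherBound_two_pow (k : ℕ) : FeatherBound 6 (6 * k ^ 2) (2 ^ k) := by
  induction k with
  | zero => exact featherBound_two.mono (by omega) (by omega) (by omega)
  | succ k ih =>
    -- A composition needs intervals of width at least two, so two blocks are left to the base tree.
    rcases Nat.eq_zero_or_pos k with rfl | hk
    · exact featherBound_two.mono (by omega) (by omega) (by omega)
    · exact FeatherBound.step (γ := 0) hk ih featherBound_two
        (lengthBound_three_two_pow k) (by rw [pow_succ']) (by omega) (by omega) (by nlinarith)

/-- The coefficient of `n` in the bound for feathers. -/
def featherCoeff (i : ℕ) : ℕ := 3 * (i + 1).choose 2 + 3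

theorem featherCoeff_succ (i : ℕ) : featherCoeff (i + 1) = featherCoeff i + 3 * (i + 1) := by
  rw [featherCoeff, featherCoeff, Nat.choose_succ_succ (i + 1) 1, Nat.choose_one_right]
  ring

theorem featherBound (i j : ℕ) (hi : 1 ≤ i) (hj : 1 ≤ j) :
    FeatherBound (featherCoeff i) (featherCoeff i * (3 * j) ^ 2) (acker i j ^ 3) := by
  refine acker_induction (R := fun i j =>
    FeatherBound (featherCoeff i) (featherCoeff i * (3 * j) ^ 2) (acker i j ^ 3))
    ?_ ?_ ?_ i j hi hj
  · intro j _
    rw [acker_one, ← pow_mul, mul_comm j 3]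
    exact featherBound_two_pow _
  · intro i hi h
    rw [acker_at_one (by omega)] at h ⊢
    have h1 : featherCoeff i ≤ featherCoeff (i + 1) := by rw [featherCoeff_succ]; omega
    exact h.mono h1 (Nat.mul_le_mul_right _ h1) le_rfl
  · intro i j r w hi hj hr1 hw hr hM hloc hcon
    have h3 := lengthBound_three (i + 1) j (by omega) hj
    rw [← hw, ← hr] at hloc h3
    refine FeatherBound.step hr1 hloc hcon h3 hM.le
      (mul_three_pow_le hr (one_le_of_two_pow_eq hr) (by omega)) ?_ ?_
    · rw [featherCoeff_succ]; omega
    · rw [featherCoeff_succ]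
      generalize featherCoeff i = a
      have : 0 ≤ a * j := by positivity
      have : 0 ≤ i * j := by positivity
      nlinarith

theorem doubleFeatherBound_two_pow (k : ℕ) : DoubleFeatherBound 14 (14 * k ^ 3) (2 ^ k) := by
  induction k with
  | zero => exact doubleFeatherBound_two.mono (by omega) (by omega) (by omega)
  | succ k ih =>
    rcases Nat.eq_zero_or_pos k with rfl | hk
    · exact doubleFeatherBound_two.mono (by omega) (by omega) (by omega)
    · exact DoubleFeatherBound.step (γ := 0) hk ih doubleFeatherBound_two
        (featherBound_two_pow k) (by rw [pow_succ']) (by omega) (by omega) (by nlinarith)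

/-- The coefficient of `n` in the bound for double-feathers. -/
def doubleFeatherCoeff (i : ℕ) : ℕ := 6 * (i + 2).choose 3 + 8 * i

theorem doubleFeatherCoeff_succ (i : ℕ) :
    doubleFeatherCoeff (i + 1) = doubleFeatherCoeff i + 2 * (featherCoeff (i + 1) + 1) := by
  rw [doubleFeatherCoeff, doubleFeatherCoeff, featherCoeff, Nat.choose_succ_succ (i + 2) 2]
  ring

theorem doubleFeatherBound (i j : ℕ) (hi : 1 ≤ i) (hj : 1 ≤ j) :
    DoubleFeatherBound (doubleFeatherCoeff i) (doubleFeatherCoeff i * (3 * j) ^ 3)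
      (acker i j ^ 3) := by
  refine acker_induction (R := fun i j => DoubleFeatherBound (doubleFeatherCoeff i)
    (doubleFeatherCoeff i * (3 * j) ^ 3) (acker i j ^ 3)) ?_ ?_ ?_ i j hi hj
  · intro j _
    rw [acker_one, ← pow_mul, mul_comm j 3]
    exact doubleFeatherBound_two_pow _
  · intro i hi h
    rw [acker_at_one (by omega)] at h ⊢
    have h1 : doubleFeatherCoeff i ≤ doubleFeatherCoeff (i + 1) := by
      rw [doubleFeatherCoeff_succ]; omega
    exact h.mono h1 (Nat.mul_le_mul_right _ h1) le_rfl
  · intro i j r w hi hj hr1 hw hr hM hloc hcon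
    have h3 := featherBound (i + 1) j (by omega) hj
    rw [← hw, ← hr] at hloc h3
    refine DoubleFeatherBound.step hr1 hloc hcon h3 hM.le
      (mul_three_pow_le hr (one_le_of_two_pow_eq hr) (by omega)) ?_ ?_
    · rw [doubleFeatherCoeff_succ]
    · rw [doubleFeatherCoeff_succ]
      generalize doubleFeatherCoeff i = a
      generalize featherCoeff (i + 1) = b
      have h1 : 0 ≤ a * j := by positivity
      have h2 : 0 ≤ a * j ^ 2 := by positivity
      have h3 : 0 ≤ b * j := by positivity
      have h4 : 0 ≤ b * j ^ 2 := by positivity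
      nlinarith

theorem lengthBound_five_two_pow (k : ℕ) : LengthBound 5 256 (256 * k ^ 3) (2 ^ k) := by
  induction k with
  | zero => exact (lengthBound_self 5 1).mono (by omega) (by omega) le_rfl
  | succ k ih =>
    exact LengthBound.orderFive_recurrence (γ := 0) (γD := 0) ih (lengthBound_self 5 2)
      doubleFeatherBound_two (lengthBound_four_two_pow k) (lengthBound_three_two_pow k)
      (by rw [pow_succ']) (by omega) (by omega) (by omega) (by nlinarith)

theorem six_mul_choose_three (i : ℕ) : 6 * (i + 2).choose 3 = (i + 2) * (i + 1) * i := by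
  induction i with
  | zero => rfl
  | succ i ih =>
    have h2 : 2 * (i + 2).choose 2 = (i + 2) * (i + 1) := by
      rw [Nat.choose_two_right]
      have h := Nat.two_mul_div_two_of_even (Nat.even_mul_pred_self (i + 2))
      simpa using h
    rw [Nat.choose_succ_succ (i + 2) 2]
    nlinarith

theorem quartic_le_two_pow (i : ℕ) :
    (2 * i + 4) * ((i + 2) * (i + 1) * i + 8 * i) ≤ 216 * 2 ^ i := by
  rcases lt_or_ge i 4 with h | h
  · interval_cases i <;> norm_num
  · induction i, h using Nat.le_induction with
    | base => norm_num
    | succ i hi ih =>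
      rw [pow_succ]
      obtain ⟨k, rfl⟩ := Nat.exists_eq_add_of_le hi
      ring_nf at ih ⊢
      nlinarith [sq_nonneg k, pow_nonneg (Nat.zero_le k) 3]

/-- After the doubled term, `256 * 2 ^ i` remains. The order-four coefficient takes at most `40 * 2
^ i` of it, leaving `216 * 2 ^ i` for the quartic product of the order-three and double-feather
coefficients. -/
theorem fiveCoeff_step (i : ℕ) :
    2 * fourCoeff (i + 1) + (2 * (i + 1) + 2) * doubleFeatherCoeff i + 2 * (i * 2 ^ (i + 7)) ≤
      (i + 1) * 2 ^ (i + 1 + 7) := by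
  have h1 := fourCoeff_add (i + 1)
  have h2 := quartic_le_two_pow i
  rw [doubleFeatherCoeff, six_mul_choose_three]
  have e1 : 2 ^ (i + 7) = 128 * 2 ^ i := by rw [pow_add]; norm_num [mul_comm]
  have e2 : 2 ^ (i + 1 + 7) = 256 * 2 ^ i := by rw [add_assoc, pow_add]; norm_num [mul_comm]
  rw [pow_succ] at h1
  rw [e1, e2, show 2 * (i + 1) + 2 = 2 * i + 4 by ring]
  nlinarith

theorem lengthBound_five (i j : ℕ) (hi : 1 ≤ i) (hj : 1 ≤ j) :
    LengthBound 5 (i * 2 ^ (i + 7)) (i * 2 ^ (i + 7) * (3 * j) ^ 3) (acker i j ^ 3) := by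
  refine acker_induction (R := fun i j =>
    LengthBound 5 (i * 2 ^ (i + 7)) (i * 2 ^ (i + 7) * (3 * j) ^ 3) (acker i j ^ 3))
    ?_ ?_ ?_ i j hi hj
  · intro j _
    rw [acker_one, ← pow_mul, mul_comm j 3]
    exact lengthBound_five_two_pow _
  · intro i hi h
    rw [acker_at_one (by omega)] at h ⊢
    have h1 : i * 2 ^ (i + 7) ≤ (i + 1) * 2 ^ (i + 1 + 7) :=
      Nat.mul_le_mul (by omega) (Nat.pow_le_pow_right two_pos (by omega))
    exact h.mono h1 (Nat.mul_le_mul_right _ h1) le_rfl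
  · intro i j r w hi hj hr1 hw hr hM hloc hcon
    have hw1 := one_le_of_two_pow_eq hr
    have h3 := lengthBound_three (i + 1) j (by omega) hj
    have h4 := lengthBound_four (i + 1) j (by omega) hj
    rw [← hw, ← hr] at hloc h3 h4
    have hstep := fiveCoeff_step i
    refine LengthBound.orderFive_recurrence hloc hcon (doubleFeatherBound i w hi hw1) h4 h3 hM.le
      (mul_three_pow_le hr hw1 le_rfl) (mul_three_pow_le hr hw1 le_rfl) (by omega) ?_
    have h5 : 2 * (i + 1) + 2 ≤ fourCoeff (i + 1) := by rw [fourCoeff]; omega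
    have k8 : 1 ≤ fourCoeff (i + 1) := by omega
    generalize (i + 1) * 2 ^ (i + 1 + 7) = A at *
    generalize i * 2 ^ (i + 7) = A' at *
    generalize fourCoeff (i + 1) = b at *
    generalize 2 * (i + 1) + 2 = c at *
    generalize doubleFeatherCoeff i = e at *
    -- The factor is `(3 * (j + 1)) ^ 3 - (3 * j) ^ 3`, the room between the claimed bound and the
    -- local one.
    have k1 := Nat.mul_le_mul_right (27 * (3 * j ^ 2 + 3 * j + 1)) hstep
    have k2 := Nat.mul_le_mul_right j h5
    have k3 : 0 ≤ c * e * j := by positivity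
    have k4 : 0 ≤ c * e * j ^ 2 := by positivity
    have k5 : 0 ≤ A' * j := by positivity
    have k6 : 0 ≤ A' * j ^ 2 := by positivity
    have k7 : 0 ≤ b * j ^ 2 := by positivity
    nlinarith

end DavenportSchinzel

/-! ### Passing to the extremal functions -/

theorem mainTheorem9 (n m i j : ℕ) (hm : 1 ≤ m) (hi : 1 ≤ i)
    (hj : IsLeast {j : ℕ | 1 ≤ j ∧ m ≤ DavenportSchinzel.acker i j ^ 3} j) :
    DavenportSchinzel.maxFeathers n m ≤
        (3 * (i + 1).choose 2 + 3) * (n + (3 * j) ^ 2 * (m - 1)) ∧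
      DavenportSchinzel.maxDoubleFeathers n m ≤
        (6 * (i + 2).choose 3 + 8 * i) * (n + (3 * j) ^ 3 * (m - 1)) ∧
      DavenportSchinzel.dsLength 5 n m ≤
        (i * 2 ^ (i + 7)) * (n + (3 * j) ^ 3 * (m - 1)) := by
  open DavenportSchinzel in
  obtain ⟨⟨hj1, hmj⟩, -⟩ := hj
  have key : ∀ {s : ℕ} {B : List (List ℕ)} {α β : ℕ}, IsBlockedDS s n m B →
      α * alphabetSize B + α * β * (B.length - 1) ≤ α * (n + β * (m - 1)) := by
    intro s B α β hB
    rw [alphabetSize, hB.card_alphabet, mul_add, mul_assoc]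
    exact Nat.add_le_add_left (Nat.mul_le_mul_left _ (Nat.mul_le_mul_left _
      (Nat.sub_le_sub_right hB.length_le 1))) _
  refine ⟨csSup_le' ?_, csSup_le' ?_, csSup_le' ?_⟩
  · rintro k ⟨B, hB, d, rfl⟩
    obtain ⟨T, hT⟩ := featherBound i j hi hj1 B ⟨hB.nodup, hB.isDS⟩ (hB.length_le.trans hmj) d
    exact (ciInf_le (OrderBot.bddBelow _) T).trans (hT.trans (key hB))
  · rintro k ⟨B, hB, rfl⟩
    obtain ⟨E, hE⟩ := doubleFeatherBound i j hi hj1 B ⟨hB.nodup, hB.isDS⟩ (hB.length_le.trans hmj)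
    refine (ciInf_le (OrderBot.bddBelow _) E).trans (le_trans ?_ (hE.trans (key hB)))
    -- The occurrences that are double-feathers of some type number at most the sum of the counts
    -- for the two types.
    refine (Set.ncard_le_ncard_of_injOn id ?_ Function.injective_id.injOn ?_).trans
      (Set.ncard_union_le {x : ℕ × ℕ | E.IsDoubleFeather (blocksOf B) x.1 .dove x.2}
        {x : ℕ × ℕ | E.IsDoubleFeather (blocksOf B) x.1 .hawk x.2})
    · rintro x ⟨d, hd⟩
      cases d
      · exact .inl hd
      · exact .inr hd
    · exact (finite_of_subset_occurrences rfl fun _ h => h.mem).union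
        (finite_of_subset_occurrences rfl fun _ h => h.mem)
  · rintro k ⟨B, hB, rfl⟩
    exact (lengthBound_five i j hi hj1 B ⟨hB.nodup, hB.isDS⟩ (hB.length_le.trans hmj)).trans
      (key hB)
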